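/- All manifolds and maps are smooth ($C^\infty$). Let $f:M^n\to\mathbb R^{n+p}$ and $\hat f:M^n\to\mathbb R^{n+q}$ be isometric immersions of a Riemannian manifold. They *singularly extend isometrically* if there are a manifold $N^{n+s}$ with $s>0$, an embedding $j:M^n\to N^{n+s}$, and maps $F:N\to\mathbb R^{n+p}$, $\hat F:N\to\mathbb R^{n+q}$ inducing the same (possibly degenerate) metric on $N$, such that $f=F\circ j$, $\hat f=\hat F\circ j$, and $F$ and $\hat F$ are immersions outside $j(M)$. We call $\hat f$ a *strongly genuine deformation* of $f$ if there is no nonempty open $U\subset M$ such that $f|_U$ and $\hat f|_U$ singularly extend isometrically. Let $L\subset T_f^\perp M$ and $\hat L\subset T_{\hat f}^\perp M$ be normal subbundles of rank $\ell\ge 0$ and $\tau:L\to\hat L$ a vector bundle isometry which preserves second fundamental forms, $\tau\circ\alpha_L=\hat\alpha_{\hat L}$, and is parallel, $\tau(\nabla^\perp_X\xi)_L=(\hat\nabla^\perp_X\tau\xi)_{\hat L}$ for $X\in TM$ and sections $\xi$ of $L$ (subindices denote orthogonal projections). Put $\bar\tau=\mathrm{Id}\oplus\tau:TM\oplus L\to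 TM\oplus\hat L$ and $$\phi_\tau:TM\times(TM\oplus L)\to L^\perp\times\hat L^\perp,\qquad \phi_\tau(X,v)=\big((\tilde\nabla_Xv)_{L^\perp},(\tilde\nabla_X\bar\tau v)_{\hat L^\perp}\big),$$ where $\tilde\nabla$ is the Euclidean connection and $L^\perp$, $\hat L^\perp$ are the orthogonal complements in the normal bundles. Let $\phi_\tau^Y=\phi_\tau(Y,\cdot)$ and $i(\phi_\tau)(x)=\max\{\operatorname{rank}\phi_\tau^X: X\in T_xM\}$; $Y\in T_xM$ is a *regular element* if $\operatorname{rank}\phi_\tau^Y=i(\phi_\tau)(x)$. Two immersions are *mutually $\bar D$-ruled* for a rank $d$ distribution $D\subset TM$ if through each point $x$ there is a totally geodesic submanifold of $M$ tangent to $D(x)$ at $x$ which is mapped by both immersions onto open subsets of $d$-dimensional affine subspaces. They are *mutually $d$-ruled* if there is a totally geodesic distribution $D\subset TM$ of rank $d$ whose leaves are mapped by both immersions onto open subsets of $d$-dimensional affine subspaces. **Theorem.** If $\hat f$ is a strongly genuine deformation of $f$ and $\tau$ is as above, then there is an open dense subset $V\subset M$ such that along each connected component $C$ of $V$ the following hold.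 1. $i(\phi_\tau)$ is constant on $C$. 2. Let $d=n+\ell-i(\phi_\tau)$. For every smooth vector field $Y$ of regular elements of $\phi_\tau$ defined on $C$, or on an open subset of $C$, the bundle $D_Y=\ker\phi_\tau^Y$ is contained in $TM$ and has rank $d$, and on the domain of $Y$ the immersions $f$ and $\hat f$ are mutually $\bar D_Y$-ruled. 3. $f$ and $\hat f$ are mutually $d$-ruled along $C$, and $d\ge n-p-q+3\ell$. -/

import Mathlib

open scoped Manifold ContDiff Topology

universe u

noncomputable section

/-- Euclidean space `ℝᵐ` with its standard inner product. -/
abbrev Euc (m : ℕ) : Type := EuclideanSpace ℝ (Fin m)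

section General

variable {n m : ℕ} {M : Type u} [TopologicalSpace M] [ChartedSpace (Euc n) M]

/-- The differential `f_*` at `x` of a map into Euclidean space. -/
def diff (f : M → Euc m) (x : M) : TangentSpace (𝓡 n) x →L[ℝ] Euc m :=
  mfderiv (𝓡 n) (𝓡 m) f x

/-- The image `f_* T_xM` of the tangent space, as a subspace of the ambient Euclidean space. -/
def tangentImage (f : M → Euc m) (x : M) : Submodule ℝ (Euc m) :=
  LinearMap.range (diff (n := n) f x : TangentSpace (𝓡 n) x →ₗ[ℝ] Euc m)

/-- `f` is an isometric immersion of the Riemannian manifold `(M, g)`: it is smooth and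
`g` is the metric induced by `f` (so that `f_*` is injective, `g` being positive definite). -/
def IsIsometricImmersion [IsManifold (𝓡 n) ∞ M]
    (g : Bundle.ContMDiffRiemannianMetric (𝓡 n) ∞ (Euc n)
      (fun x : M => TangentSpace (𝓡 n) x))
    (f : M → Euc m) : Prop :=
  ContMDiff (𝓡 n) (𝓡 m) ∞ f ∧
    ∀ (x : M) (v w : TangentSpace (𝓡 n) x),
      g.inner x v w = inner ℝ (diff f x v) (diff f x w)

/-! ### Singular isometric extensions -/

/-- `f : Mⁿ → ℝᵃ` and `f' : Mⁿ → ℝᵇ` singularly extend isometrically: there are a manifold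
`N` of dimension `n + s` with `s > 0`, a smooth embedding `j : M → N` (an injective immersion which
is a homeomorphism onto its image), and smooth maps `F : N → ℝᵃ`, `F' : N → ℝᵇ` which induce the
same (possibly degenerate) metric on `N`, which are immersions outside `j(M)`, and which extend
`f` and `f'`. -/
def SingularlyExtendIsometrically {a b : ℕ} (f : M → Euc a) (f' : M → Euc b) : Prop :=
  ∃ (s : ℕ) (N : Type u) (_ : TopologicalSpace N) (_ : T2Space N)
    (_ : SecondCountableTopology N) (_ : ChartedSpace (Euc (n + s)) N)
    (_ : IsManifold (𝓡 (n + s)) ∞ N)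
    (j : M → N) (F : N → Euc a) (F' : N → Euc b),
    0 < s ∧
    ContMDiff (𝓡 n) (𝓡 (n + s)) ∞ j ∧
    (∀ x, Function.Injective (mfderiv (𝓡 n) (𝓡 (n + s)) j x)) ∧
    Topology.IsEmbedding j ∧
    ContMDiff (𝓡 (n + s)) (𝓡 a) ∞ F ∧
    ContMDiff (𝓡 (n + s)) (𝓡 b) ∞ F' ∧
    (∀ (y : N) (v w : TangentSpace (𝓡 (n + s)) y),
      inner ℝ (diff F y v) (diff F y w) = inner ℝ (diff F' y v) (diff F' y w)) ∧
    (∀ y : N, y ∉ Set.range j →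
      Function.Injective (diff (n := n + s) F y) ∧
        Function.Injective (diff (n := n + s) F' y)) ∧
    F ∘ j = f ∧ F' ∘ j = f'

/-- `f'` is a strongly genuine deformation of `f`: along no nonempty open subset `U` of `M` do the
restrictions of `f` and `f'` singularly extend isometrically. -/
def IsStronglyGenuineDeformation {a b : ℕ} (f : M → Euc a) (f' : M → Euc b) : Prop :=
  ∀ U : TopologicalSpace.Opens M, (U : Set M).Nonempty →
    ¬ SingularlyExtendIsometrically (n := n) (fun x : U => f x) (fun x : U => f' x)

/-! ### Subbundles of `M × ℝᵐ`, second fundamental forms and normal connections -/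

/-- `S` is a smooth rank `k` subbundle of the trivial bundle `M × ℝᵐ`. -/
def IsSmoothSubbundle (k : ℕ) (S : M → Submodule ℝ (Euc m)) : Prop :=
  ∀ x : M, ∃ (U : Set M) (e : Fin k → M → Euc m), IsOpen U ∧ x ∈ U ∧
    (∀ i, ContMDiffOn (𝓡 n) (𝓡 m) ∞ (e i) U) ∧
    ∀ y ∈ U, LinearIndependent ℝ (fun i => e i y) ∧
      S y = Submodule.span ℝ (Set.range fun i => e i y)

/-- `L` is a smooth rank `k` subbundle of the normal bundle of `f`. -/
def IsNormalSubbundle (f : M → Euc m) (k : ℕ) (L : M → Submodule ℝ (Euc m)) : Prop :=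
  IsSmoothSubbundle (n := n) k L ∧ ∀ x, L x ≤ (tangentImage (n := n) f x)ᗮ

/-- The Euclidean derivative `∇̃_u ξ` at `x` of a map `ξ : M → ℝᵐ`. -/
def ambientDeriv (ξ : M → Euc m) (x : M) (u : TangentSpace (𝓡 n) x) : Euc m :=
  diff ξ x u

/-- For a smooth subbundle `S` of `M × ℝᵐ`, `u ∈ T_xM` and `v ∈ S x`, the vector
`(∇̃_u v)_{Sᗮ}`, where `v` is extended to the section `y ↦ P_{S y} v` of `S` (with `P` the
orthogonal projection); by tensoriality the choice of the extension is immaterial, see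
`secondForm_eq_of_section`. It is written through the derivative of the map `y ↦ P_{S y}` in order
to be linear in `v`. -/
def secondForm (S : M → Submodule ℝ (Euc m)) (x : M) (u : TangentSpace (𝓡 n) x) :
    Euc m →L[ℝ] Euc m :=
  (S x)ᗮ.starProjection ∘L
    (mfderiv (𝓡 n) 𝓘(ℝ, Euc m →L[ℝ] Euc m) (fun y => (S y).starProjection) x u :
      Euc m →L[ℝ] Euc m)

/-- Independence of the extension: `secondForm S x u (ξ x) = (∇̃_u ξ)_{Sᗮ}` for every section
`ξ` of `S`. -/
theorem secondForm_eq_of_section (S : M → Submodule ℝ (Euc m)) (x : M)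
    (u : TangentSpace (𝓡 n) x) (ξ : M → Euc m)
    (hS : MDifferentiableAt (𝓡 n) 𝓘(ℝ, Euc m →L[ℝ] Euc m) (fun y => (S y).starProjection) x)
    (hξ : MDifferentiableAt (𝓡 n) (𝓡 m) ξ x) (hmem : ∀ᶠ y in 𝓝 x, ξ y ∈ S y) :
    secondForm S x u (ξ x) = (S x)ᗮ.starProjection (ambientDeriv ξ x u) := by
  have hξ' : (fun y => (S y).starProjection (ξ y)) =ᶠ[𝓝 x] ξ := by
    filter_upwards [hmem] with y hy
    exact Submodule.starProjection_eq_self_iff.mpr hy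
  set P : M → Euc m →L[ℝ] Euc m := fun y => (S y).starProjection with hP
  let dP : TangentSpace (𝓡 n) x →L[ℝ] Euc m →L[ℝ] Euc m :=
    mfderiv (𝓡 n) 𝓘(ℝ, Euc m →L[ℝ] Euc m) P x
  have h1 : HasMFDerivAt (𝓡 n) (𝓡 m) (fun y => P y (ξ y)) x
      ((P x).comp (diff ξ x) + (ContinuousLinearMap.apply ℝ (Euc m) (ξ x)).comp dP) := by
    refine ⟨(hS.clm_apply hξ).continuousAt, ?_⟩
    let dP' : Euc n →L[ℝ] Euc m →L[ℝ] Euc m := dP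
    let dξ : Euc n →L[ℝ] Euc m := diff ξ x
    have hx : (extChartAt (𝓡 n) x).symm (extChartAt (𝓡 n) x x) = x := extChartAt_to_inv x
    have ha : HasFDerivWithinAt (fun z => P ((extChartAt (𝓡 n) x).symm z)) dP'
        (Set.range (𝓡 n)) (extChartAt (𝓡 n) x x) := hS.hasMFDerivAt.2
    have hb : HasFDerivWithinAt (fun z => ξ ((extChartAt (𝓡 n) x).symm z)) dξ
        (Set.range (𝓡 n)) (extChartAt (𝓡 n) x x) := hξ.hasMFDerivAt.2
    have h := ha.clm_apply hb
    rw [hx] at h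
    exact h
  have h2 := (h1.congr_of_eventuallyEq hξ'.symm).mfderiv
  have h3 : ambientDeriv ξ x u = P x (ambientDeriv ξ x u) + dP u (ξ x) :=
    congrArg (fun T : TangentSpace (𝓡 n) x →L[ℝ] Euc m => T u) h2
  have h4 : (S x)ᗮ.starProjection (P x (ambientDeriv ξ x u)) = 0 :=
    Submodule.starProjection_orthogonal_apply_eq_zero (Submodule.starProjection_apply_mem _ _)
  rw [h3, map_add, h4, zero_add]
  rfl

/-- The second fundamental form `α(u, w) = (∇̃_u f_* w)_{T^⊥}` of `f`. -/
def sff (f : M → Euc m) (x : M) (u w : TangentSpace (𝓡 n) x) : Euc m :=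
  secondForm (tangentImage (n := n) f) x u (diff f x w)

/-- The normal connection `∇^⊥_u ξ` of `f`, for a normal field `ξ`. -/
def normalDeriv (f : M → Euc m) (ξ : M → Euc m) (x : M) (u : TangentSpace (𝓡 n) x) : Euc m :=
  (tangentImage (n := n) f x)ᗮ.starProjection (ambientDeriv ξ x u)

section Tau

variable {m' : ℕ} {L : M → Submodule ℝ (Euc m)} {L' : M → Submodule ℝ (Euc m')}

/-- The fibrewise linear isometries `τ x : L x → L' x` depend smoothly on `x`: `τ` maps smooth
local sections to smooth local sections. -/
def IsSmoothBundleMap (τ : ∀ x, L x ≃ₗᵢ[ℝ] L' x) : Prop :=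
  ∀ (U : Set M) (ξ : ∀ x, L x), IsOpen U →
    ContMDiffOn (𝓡 n) (𝓡 m) ∞ (fun y => (ξ y : Euc m)) U →
    ContMDiffOn (𝓡 n) (𝓡 m') ∞ (fun y => (τ y (ξ y) : Euc m')) U

/-- `τ` preserves the second fundamental forms: `τ ∘ α_L = α'_{L'}`. -/
def PreservesSff (f : M → Euc m) (f' : M → Euc m') (τ : ∀ x, L x ≃ₗᵢ[ℝ] L' x) : Prop :=
  ∀ (x : M) (u w : TangentSpace (𝓡 n) x),
    τ x ((L x).orthogonalProjectionOnto (sff f x u w)) =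
      (L' x).orthogonalProjectionOnto (sff f' x u w)

/-- `τ` is parallel for the induced normal connections:
`τ (∇^⊥_u ξ)_L = (∇'^⊥_u τξ)_{L'}` for all smooth local sections `ξ` of `L`. -/
def IsParallel (f : M → Euc m) (f' : M → Euc m') (τ : ∀ x, L x ≃ₗᵢ[ℝ] L' x) : Prop :=
  ∀ (U : Set M) (ξ : ∀ x, L x), IsOpen U →
    ContMDiffOn (𝓡 n) (𝓡 m) ∞ (fun y => (ξ y : Euc m)) U →
    ∀ x ∈ U, ∀ u : TangentSpace (𝓡 n) x,
      τ x ((L x).orthogonalProjectionOnto (normalDeriv f (fun y => (ξ y : Euc m)) x u)) =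
        (L' x).orthogonalProjectionOnto (normalDeriv f' (fun y => (τ y (ξ y) : Euc m')) x u)

/-! ### The bilinear form `φ_τ` -/

/-- The inclusion of the fibre `T_xM ⊕ L x` into `ℝᵐ`, `(w, η) ↦ f_* w + η`. -/
def fibreIncl (f : M → Euc m) (L : M → Submodule ℝ (Euc m)) (x : M) :
    (TangentSpace (𝓡 n) x × L x) →ₗ[ℝ] Euc m :=
  LinearMap.coprod (diff (n := n) f x : TangentSpace (𝓡 n) x →ₗ[ℝ] Euc m) (L x).subtype

/-- The isometry `τ̄ = Id ⊕ τ : T_xM ⊕ L x → T_xM ⊕ L' x`. -/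
def tauBar (τ : ∀ x, L x ≃ₗᵢ[ℝ] L' x) (x : M) :
    (TangentSpace (𝓡 n) x × L x) →ₗ[ℝ] (TangentSpace (𝓡 n) x × L' x) :=
  LinearMap.prodMap LinearMap.id ((τ x).toLinearEquiv : L x →ₗ[ℝ] L' x)

/-- `φ_τ^u = φ_τ(u, ·)`, with
`φ_τ(u, v) = ((∇̃_u v)_{L^⊥}, (∇̃_u τ̄ v)_{L'^⊥})` for `v ∈ T_xM ⊕ L x`. Here `L^⊥` is the
orthogonal complement of `L` in the normal bundle of `f`, that is, the orthogonal complement of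
`f_* TM ⊕ L` in `ℝᵐ`. -/
def phi (f : M → Euc m) (f' : M → Euc m') (τ : ∀ x, L x ≃ₗᵢ[ℝ] L' x) (x : M)
    (u : TangentSpace (𝓡 n) x) :
    (TangentSpace (𝓡 n) x × L x) →ₗ[ℝ] (Euc m × Euc m') :=
  LinearMap.prod
    ((secondForm (fun y => tangentImage (n := n) f y ⊔ L y) x u : Euc m →ₗ[ℝ] Euc m) ∘ₗ
      fibreIncl f L x)
    ((secondForm (fun y => tangentImage (n := n) f' y ⊔ L' y) x u : Euc m' →ₗ[ℝ] Euc m') ∘ₗ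
      fibreIncl f' L' x ∘ₗ tauBar τ x)

/-- The rank of `φ_τ^u`. -/
def phiRank (f : M → Euc m) (f' : M → Euc m') (τ : ∀ x, L x ≃ₗᵢ[ℝ] L' x) (x : M)
    (u : TangentSpace (𝓡 n) x) : ℕ :=
  Module.finrank ℝ (LinearMap.range (phi f f' τ x u))

/-- `i(φ_τ)(x)`, the maximal rank of `φ_τ^u` over `u ∈ T_xM` (the ranks are bounded by
`n + rank L`). -/
def phiIndex (f : M → Euc m) (f' : M → Euc m') (τ : ∀ x, L x ≃ₗᵢ[ℝ] L' x) (x : M) : ℕ :=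
  ⨆ u : TangentSpace (𝓡 n) x, phiRank f f' τ x u

/-- `u ∈ T_xM` is a regular element of `φ_τ`. -/
def IsRegularElement (f : M → Euc m) (f' : M → Euc m') (τ : ∀ x, L x ≃ₗᵢ[ℝ] L' x) (x : M)
    (u : TangentSpace (𝓡 n) x) : Prop :=
  phiRank f f' τ x u = phiIndex (n := n) f f' τ x

/-- The kernel `D_Y(x) = ker φ_τ^{Y(x)} ⊆ T_xM ⊕ L x`. -/
def phiKer (f : M → Euc m) (f' : M → Euc m') (τ : ∀ x, L x ≃ₗᵢ[ℝ] L' x)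
    (Y : ∀ x : M, TangentSpace (𝓡 n) x) (x : M) :
    Submodule ℝ (TangentSpace (𝓡 n) x × L x) :=
  LinearMap.ker (phi f f' τ x (Y x))

/-- The tangent part of `D_Y(x)`; it is `D_Y(x)` itself when `D_Y(x) ⊆ T_xM`. -/
def phiKerTangent (f : M → Euc m) (f' : M → Euc m') (τ : ∀ x, L x ≃ₗᵢ[ℝ] L' x)
    (Y : ∀ x : M, TangentSpace (𝓡 n) x) (x : M) : Submodule ℝ (TangentSpace (𝓡 n) x) :=
  (phiKer f f' τ Y x).map (LinearMap.fst ℝ (TangentSpace (𝓡 n) x) (L x))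

end Tau

/-! ### Ruled immersions -/

/-- `X` is a smooth vector field on `U`. -/
def IsSmoothVectorField (U : Set M) [IsManifold (𝓡 n) ∞ M]
    (X : ∀ x : M, TangentSpace (𝓡 n) x) : Prop :=
  ContMDiffOn (𝓡 n) (𝓡 n).tangent ∞ (fun x => (⟨x, X x⟩ : TangentBundle (𝓡 n) M)) U

/-- `D` is a smooth distribution of rank `d` on the open set `C`. -/
def IsSmoothDistribution [IsManifold (𝓡 n) ∞ M] (C : Set M) (d : ℕ)
    (D : ∀ x : M, Submodule ℝ (TangentSpace (𝓡 n) x)) : Prop :=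
  ∀ x ∈ C, ∃ (U : Set M) (X : Fin d → ∀ y : M, TangentSpace (𝓡 n) y), IsOpen U ∧ x ∈ U ∧ U ⊆ C ∧
    (∀ i, IsSmoothVectorField U (X i)) ∧
    ∀ y ∈ U, LinearIndependent ℝ (fun i => X i y) ∧
      D y = Submodule.span ℝ (Set.range fun i => X i y)

/-- `K` is mapped by `f` onto a (relatively) open subset of a `d`-dimensional affine subspace. -/
def MapsOntoOpenOfAffine (f : M → Euc m) (d : ℕ) (K : Set M) : Prop :=
  ∃ (A : AffineSubspace ℝ (Euc m)) (O : Set (Euc m)),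
    Module.finrank ℝ A.direction = d ∧ IsOpen O ∧ f '' K = O ∩ A

/-- The embedded `d`-dimensional submanifold `Σ = σ(W)`, parametrized by an open neighbourhood `W`
of `0` in `ℝᵈ`, is contained in `C`, is tangent to `D` at `σ 0`, is totally geodesic, and is mapped
by the isometric immersion `f` onto an open subset of a `d`-dimensional affine subspace.
By the Gauss formula, `f_*` maps the Levi-Civita derivative `∇_{∂_a} ∂_c` on `M` along `Σ` to the
tangential part of the second derivative of `f ∘ σ`; `Σ` is totally geodesic when these derivatives
are tangent to `Σ`. -/
structure IsAffineRuling (f : M → Euc m) (C : Set M) (d : ℕ)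
    (D : ∀ x : M, Submodule ℝ (TangentSpace (𝓡 n) x)) (W : Set (Euc d)) (σ : Euc d → M) :
    Prop where
  isOpen : IsOpen W
  zero_mem : (0 : Euc d) ∈ W
  mapsTo : Set.MapsTo σ W C
  smooth : ContMDiffOn (𝓡 d) (𝓡 n) ∞ σ W
  immersion : ∀ w ∈ W, Function.Injective (mfderiv (𝓡 d) (𝓡 n) σ w)
  embedding : Topology.IsEmbedding (fun w : W => σ w)
  tangent : LinearMap.range (mfderiv (𝓡 d) (𝓡 n) σ 0 :
    TangentSpace (𝓡 d) (0 : Euc d) →ₗ[ℝ] TangentSpace (𝓡 n) (σ 0)) = D (σ 0)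
  totallyGeodesic : ∀ w ∈ W, ∀ a c : Euc d,
    (tangentImage (n := n) f (σ w)).starProjection
        (fderiv ℝ (fun z => fderiv ℝ (f ∘ σ) z c) w a) ∈
      LinearMap.range (fderiv ℝ (f ∘ σ) w : Euc d →ₗ[ℝ] Euc m)
  affine : MapsOntoOpenOfAffine f d (σ '' W)

/-- Along the open set `C`, `f` and `f'` are mutually `D̄`-ruled for the rank `d` distribution `D`:
through each point `x` of `C` there is a totally geodesic submanifold of `C`, tangent to `D x` at
`x`, which is mapped by both `f` and `f'` onto open subsets of `d`-dimensional affine subspaces. -/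
def MutuallyBarRuled [IsManifold (𝓡 n) ∞ M] {m' : ℕ} (f : M → Euc m) (f' : M → Euc m')
    (C : Set M) (d : ℕ) (D : ∀ x : M, Submodule ℝ (TangentSpace (𝓡 n) x)) : Prop :=
  IsSmoothDistribution C d D ∧
    ∀ x ∈ C, ∃ (W : Set (Euc d)) (σ : Euc d → M), σ 0 = x ∧
      IsAffineRuling f C d D W σ ∧ IsAffineRuling f' C d D W σ

/-- The distribution `D` on `C` is totally geodesic: `∇_u Y ∈ D` for all `u ∈ D` and all local
sections `Y` of `D`, where `∇` is the Levi-Civita connection of the metric induced by `f`, that is,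
`f_* ∇_u Y` is the tangential part of `∇̃_u (f_* Y)`. -/
def IsTotallyGeodesicDistribution [IsManifold (𝓡 n) ∞ M] (f : M → Euc m) (C : Set M)
    (D : ∀ x : M, Submodule ℝ (TangentSpace (𝓡 n) x)) : Prop :=
  ∀ (U : Set M) (Y : ∀ x : M, TangentSpace (𝓡 n) x), IsOpen U → U ⊆ C →
    IsSmoothVectorField U Y → (∀ y ∈ U, Y y ∈ D y) →
    ∀ x ∈ U, ∀ u ∈ D x,
      (tangentImage (n := n) f x).starProjection (ambientDeriv (fun y => diff f y (Y y)) x u) ∈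
        (D x).map (diff (n := n) f x : TangentSpace (𝓡 n) x →ₗ[ℝ] Euc m)

/-- The leaf through `x` of an integrable distribution `D` on the open set `C`: the points which
can be joined to `x` by a smooth curve in `C` tangent to `D`. -/
def leaf (C : Set M) (D : ∀ x : M, Submodule ℝ (TangentSpace (𝓡 n) x)) (x : M) : Set M :=
  {y | ∃ γ : ℝ → M, ContMDiff 𝓘(ℝ, ℝ) (𝓡 n) ∞ γ ∧ γ 0 = x ∧ γ 1 = y ∧
    ∀ t : ℝ, γ t ∈ C ∧ mfderiv 𝓘(ℝ, ℝ) (𝓡 n) γ t (1 : ℝ) ∈ D (γ t)}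

/-- Along the open set `C`, `f` is `D`-ruled: `D` is a totally geodesic distribution of rank `d`
whose leaves are mapped by `f` onto open subsets of `d`-dimensional affine subspaces. -/
def IsRuledBy [IsManifold (𝓡 n) ∞ M] (f : M → Euc m) (C : Set M) (d : ℕ)
    (D : ∀ x : M, Submodule ℝ (TangentSpace (𝓡 n) x)) : Prop :=
  IsSmoothDistribution C d D ∧ IsTotallyGeodesicDistribution f C D ∧
    ∀ x ∈ C, MapsOntoOpenOfAffine f d (leaf C D x)

variable (n) in
/-- Along the open set `C`, `f` and `f'` are mutually `d`-ruled, i.e., ruled with the same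
rulings of dimension `d`. -/
def MutuallyRuled [IsManifold (𝓡 n) ∞ M] {m' : ℕ} (f : M → Euc m) (f' : M → Euc m')
    (C : Set M) (d : ℕ) : Prop :=
  ∃ D : ∀ x : M, Submodule ℝ (TangentSpace (𝓡 n) x), IsRuledBy f C d D ∧ IsRuledBy f' C d D

end General

end

/-!
Locally, the bundles `TM ⊕ L` and `TM ⊕ L'` have corresponding frames `B₁`, `B₂`. The assumptions on
`τ` say that these frames have the same inner products and the same connection forms
(`IsCompatiblePair`, `exists_isAdaptedChart`). The curvatures of the two bundles therefore agree, and
by the Gauss equations `φ_τ` is flat with respect to the inner product of signature `(+, -)` on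
`L^⊥ × L'^⊥` (`IsCompatiblePair.flat`). If `Y` is regular, `φ_τ(u, ·)` maps `ker φ_τ^Y` into the image
of `φ_τ^Y` for every `u` (`apply_ker_mem_range_of_max_rank`), and flatness makes these values null
vectors (`IsCompatiblePair.norm_frameSff_eq`).

Consequently, for a section `v` of `D_Y = ker φ_τ^Y`, the maps `f + t v` and `f' + t τ̄ v` induce the
same metric on `M × ℝ` (`IsCompatiblePair.norm_extensionDeriv_eq`). They are nowhere immersions, not
even for `t ≠ 0`: a minor of the differential is a polynomial in `t`, and if it did not vanish
identically, dividing it by the largest possible power of `t` would produce an open set of `M × ℝ`,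
meeting `M × {0}`, on which they are immersions except for `t = 0`; this is excluded by strong
genuineness (`not_injective_extensionDeriv`). At `t = 0` this says that `v` is tangent to `M`
(`IsCompatiblePair.exists_isRulingPair`).

The common kernel of the two differentials contains a field `Z - ∂/∂t`, and both maps are constant
along its integral curves. Hence for `v` small the points `f x + f_* v` and `f' x + f'_* v` are the
images under `f` and `f'` of one point of `M`, which depends smoothly on `x` and `v`
(`IsRulingPair.exists_transport`, `IsRulingPair.exists_smooth_transport`). For `x` fixed these points
form the ruling through `x` (`IsRulingPair.exists_isAffineRuling`). When `x` runs through a slice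
transversal to `D_Y` they form a foliated chart, on whose slices `f` and `f'` are affine, so that its
domain is mutually ruled (`IsRulingPair.exists_foliated_chart`, `IsFoliatedChart.isRuledBy`).

By semicontinuity of the rank, every nonempty open set contains the domain of such a chart along which
`i(φ_τ)` is constant (`exists_mutuallyRuled`). The set `V` is the union of a maximal family of
pairwise disjoint connected domains of this kind, which are then its connected components
(`exists_isOpen_dense_connectedComponentIn`).
-/

set_option linter.unusedSectionVars false

/-! ### Smooth families of linear maps -/

section LinearFamilies

variable {X G H W E : Type*} [NormedAddCommGroup X] [NormedSpace ℝ X]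
  [NormedAddCommGroup G] [NormedSpace ℝ G] [FiniteDimensional ℝ G]
  [NormedAddCommGroup H] [NormedSpace ℝ H] [FiniteDimensional ℝ H]

theorem ContinuousLinearMap.isInvertible_of_injective {T : G →L[ℝ] G}
    (h : Function.Injective T) : T.IsInvertible :=
  ⟨(LinearEquiv.ofInjectiveEndo (T : G →ₗ[ℝ] G) h).toContinuousLinearEquiv, by ext; rfl⟩

/-- A left inverse `S` of `T` modulo `ker T`, together with the map `π = 1 - S T` into `ker T`. -/
theorem exists_generalized_inverse (T : G →L[ℝ] H) :
    ∃ (S : H →L[ℝ] G) (π : G →L[ℝ] G), (∀ g, S (T g) + π g = g) ∧ ∀ g, T (π g) = 0 := by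
  obtain ⟨C, hC⟩ := Submodule.exists_isCompl (LinearMap.ker (T : G →ₗ[ℝ] H))
  have hinj : LinearMap.ker ((T : G →ₗ[ℝ] H) ∘ₗ C.subtype) = ⊥ := by
    rw [LinearMap.ker_eq_bot']
    intro c hc
    have := (Submodule.disjoint_def.mp hC.disjoint) c hc c.2
    exact Subtype.ext this
  obtain ⟨R, hR⟩ := LinearMap.exists_leftInverse_of_injective _ hinj
  let S : H →L[ℝ] G := (C.subtype ∘ₗ R).toContinuousLinearMap
  have hS : ∀ c ∈ C, S (T c) = c := fun c hc =>
    congrArg Subtype.val (LinearMap.congr_fun hR ⟨c, hc⟩)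
  have hT : ∀ g, T (S (T g)) = T g := by
    intro g
    obtain ⟨k, hk, c, hc, rfl⟩ := Submodule.mem_sup.mp (hC.sup_eq_top ▸ Submodule.mem_top (x := g))
    have hk' : T k = 0 := hk
    rw [map_add, hk', zero_add, hS c hc]
  refine ⟨S, ContinuousLinearMap.id ℝ G - S ∘L T, ?_, ?_⟩
  · intro g; simp
  · intro g; simp [hT]

/-- The kernels of a smooth family of linear maps of constant rank have a smooth local frame. -/
theorem exists_smooth_kernel_frame {T : X → G →L[ℝ] H} {Ω : Set X} {x₀ : X} {d : ℕ}
    (hΩ : IsOpen Ω) (hT : ContDiffOn ℝ ∞ T Ω) (hx₀ : x₀ ∈ Ω)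
    (hd : ∀ x ∈ Ω, Module.finrank ℝ (LinearMap.ker (T x : G →ₗ[ℝ] H)) = d) :
    ∃ U : Set X, IsOpen U ∧ x₀ ∈ U ∧ U ⊆ Ω ∧ ∃ s : X → EuclideanSpace ℝ (Fin d) →L[ℝ] G,
      ContDiffOn ℝ ∞ s U ∧ ∀ x ∈ U, Function.Injective (s x) ∧
        LinearMap.range (s x : EuclideanSpace ℝ (Fin d) →ₗ[ℝ] G) =
          LinearMap.ker (T x : G →ₗ[ℝ] H) := by
  obtain ⟨S, π, h1, h2⟩ := exists_generalized_inverse (T x₀)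
  -- `Ψ x` is an isomorphism for `x` near `x₀`, and maps `ker T x` onto `ker T x₀`
  let Ψ : X → G →L[ℝ] G := fun x => S ∘L T x + π
  have hΨ : ContDiffOn ℝ ∞ Ψ Ω := (contDiffOn_const.clm_comp hT).add contDiffOn_const
  have hΨ0 : Ψ x₀ = ContinuousLinearMap.id ℝ G := by ext g; exact h1 g
  let U : Set X := Ω ∩ Ψ ⁻¹' {A | Function.Injective A}
  have hU : IsOpen U := hΨ.continuousOn.isOpen_inter_preimage hΩ
    ContinuousLinearMap.isOpen_injective
  have hinv : ∀ x ∈ U, (Ψ x).IsInvertible := fun x hx =>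
    ContinuousLinearMap.isInvertible_of_injective hx.2
  obtain ⟨e⟩ : Nonempty (EuclideanSpace ℝ (Fin d) ≃L[ℝ] LinearMap.ker (T x₀ : G →ₗ[ℝ] H)) :=
    FiniteDimensional.nonempty_continuousLinearEquiv_of_finrank_eq (by simp [hd x₀ hx₀])
  let ι : EuclideanSpace ℝ (Fin d) →L[ℝ] G :=
    (LinearMap.ker (T x₀ : G →ₗ[ℝ] H)).subtypeL ∘L (e : _ →L[ℝ] _)
  have hι : Function.Injective ι := Subtype.val_injective.comp e.injective
  have hιK : ∀ a, T x₀ (ι a) = 0 := fun a => (e a).2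
  refine ⟨U, hU, ⟨hx₀, ?_⟩, Set.inter_subset_left,
    fun x => (Ψ x).inverse ∘L ι, ?_, ?_⟩
  · change Function.Injective (Ψ x₀)
    rw [hΨ0]; exact Function.injective_id
  · have : ContDiffOn ℝ ∞ (fun x => (Ψ x).inverse) U := fun x hx =>
      (hinv x hx).contDiffAt_map_inverse.comp_contDiffWithinAt x
        ((hΨ x hx.1).mono Set.inter_subset_left)
    exact this.clm_comp contDiffOn_const
  · intro x hx
    have hinj : Function.Injective ((Ψ x).inverse ∘L ι) :=
      (hinv x hx).inverse.injective.comp hι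
    refine ⟨hinj, ?_⟩
    symm
    have hle : LinearMap.ker (T x : G →ₗ[ℝ] H) ≤
        LinearMap.range (((Ψ x).inverse ∘L ι : EuclideanSpace ℝ (Fin d) →L[ℝ] G) :
          EuclideanSpace ℝ (Fin d) →ₗ[ℝ] G) := by
      intro g hg
      have hg' : T x g = 0 := hg
      have hk : T x₀ (π g) = 0 := h2 g
      refine ⟨e.symm ⟨π g, hk⟩, ?_⟩
      have : Ψ x g = π g := by simp [Ψ, hg']
      simp only [ContinuousLinearMap.coe_coe, ContinuousLinearMap.comp_apply, ι,
        ContinuousLinearEquiv.coe_coe, ContinuousLinearEquiv.apply_symm_apply,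
        Submodule.subtypeL_apply]
      rw [← this, (hinv x hx).inverse_apply_self]
    refine Submodule.eq_of_le_of_finrank_eq hle ?_
    rw [hd x hx.1, LinearMap.finrank_range_of_inj hinj]
    simp

/-- The rank of a continuous family of linear maps is lower semicontinuous. -/
theorem eventually_finrank_range_le {Y : Type*} [TopologicalSpace Y] {T : Y → G →L[ℝ] H} {x₀ : Y}
    (hT : ContinuousAt T x₀) :
    ∀ᶠ x in 𝓝 x₀, Module.finrank ℝ (LinearMap.range (T x₀ : G →ₗ[ℝ] H)) ≤
      Module.finrank ℝ (LinearMap.range (T x : G →ₗ[ℝ] H)) := by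
  have h := (isOpen_setOfPred_nat_le_rank (𝕜 := ℝ) (E := G) (F := H)
    (Module.finrank ℝ (LinearMap.range (T x₀ : G →ₗ[ℝ] H)))).mem_nhds
    (x := T x₀) (by simp [LinearMap.rank, Module.finrank_eq_rank])
  filter_upwards [hT h] with x hx
  have hx' : ((Module.finrank ℝ (LinearMap.range (T x₀ : G →ₗ[ℝ] H)) : ℕ) : Cardinal) ≤
      (T x : G →ₗ[ℝ] H).rank := hx
  rw [LinearMap.rank, ← Module.finrank_eq_rank] at hx'
  exact_mod_cast hx'

/-- If `Y` maximizes the rank of `φ u`, then every `φ u` maps `ker φ Y` into the image of `φ Y`. -/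
theorem apply_ker_mem_range_of_max_rank [NormedAddCommGroup E] [NormedSpace ℝ E]
    (φ : E →ₗ[ℝ] G →ₗ[ℝ] H) {Y : E}
    (hY : ∀ u, Module.finrank ℝ (LinearMap.range (φ u)) ≤ Module.finrank ℝ (LinearMap.range (φ Y)))
    {v : G} (hv : φ Y v = 0) (u : E) : φ u v ∈ LinearMap.range (φ Y) := by
  by_contra hnot
  set r := Module.finrank ℝ (LinearMap.range (φ Y)) with hr
  let b := Module.finBasis ℝ (LinearMap.range (φ Y))
  choose g hg using fun i => (b i).2
  -- the vectors `φ u v` and `φ (Y + t u) (g i)` are independent at `t = 0`, hence for small `t`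
  let a : ℝ → Fin (r + 1) → H := fun t => Fin.cons (φ u v) fun i => φ (Y + t • u) (g i)
  have ha0 : LinearIndependent ℝ (a 0) := by
    have hli : LinearIndependent ℝ (fun i => ((b i : LinearMap.range (φ Y)) : H)) :=
      b.linearIndependent.map' (LinearMap.range (φ Y)).subtype (Submodule.ker_subtype _)
    have hspan : Submodule.span ℝ (Set.range fun i => ((b i : LinearMap.range (φ Y)) : H)) ≤
        LinearMap.range (φ Y) := by
      rw [Submodule.span_le]; rintro _ ⟨i, rfl⟩; exact (b i).2
    have : a 0 = Fin.cons (φ u v) fun i => ((b i : LinearMap.range (φ Y)) : H) := by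
      simp only [a, zero_smul, add_zero]
      congr 1
      funext i
      exact hg i
    rw [this, linearIndependent_finCons]
    exact ⟨hli, fun h => hnot (hspan h)⟩
  have hcont : Continuous a := by
    refine continuous_pi fun i => ?_
    refine Fin.cases ?_ (fun i => ?_) i
    · exact continuous_const
    · simp only [a, Fin.cons_succ, map_add, map_smul, LinearMap.add_apply, LinearMap.smul_apply]
      fun_prop
  have hev : ∀ᶠ t in 𝓝 (0 : ℝ), LinearIndependent ℝ (a t) :=
    hcont.continuousAt.eventually ha0.eventually
  obtain ⟨t, ht, ht0⟩ : ∃ t, LinearIndependent ℝ (a t) ∧ t ≠ 0 :=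
    ((hev.filter_mono nhdsWithin_le_nhds).and
      (self_mem_nhdsWithin : {t : ℝ | t ≠ 0} ∈ 𝓝[≠] 0)).exists
  have hmem : ∀ i, a t i ∈ LinearMap.range (φ (Y + t • u)) := by
    intro i
    refine Fin.cases ?_ (fun i => ?_) i
    · refine ⟨t⁻¹ • v, ?_⟩
      simp [a, hv, smul_smul, ht0]
    · exact ⟨g i, rfl⟩
  have hli' : LinearIndependent ℝ (fun i => (⟨a t i, hmem i⟩ : LinearMap.range (φ (Y + t • u)))) :=
    LinearIndependent.of_comp (LinearMap.range (φ (Y + t • u))).subtype ht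
  have := hli'.fintype_card_le_finrank
  have h2 := hY (Y + t • u)
  simp only [Fintype.card_fin] at this
  omega

end LinearFamilies

/-! ### Frames of subbundles and their second fundamental forms -/

section Frames

variable {X G H : Type*} [NormedAddCommGroup X] [NormedSpace ℝ X]
  [NormedAddCommGroup G] [NormedSpace ℝ G]
  [NormedAddCommGroup H] [InnerProductSpace ℝ H]

/-- The orthogonal projections onto the spans of a smooth frame depend smoothly on the point. -/
theorem contDiffOn_starProjection_range [FiniteDimensional ℝ G] [FiniteDimensional ℝ H]
    {B : X → G →L[ℝ] H} {Ω : Set X}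
    (hB : ContDiffOn ℝ ∞ B Ω) (hinj : ∀ x ∈ Ω, Function.Injective (B x)) :
    ContDiffOn ℝ ∞ (fun x => (LinearMap.range (B x : G →ₗ[ℝ] H)).starProjection) Ω := by
  obtain ⟨e⟩ : Nonempty (EuclideanSpace ℝ (Fin (Module.finrank ℝ G)) ≃L[ℝ] G) :=
    FiniteDimensional.nonempty_continuousLinearEquiv_of_finrank_eq (by simp)
  let K := EuclideanSpace ℝ (Fin (Module.finrank ℝ G))
  let adj : (K →L[ℝ] H) →L[ℝ] (H →L[ℝ] K) := LinearMap.toContinuousLinearMap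
    { toFun := fun A => ContinuousLinearMap.adjoint A
      map_add' := fun A A' => map_add _ A A'
      map_smul' := fun c A => by simp }
  let A : X → K →L[ℝ] H := fun x => B x ∘L (e : K →L[ℝ] G)
  have hA : ContDiffOn ℝ ∞ A Ω := hB.clm_comp contDiffOn_const
  have hA' : ContDiffOn ℝ ∞ (fun x => adj (A x)) Ω := adj.contDiff.comp_contDiffOn hA
  have hadj : ∀ x k h, inner ℝ k (adj (A x) h) = inner ℝ (A x k) h := fun x k h =>
    ContinuousLinearMap.adjoint_inner_right (A x) k h
  -- the projection is `A (A* A)⁻¹ A*`, where the Gram operator `A* A` is invertible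
  have hGram : ∀ x ∈ Ω, (adj (A x) ∘L A x).IsInvertible := by
    intro x hx
    apply ContinuousLinearMap.isInvertible_of_injective
    rw [injective_iff_map_eq_zero]
    intro k hk
    have h0 : inner ℝ (A x k) (A x k) = 0 := by
      rw [← hadj]
      have : adj (A x) (A x k) = 0 := hk
      rw [this, inner_zero_right]
    have h1 : B x (e k) = 0 := inner_self_eq_zero.mp h0
    have h2 : e k = 0 := hinj x hx (by rw [h1, map_zero])
    simpa using h2
  have hInv : ContDiffOn ℝ ∞ (fun x => (adj (A x) ∘L A x).inverse) Ω := fun x hx =>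
    ContDiffAt.comp_contDiffWithinAt (g := ContinuousLinearMap.inverse) x
      (hGram x hx).contDiffAt_map_inverse ((hA'.clm_comp hA) x hx)
  refine ((hA.clm_comp hInv).clm_comp hA').congr fun x hx => ?_
  ext1 h
  refine Submodule.eq_starProjection_of_mem_of_inner_eq_zero ?_ ?_
  · exact ⟨e ((adj (A x) ∘L A x).inverse (adj (A x) h)), rfl⟩
  · rintro _ ⟨g, rfl⟩
    have hg : (B x : G →ₗ[ℝ] H) g = A x (e.symm g) := by simp [A]
    rw [hg, real_inner_comm, ← hadj]
    have := (hGram x hx).self_apply_inverse (adj (A x) h)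
    simp only [ContinuousLinearMap.comp_apply] at this
    simp only [map_sub, ContinuousLinearMap.comp_apply, this, sub_self, inner_zero_right]

/-- The second fundamental form, with values in the orthogonal complement, of the subbundle spanned
by the frame `B`: the component of the derivative `dB(u) g` orthogonal to the range of `B x`. -/
noncomputable def frameSff [FiniteDimensional ℝ G] (B : X → G →L[ℝ] H) (x : X) :
    X →L[ℝ] G →L[ℝ] H :=
  (ContinuousLinearMap.compL ℝ G H H
    (LinearMap.range (B x : G →ₗ[ℝ] H))ᗮ.starProjection) ∘L fderiv ℝ B x

variable [FiniteDimensional ℝ G]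

theorem frameSff_apply (B : X → G →L[ℝ] H) (x u : X) (g : G) :
    frameSff B x u g = (LinearMap.range (B x : G →ₗ[ℝ] H))ᗮ.starProjection (fderiv ℝ B x u g) :=
  rfl

theorem inner_frameSff_left (B : X → G →L[ℝ] H) (x u : X) (g a : G) :
    inner ℝ (frameSff B x u g) (B x a) = 0 := by
  have h : frameSff B x u g ∈ (LinearMap.range (B x : G →ₗ[ℝ] H))ᗮ := by
    rw [frameSff_apply]; exact Submodule.starProjection_apply_mem _ _
  exact Submodule.inner_left_of_mem_orthogonal
    (LinearMap.mem_range_self (B x : G →ₗ[ℝ] H) a) h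

theorem contDiffOn_frameSff [FiniteDimensional ℝ H]
    {B : X → G →L[ℝ] H} {Ω : Set X} (hΩ : IsOpen Ω)
    (hB : ContDiffOn ℝ ∞ B Ω) (hinj : ∀ x ∈ Ω, Function.Injective (B x)) :
    ContDiffOn ℝ ∞ (frameSff B) Ω := by
  have h1 : ContDiffOn ℝ ∞
      (fun x => (LinearMap.range (B x : G →ₗ[ℝ] H))ᗮ.starProjection) Ω := by
    refine (contDiffOn_const (c := ContinuousLinearMap.id ℝ H)).sub
      (contDiffOn_starProjection_range hB hinj) |>.congr fun x _ => ?_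
    exact Submodule.starProjection_orthogonal _
  have h2 : ContDiffOn ℝ ∞ (fderiv ℝ B) Ω := hB.fderiv_of_isOpen hΩ (by simp)
  exact ((ContinuousLinearMap.compL ℝ G H H).contDiff.comp_contDiffOn h1).clm_comp h2

end Frames

/-! ### Pairs of subbundles with the same induced connection -/

section Pairs

variable {E F H₁ H₂ : Type*} [NormedAddCommGroup E] [NormedSpace ℝ E] [FiniteDimensional ℝ E]
  [NormedAddCommGroup F] [NormedSpace ℝ F] [FiniteDimensional ℝ F]
  [NormedAddCommGroup H₁] [InnerProductSpace ℝ H₁] [FiniteDimensional ℝ H₁]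
  [NormedAddCommGroup H₂] [InnerProductSpace ℝ H₂] [FiniteDimensional ℝ H₂]

/-- In a chart with domain `Ω`, `f₁` and `f₂` are immersions and `B₁`, `B₂` are frames of the
bundles `TM ⊕ L` and `TM ⊕ L'`, corresponding to each other under `Id ⊕ τ`: `B₁ x (u, c)` is the
sum of `df₁ u` and of the element of `L` with coefficients `c`. The frames have the same inner
products, and the connections induced on the two bundles coincide. -/
structure IsCompatiblePair (Ω : Set E) (f₁ : E → H₁) (f₂ : E → H₂)
    (B₁ : E → E × F →L[ℝ] H₁) (B₂ : E → E × F →L[ℝ] H₂) : Prop where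
  isOpen : IsOpen Ω
  smooth₁ : ContDiffOn ℝ ∞ f₁ Ω
  smooth₂ : ContDiffOn ℝ ∞ f₂ Ω
  frame₁ : ContDiffOn ℝ ∞ B₁ Ω
  frame₂ : ContDiffOn ℝ ∞ B₂ Ω
  injective₁ : ∀ x ∈ Ω, Function.Injective (B₁ x)
  tangent₁ : ∀ x ∈ Ω, ∀ u, B₁ x (u, 0) = fderiv ℝ f₁ x u
  tangent₂ : ∀ x ∈ Ω, ∀ u, B₂ x (u, 0) = fderiv ℝ f₂ x u
  metric : ∀ x ∈ Ω, ∀ a b, inner ℝ (B₁ x a) (B₁ x b) = inner ℝ (B₂ x a) (B₂ x b)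
  connection : ∀ x ∈ Ω, ∀ u a b,
    inner ℝ (fderiv ℝ B₁ x u a) (B₁ x b) = inner ℝ (fderiv ℝ B₂ x u a) (B₂ x b)

/-- The form `φ_τ` in terms of the frames `B₁` and `B₂`. -/
noncomputable def pairForm (B₁ : E → E × F →L[ℝ] H₁) (B₂ : E → E × F →L[ℝ] H₂) (x : E) :
    E →ₗ[ℝ] E × F →L[ℝ] H₁ × H₂ where
  toFun u := ContinuousLinearMap.inl ℝ H₁ H₂ ∘L frameSff B₁ x u +
    ContinuousLinearMap.inr ℝ H₁ H₂ ∘L frameSff B₂ x u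
  map_add' u v := by
    simp only [map_add, ContinuousLinearMap.comp_add]
    abel
  map_smul' c u := by
    simp only [map_smul, ContinuousLinearMap.comp_smul, smul_add, RingHom.id_apply]

omit [FiniteDimensional ℝ H₁] [FiniteDimensional ℝ H₂] in
theorem pairForm_apply (B₁ : E → E × F →L[ℝ] H₁) (B₂ : E → E × F →L[ℝ] H₂) (x u : E) (a : E × F) :
    pairForm B₁ B₂ x u a = (frameSff B₁ x u a, frameSff B₂ x u a) := by
  simp [pairForm]

namespace IsCompatiblePair

variable {Ω : Set E} {f₁ : E → H₁} {f₂ : E → H₂}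
    {B₁ : E → E × F →L[ℝ] H₁} {B₂ : E → E × F →L[ℝ] H₂}
    (h : IsCompatiblePair Ω f₁ f₂ B₁ B₂)

include h

theorem injective₂ {x : E} (hx : x ∈ Ω) : Function.Injective (B₂ x) := by
  rw [injective_iff_map_eq_zero]
  intro a ha
  have h1 : inner ℝ (B₁ x a) (B₁ x a) = 0 := by rw [h.metric x hx, ha, inner_zero_left]
  exact h.injective₁ x hx (by rw [inner_self_eq_zero.mp h1, map_zero])

theorem contDiffOn_pairForm {Ω' : Set E} {Y : E → E} (hsub : Ω' ⊆ Ω) (hY : ContDiffOn ℝ ∞ Y Ω') :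
    ContDiffOn ℝ ∞ (fun x => pairForm B₁ B₂ x (Y x)) Ω' :=
  (contDiffOn_const.clm_comp
    (((contDiffOn_frameSff h.isOpen h.frame₁ h.injective₁).mono hsub).clm_apply hY)).add
    (contDiffOn_const.clm_comp
      (((contDiffOn_frameSff h.isOpen h.frame₂ fun _ hx => h.injective₂ hx).mono
        hsub).clm_apply hY))

/-- Gauss formula: the two derivatives `dB₁(u) a` and `dB₂(u) a` have the same components along the
bundles. -/
theorem gauss_formula {x : E} (hx : x ∈ Ω) (u : E) (a : E × F) :
    ∃ c, fderiv ℝ B₁ x u a = B₁ x c + frameSff B₁ x u a ∧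
      fderiv ℝ B₂ x u a = B₂ x c + frameSff B₂ x u a := by
  obtain ⟨c, hc⟩ := Submodule.starProjection_apply_mem
    (LinearMap.range (B₁ x : E × F →ₗ[ℝ] H₁)) (fderiv ℝ B₁ x u a)
  have hc1 : fderiv ℝ B₁ x u a = B₁ x c + frameSff B₁ x u a := by
    rw [frameSff_apply, Submodule.starProjection_orthogonal', ← ContinuousLinearMap.coe_coe (B₁ x),
      hc]
    simp
  refine ⟨c, hc1, ?_⟩
  have : (LinearMap.range (B₂ x : E × F →ₗ[ℝ] H₂)).starProjection (fderiv ℝ B₂ x u a) = B₂ x c := by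
    refine Submodule.eq_starProjection_of_mem_of_inner_eq_zero
      (LinearMap.mem_range_self (B₂ x : E × F →ₗ[ℝ] H₂) c) ?_
    rintro _ ⟨b, rfl⟩
    change inner ℝ (fderiv ℝ B₂ x u a - B₂ x c) (B₂ x b) = 0
    rw [inner_sub_left, ← h.connection x hx, ← h.metric x hx, ← inner_sub_left, hc1,
      add_sub_cancel_left, inner_frameSff_left]
  rw [frameSff_apply, Submodule.starProjection_orthogonal', ← this]
  simp

/-- The curvature tensors of the two bundles coincide, as their connections do. -/
theorem inner_fderiv_sub {x : E} (hx : x ∈ Ω) (u v : E) (a b : E × F) :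
    inner ℝ (fderiv ℝ B₁ x u a) (fderiv ℝ B₁ x v b) -
        inner ℝ (fderiv ℝ B₁ x v a) (fderiv ℝ B₁ x u b) =
      inner ℝ (fderiv ℝ B₂ x u a) (fderiv ℝ B₂ x v b) -
        inner ℝ (fderiv ℝ B₂ x v a) (fderiv ℝ B₂ x u b) := by
  have key : ∀ u v : E,
      inner ℝ (fderiv ℝ (fderiv ℝ B₁) x v u a) (B₁ x b) +
        inner ℝ (fderiv ℝ B₁ x u a) (fderiv ℝ B₁ x v b) =
      inner ℝ (fderiv ℝ (fderiv ℝ B₂) x v u a) (B₂ x b) +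
        inner ℝ (fderiv ℝ B₂ x u a) (fderiv ℝ B₂ x v b) := by
    intro u v
    have hΩ := h.isOpen.mem_nhds hx
    have d1 : DifferentiableAt ℝ B₁ x := (h.frame₁.contDiffAt hΩ).differentiableAt (by simp)
    have d2 : DifferentiableAt ℝ B₂ x := (h.frame₂.contDiffAt hΩ).differentiableAt (by simp)
    have d1' : DifferentiableAt ℝ (fderiv ℝ B₁) x :=
      ((h.frame₁.fderiv_of_isOpen h.isOpen (m := ∞) (by simp)).contDiffAt hΩ).differentiableAt
        (by simp)
    have d2' : DifferentiableAt ℝ (fderiv ℝ B₂) x :=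
      ((h.frame₂.fderiv_of_isOpen h.isOpen (m := ∞) (by simp)).contDiffAt hΩ).differentiableAt
        (by simp)
    have e1 : HasFDerivAt (fun y => fderiv ℝ B₁ y u a) _ x :=
      (d1'.hasFDerivAt.clm_apply (hasFDerivAt_const u x)).clm_apply (hasFDerivAt_const a x)
    have e2 : HasFDerivAt (fun y => fderiv ℝ B₂ y u a) _ x :=
      (d2'.hasFDerivAt.clm_apply (hasFDerivAt_const u x)).clm_apply (hasFDerivAt_const a x)
    have i1 := e1.inner ℝ (d1.hasFDerivAt.clm_apply (hasFDerivAt_const b x))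
    have i2 := e2.inner ℝ (d2.hasFDerivAt.clm_apply (hasFDerivAt_const b x))
    have heq : (fun y => inner ℝ (fderiv ℝ B₁ y u a) (B₁ y b)) =ᶠ[𝓝 x]
        fun y => inner ℝ (fderiv ℝ B₂ y u a) (B₂ y b) := by
      filter_upwards [hΩ] with y hy using h.connection y hy u a b
    have := congrArg (fun T => T v) ((i1.congr_of_eventuallyEq heq.symm).unique i2)
    simp at this
    linarith
  have hΩ := h.isOpen.mem_nhds hx
  have s1 := (h.frame₁.contDiffAt hΩ).isSymmSndFDerivAt
    (by simpa only [minSmoothness_of_isRCLikeNormedField] using ENat.LEInfty.out)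
  have s2 := (h.frame₂.contDiffAt hΩ).isSymmSndFDerivAt
    (by simpa only [minSmoothness_of_isRCLikeNormedField] using ENat.LEInfty.out)
  have k1 := key u v
  have k2 := key v u
  rw [s1 u v, s2 u v] at k2
  linarith

/-- The form `φ_τ` is flat with respect to the difference of the two inner products. -/
theorem flat {x : E} (hx : x ∈ Ω) (u v : E) (a b : E × F) :
    inner ℝ (frameSff B₁ x u a) (frameSff B₁ x v b) -
        inner ℝ (frameSff B₁ x v a) (frameSff B₁ x u b) =
      inner ℝ (frameSff B₂ x u a) (frameSff B₂ x v b) -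
        inner ℝ (frameSff B₂ x v a) (frameSff B₂ x u b) := by
  have key : ∀ u v : E, inner ℝ (fderiv ℝ B₁ x u a) (fderiv ℝ B₁ x v b) -
        inner ℝ (frameSff B₁ x u a) (frameSff B₁ x v b) =
      inner ℝ (fderiv ℝ B₂ x u a) (fderiv ℝ B₂ x v b) -
        inner ℝ (frameSff B₂ x u a) (frameSff B₂ x v b) := by
    intro u v
    obtain ⟨c, hc1, hc2⟩ := h.gauss_formula hx u a
    obtain ⟨d, hd1, hd2⟩ := h.gauss_formula hx v b
    rw [hc1, hc2, hd1, hd2]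
    simp only [inner_add_left, inner_add_right, inner_frameSff_left, h.metric x hx,
      real_inner_comm (frameSff B₁ x v b) (B₁ x c), real_inner_comm (frameSff B₂ x v b) (B₂ x c)]
    ring
  have h1 := h.inner_fderiv_sub hx u v a b
  have k1 := key u v
  have k2 := key v u
  linarith

/-- If `Y` is a regular element, then `φ_τ(u, a)` is a null vector for all `u` and all
`a ∈ ker φ_τ^Y`. -/
theorem norm_frameSff_eq {x : E} (hx : x ∈ Ω) {Y : E} {a : E × F}
    (hY : ∀ u, Module.finrank ℝ (LinearMap.range (pairForm B₁ B₂ x u : E × F →ₗ[ℝ] H₁ × H₂)) ≤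
      Module.finrank ℝ (LinearMap.range (pairForm B₁ B₂ x Y : E × F →ₗ[ℝ] H₁ × H₂)))
    (ha : pairForm B₁ B₂ x Y a = 0) (u : E) :
    ‖frameSff B₁ x u a‖ = ‖frameSff B₂ x u a‖ := by
  obtain ⟨b, hb⟩ := apply_ker_mem_range_of_max_rank
    (ContinuousLinearMap.coeLM ℝ ∘ₗ pairForm B₁ B₂ x) hY ha u
  have hb' : pairForm B₁ B₂ x Y b = pairForm B₁ B₂ x u a := hb
  rw [pairForm_apply] at ha
  rw [pairForm_apply, pairForm_apply] at hb'
  obtain ⟨ha1, ha2⟩ := Prod.mk.inj ha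
  obtain ⟨hb1, hb2⟩ := Prod.mk.inj hb'
  have := h.flat hx u Y a b
  rw [ha1, ha2, hb1, hb2, inner_zero_left, inner_zero_left, sub_zero, sub_zero,
    real_inner_self_eq_norm_sq, real_inner_self_eq_norm_sq] at this
  exact (sq_eq_sq₀ (norm_nonneg _) (norm_nonneg _)).mp this

end IsCompatiblePair

end Pairs

/-! ### Extensions along a vector field and their singularities -/

section Extensions

open Polynomial

variable {E H H₁ H₂ : Type*} [NormedAddCommGroup E] [NormedSpace ℝ E] [FiniteDimensional ℝ E]
  [NormedAddCommGroup H] [NormedSpace ℝ H] [FiniteDimensional ℝ H]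
  [NormedAddCommGroup H₁] [InnerProductSpace ℝ H₁] [FiniteDimensional ℝ H₁]
  [NormedAddCommGroup H₂] [InnerProductSpace ℝ H₂] [FiniteDimensional ℝ H₂]

/-- The differential at `(x, t)` of the map `(x, t) ↦ f x + t v x`. -/
noncomputable def extensionDeriv (f v : E → H) (x : E) (t : ℝ) : E × ℝ →L[ℝ] H :=
  (fderiv ℝ f x + t • fderiv ℝ v x).coprod (ContinuousLinearMap.toSpanSingleton ℝ (v x))

theorem extensionDeriv_apply (f v : E → H) (x : E) (t : ℝ) (z : E × ℝ) :
    extensionDeriv f v x t z = fderiv ℝ f x z.1 + t • fderiv ℝ v x z.1 + z.2 • v x := by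
  simp [extensionDeriv]

theorem hasFDerivAt_extensionDeriv {f v : E → H} {z : E × ℝ} (hf : DifferentiableAt ℝ f z.1)
    (hv : DifferentiableAt ℝ v z.1) :
    HasFDerivAt (fun z : E × ℝ => f z.1 + z.2 • v z.1) (extensionDeriv f v z.1 z.2) z := by
  have h1 : HasFDerivAt (fun z : E × ℝ => f z.1) _ z :=
    hf.hasFDerivAt.comp z (hasFDerivAt_fst (𝕜 := ℝ) (E := E) (F := ℝ))
  have h2 : HasFDerivAt (fun z : E × ℝ => v z.1) _ z :=
    hv.hasFDerivAt.comp z (hasFDerivAt_fst (𝕜 := ℝ) (E := E) (F := ℝ))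
  have h3 : HasFDerivAt (fun z : E × ℝ => z.2) _ z :=
    hasFDerivAt_snd (𝕜 := ℝ) (E := E) (F := ℝ)
  convert! h1.add (h3.smul h2) using 1
  ext a
  · simp [extensionDeriv_apply]
  · simp [extensionDeriv_apply]

/-- `f₁` and `f₂`, defined on an open set `U` of the vector space `E`, singularly extend
isometrically to an open set `N` of `E × ℝ` which meets `E × {0}` in `U × {0}`. -/
def LocallySingularlyExtend (U : Set E) (f₁ : E → H₁) (f₂ : E → H₂) : Prop :=
  ∃ (N : Set (E × ℝ)) (F₁ : E × ℝ → H₁) (F₂ : E × ℝ → H₂), IsOpen N ∧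
    ContDiffOn ℝ ∞ F₁ N ∧ ContDiffOn ℝ ∞ F₂ N ∧ (∀ x, (x, (0 : ℝ)) ∈ N ↔ x ∈ U) ∧
    (∀ x ∈ U, F₁ (x, 0) = f₁ x ∧ F₂ (x, 0) = f₂ x) ∧
    (∀ z ∈ N, ∀ a b, inner ℝ (fderiv ℝ F₁ z a) (fderiv ℝ F₁ z b) =
      inner ℝ (fderiv ℝ F₂ z a) (fderiv ℝ F₂ z b)) ∧
    ∀ z ∈ N, z.2 ≠ 0 →
      Function.Injective (fderiv ℝ F₁ z) ∧ Function.Injective (fderiv ℝ F₂ z)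

/-- Evaluation at a point, as a homomorphism from the ring of continuous functions. -/
def evalAt {Y : Type*} [TopologicalSpace Y] (y : Y) : C(Y, ℝ) →+* ℝ :=
  (Pi.evalRingHom (fun _ : Y => ℝ) y).comp ContinuousMap.coeFnRingHom

@[simp]
theorem evalAt_apply {Y : Type*} [TopologicalSpace Y] (y : Y) (c : C(Y, ℝ)) : evalAt y c = c y :=
  rfl

/-- The determinants of an affine family `A x + t B x` of endomorphisms are given by a polynomial in
`t` whose coefficients are continuous functions of `x`. -/
theorem exists_polynomial_det {Y V : Type*} [TopologicalSpace Y] [NormedAddCommGroup V]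
    [NormedSpace ℝ V] [FiniteDimensional ℝ V] {A B : Y → V →L[ℝ] V} (hA : Continuous A)
    (hB : Continuous B) :
    ∃ p : C(Y, ℝ)[X], ∀ y t,
      p.eval₂ (evalAt y) t =
        LinearMap.det ((A y + t • B y : V →L[ℝ] V) : V →ₗ[ℝ] V) := by
  let b := Module.finBasis ℝ V
  have hc : ∀ i, Continuous fun v => b.repr v i := fun i =>
    LinearMap.continuous_of_finiteDimensional (b.coord i)
  let MA : Matrix (Fin (Module.finrank ℝ V)) (Fin (Module.finrank ℝ V)) C(Y, ℝ) :=
    fun i j => ⟨fun y => b.repr (A y (b j)) i, (hc i).comp (hA.clm_apply continuous_const)⟩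
  let MB : Matrix (Fin (Module.finrank ℝ V)) (Fin (Module.finrank ℝ V)) C(Y, ℝ) :=
    fun i j => ⟨fun y => b.repr (B y (b j)) i, (hc i).comp (hB.clm_apply continuous_const)⟩
  refine ⟨Matrix.det (Matrix.of fun i j => C (MA i j) + X * C (MB i j)), fun y t => ?_⟩
  rw [← Polynomial.coe_eval₂RingHom, RingHom.map_det, ← LinearMap.det_toMatrix b]
  congr 1
  ext i j
  rw [LinearMap.toMatrix_apply]
  simp only [RingHom.mapMatrix_apply, Matrix.map_apply, Matrix.of_apply, map_add, eval₂_add, eval₂_mul,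
    coe_eval₂RingHom, eval₂_C, eval₂_X, evalAt_apply, ContinuousLinearMap.coe_coe, add_apply,
    smul_apply, map_smul, Finsupp.add_apply, Finsupp.smul_apply, smul_eq_mul]
  rfl

theorem injective_of_det_ne_zero {V : Type*} [NormedAddCommGroup V]
    [NormedSpace ℝ V] [FiniteDimensional ℝ V] {T : V →ₗ[ℝ] V} (h : LinearMap.det T ≠ 0) :
    Function.Injective T :=
  (LinearEquiv.ofIsUnitDet (f := T) (v := Module.finBasis ℝ V) (v' := Module.finBasis ℝ V)
    (by rw [LinearMap.det_toMatrix]; exact h.isUnit)).injective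

/-- If `f₁` and `f₂` do not singularly extend isometrically, then isometric extensions of the form
`f₁ x + t v₁ x` and `f₂ x + t v₂ x` are nowhere immersions. For otherwise a minor of the differential
is a polynomial `tᵏ q x t` in `t` with `q x 0` not identically zero, and the extensions are
immersions on the set where `q` does not vanish, except for `t = 0`. -/
theorem not_injective_extensionDeriv {Ω : Set E} {f₁ v₁ : E → H₁} {f₂ v₂ : E → H₂} (hΩ : IsOpen Ω)
    (hf₁ : ContDiffOn ℝ ∞ f₁ Ω) (hv₁ : ContDiffOn ℝ ∞ v₁ Ω)
    (hf₂ : ContDiffOn ℝ ∞ f₂ Ω) (hv₂ : ContDiffOn ℝ ∞ v₂ Ω)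
    (hiso : ∀ x ∈ Ω, ∀ t z, ‖extensionDeriv f₁ v₁ x t z‖ = ‖extensionDeriv f₂ v₂ x t z‖)
    (hgen : ∀ U ⊆ Ω, IsOpen U → U.Nonempty → ¬ LocallySingularlyExtend U f₁ f₂)
    {x₀ : E} (hx₀ : x₀ ∈ Ω) (t₀ : ℝ) : ¬ Function.Injective (extensionDeriv f₁ v₁ x₀ t₀) := by
  intro hinj
  obtain ⟨S, hS⟩ := LinearMap.exists_leftInverse_of_injective
    (extensionDeriv f₁ v₁ x₀ t₀ : E × ℝ →ₗ[ℝ] H₁) (LinearMap.ker_eq_bot.mpr hinj)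
  -- the minor of the differential which does not vanish at `(x₀, t₀)`, as the determinant of `A + t B`
  let A : Ω → E × ℝ →L[ℝ] E × ℝ := fun x => S.toContinuousLinearMap ∘L extensionDeriv f₁ v₁ x 0
  let B : Ω → E × ℝ →L[ℝ] E × ℝ := fun x =>
    S.toContinuousLinearMap ∘L fderiv ℝ v₁ x ∘L ContinuousLinearMap.fst ℝ E ℝ
  have hdf : ContinuousOn (fderiv ℝ f₁) Ω := hf₁.continuousOn_fderiv_of_isOpen hΩ (by simp)
  have hdv : ContinuousOn (fderiv ℝ v₁) Ω := hv₁.continuousOn_fderiv_of_isOpen hΩ (by simp)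
  have hA : Continuous A := by
    have : A = fun x : Ω => S.toContinuousLinearMap ∘L
        (fderiv ℝ f₁ x ∘L ContinuousLinearMap.fst ℝ E ℝ +
          ContinuousLinearMap.toSpanSingletonCLE (𝕜 := ℝ) (v₁ x) ∘L
            ContinuousLinearMap.snd ℝ E ℝ) := by
      funext x
      refine ContinuousLinearMap.ext fun z => ?_
      simp [A, extensionDeriv_apply]
    rw [this]
    refine continuous_const.clm_comp (((continuousOn_iff_continuous_domRestrict.mp hdf).clm_comp
      continuous_const).add (Continuous.clm_comp ?_ continuous_const))
    exact (ContinuousLinearMap.toSpanSingletonCLE (𝕜 := ℝ) (E := H₁)).continuous.comp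
      (continuousOn_iff_continuous_domRestrict.mp hv₁.continuousOn)
  have hB : Continuous B := continuous_const.clm_comp
    ((continuousOn_iff_continuous_domRestrict.mp hdv).clm_comp continuous_const)
  have hAB : ∀ (x : Ω) t, A x + t • B x = S.toContinuousLinearMap ∘L extensionDeriv f₁ v₁ x t := by
    intro x t
    refine ContinuousLinearMap.ext fun z => ?_
    change S (extensionDeriv f₁ v₁ x 0 z) + t • S (fderiv ℝ v₁ x z.1) =
      S (extensionDeriv f₁ v₁ x t z)
    rw [← map_smul, ← map_add, extensionDeriv_apply, extensionDeriv_apply, zero_smul]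
    congr 1
    abel
  obtain ⟨p, hp⟩ := exists_polynomial_det hA hB
  have hp0 : p ≠ 0 := by
    rintro rfl
    have := hp ⟨x₀, hx₀⟩ t₀
    rw [hAB] at this
    have h1 : ((S.toContinuousLinearMap ∘L extensionDeriv f₁ v₁ x₀ t₀ : E × ℝ →L[ℝ] E × ℝ) :
        E × ℝ →ₗ[ℝ] E × ℝ) = LinearMap.id := hS
    rw [h1, LinearMap.det_id] at this
    simp at this
  -- divide by the largest power of `t`, so that the quotient does not vanish identically at `t = 0`
  obtain ⟨q, hq⟩ : X ^ p.natTrailingDegree ∣ p := by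
    rw [X_pow_dvd_iff]
    exact fun d hd => coeff_eq_zero_of_lt_natTrailingDegree hd
  set k := p.natTrailingDegree with hk
  have hq0 : q.coeff 0 ≠ 0 := by
    have h1 : p.coeff k ≠ 0 := by
      rw [hk]; exact mt trailingCoeff_eq_zero.mp hp0
    rw [hq, coeff_X_pow_mul'] at h1
    simpa using h1
  let Q : Ω × ℝ → ℝ := fun z => q.eval₂ (evalAt z.1) z.2
  have hQ : Continuous Q := by
    simp only [Q, eval₂_eq_sum_range, evalAt_apply]
    fun_prop
  have hQ0 : ∀ x : Ω, Q (x, 0) = q.coeff 0 x := by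
    intro x
    simp [Q, eval₂_at_zero]
  let ι : Ω × ℝ → E × ℝ := Prod.map Subtype.val id
  have hι : Topology.IsOpenEmbedding ι :=
    hΩ.isOpenEmbedding_subtypeVal.prodMap Topology.IsOpenEmbedding.id
  let N : Set (E × ℝ) := ι '' {z | Q z ≠ 0}
  let U : Set E := Subtype.val '' {x : Ω | q.coeff 0 x ≠ 0}
  have hN : IsOpen N := hι.isOpenMap _ (isOpen_ne_fun hQ continuous_const)
  have hU : IsOpen U := hΩ.isOpenEmbedding_subtypeVal.isOpenMap _
    (isOpen_ne_fun (q.coeff 0).continuous continuous_const)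
  have hNΩ : ∀ z ∈ N, z.1 ∈ Ω := by
    rintro _ ⟨z, -, rfl⟩; exact z.1.2
  have hUΩ : U ⊆ Ω := by
    rintro _ ⟨z, -, rfl⟩; exact z.2
  have hUne : U.Nonempty := by
    by_contra hne
    refine hq0 (ContinuousMap.ext fun x => ?_)
    by_contra hx
    exact hne ⟨x, x, hx, rfl⟩
  have hfst : Set.MapsTo (Prod.fst : E × ℝ → E) N Ω := hNΩ
  have hder₁ : ∀ z ∈ N, fderiv ℝ (fun z : E × ℝ => f₁ z.1 + z.2 • v₁ z.1) z =
      extensionDeriv f₁ v₁ z.1 z.2 := fun z hz =>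
    (hasFDerivAt_extensionDeriv
      ((hf₁.contDiffAt (hΩ.mem_nhds (hNΩ z hz))).differentiableAt (by simp))
      ((hv₁.contDiffAt (hΩ.mem_nhds (hNΩ z hz))).differentiableAt (by simp))).fderiv
  have hder₂ : ∀ z ∈ N, fderiv ℝ (fun z : E × ℝ => f₂ z.1 + z.2 • v₂ z.1) z =
      extensionDeriv f₂ v₂ z.1 z.2 := fun z hz =>
    (hasFDerivAt_extensionDeriv
      ((hf₂.contDiffAt (hΩ.mem_nhds (hNΩ z hz))).differentiableAt (by simp))
      ((hv₂.contDiffAt (hΩ.mem_nhds (hNΩ z hz))).differentiableAt (by simp))).fderiv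
  have hinj₁ : ∀ z ∈ N, z.2 ≠ 0 → Function.Injective (extensionDeriv f₁ v₁ z.1 z.2) := by
    rintro _ ⟨⟨x, t⟩, hz, rfl⟩ ht
    have ht' : t ≠ 0 := ht
    have h1 : LinearMap.det ((A x + t • B x : E × ℝ →L[ℝ] E × ℝ) : E × ℝ →ₗ[ℝ] E × ℝ) ≠ 0 := by
      rw [← hp, hq, eval₂_mul, eval₂_X_pow]
      exact mul_ne_zero (pow_ne_zero _ ht') hz
    have h2 := injective_of_det_ne_zero h1
    rw [hAB] at h2
    exact Function.Injective.of_comp h2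
  refine hgen U hUΩ hU hUne ⟨N, fun z => f₁ z.1 + z.2 • v₁ z.1, fun z => f₂ z.1 + z.2 • v₂ z.1,
    hN, ?_, ?_, ?_, ?_, ?_, ?_⟩
  · exact (hf₁.comp contDiff_fst.contDiffOn hfst).add
      (contDiff_snd.contDiffOn.smul (hv₁.comp contDiff_fst.contDiffOn hfst))
  · exact (hf₂.comp contDiff_fst.contDiffOn hfst).add
      (contDiff_snd.contDiffOn.smul (hv₂.comp contDiff_fst.contDiffOn hfst))
  · intro x
    constructor
    · rintro ⟨⟨y, t⟩, hy, hyx⟩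
      obtain ⟨rfl, rfl⟩ := Prod.mk.inj hyx
      have hy' : q.coeff 0 y ≠ 0 := by rw [← hQ0]; exact hy
      exact ⟨y, hy', rfl⟩
    · rintro ⟨y, hy, rfl⟩
      exact ⟨(y, 0), by change Q (y, 0) ≠ 0; rw [hQ0]; exact hy, rfl⟩
  · intro x _; simp
  · intro z hz a b
    rw [hder₁ z hz, hder₂ z hz]
    have h := hiso z.1 (hNΩ z hz) z.2
    rw [real_inner_eq_norm_add_mul_self_sub_norm_mul_self_sub_norm_mul_self_div_two,
      real_inner_eq_norm_add_mul_self_sub_norm_mul_self_sub_norm_mul_self_div_two,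
      ← map_add, ← map_add, h, h, h]
  · intro z hz hz2
    rw [hder₁ z hz, hder₂ z hz]
    refine ⟨hinj₁ z hz hz2, ?_⟩
    rw [injective_iff_map_eq_zero]
    intro a ha
    have h := hiso z.1 (hNΩ z hz) z.2 a
    rw [ha, norm_zero, norm_eq_zero] at h
    exact hinj₁ z hz hz2 (by rw [h, map_zero])

/-- If `g` is a section of `TM ⊕ L` such that `φ_τ(u, g)` is always a null vector, then the
extensions of `f₁` and `f₂` along `g` and `τ̄ g` induce the same metric. -/
theorem IsCompatiblePair.norm_extensionDeriv_eq {F : Type*} [NormedAddCommGroup F] [NormedSpace ℝ F]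
    [FiniteDimensional ℝ F] {Ω : Set E} {f₁ : E → H₁} {f₂ : E → H₂}
    {B₁ : E → E × F →L[ℝ] H₁} {B₂ : E → E × F →L[ℝ] H₂}
    (h : IsCompatiblePair Ω f₁ f₂ B₁ B₂) {x : E} (hx : x ∈ Ω) {g : E → E × F}
    (hg : DifferentiableAt ℝ g x)
    (hnull : ∀ u, ‖frameSff B₁ x u (g x)‖ = ‖frameSff B₂ x u (g x)‖) (t : ℝ) (z : E × ℝ) :
    ‖extensionDeriv f₁ (fun y => B₁ y (g y)) x t z‖ = ‖extensionDeriv f₂ (fun y => B₂ y (g y)) x t z‖ := by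
  have hΩ := h.isOpen.mem_nhds hx
  have d1 : DifferentiableAt ℝ B₁ x := (h.frame₁.contDiffAt hΩ).differentiableAt (by simp)
  have d2 : DifferentiableAt ℝ B₂ x := (h.frame₂.contDiffAt hΩ).differentiableAt (by simp)
  have e1 := (d1.hasFDerivAt.clm_apply hg.hasFDerivAt).fderiv
  have e2 := (d2.hasFDerivAt.clm_apply hg.hasFDerivAt).fderiv
  obtain ⟨c, hc1, hc2⟩ := h.gauss_formula hx z.1 (g x)
  let w : E × F := (z.1, 0) + t • (c + fderiv ℝ g x z.1) + z.2 • g x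
  have k1 : extensionDeriv f₁ (fun y => B₁ y (g y)) x t z =
      B₁ x w + t • frameSff B₁ x z.1 (g x) := by
    rw [extensionDeriv_apply, e1]
    simp only [add_apply, ContinuousLinearMap.comp_apply,
      ContinuousLinearMap.flip_apply, hc1, w, map_add, map_smul, h.tangent₁ x hx, smul_add]
    abel
  have k2 : extensionDeriv f₂ (fun y => B₂ y (g y)) x t z =
      B₂ x w + t • frameSff B₂ x z.1 (g x) := by
    rw [extensionDeriv_apply, e2]
    simp only [add_apply, ContinuousLinearMap.comp_apply,
      ContinuousLinearMap.flip_apply, hc2, w, map_add, map_smul, h.tangent₂ x hx, smul_add]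
    abel
  rw [k1, k2, ← sq_eq_sq₀ (norm_nonneg _) (norm_nonneg _), norm_add_sq_real, norm_add_sq_real]
  rw [inner_smul_right, inner_smul_right, real_inner_comm, inner_frameSff_left,
    real_inner_comm _ (B₂ x w), inner_frameSff_left, norm_smul, norm_smul, hnull,
    ← real_inner_self_eq_norm_sq (B₁ x w), ← real_inner_self_eq_norm_sq (B₂ x w), h.metric x hx]

end Extensions

/-! ### Flows and local inverses -/

section LocalAnalysis

variable {P Q : Type*} [NormedAddCommGroup P] [NormedSpace ℝ P] [CompleteSpace P]
  [NormedAddCommGroup Q] [NormedSpace ℝ Q]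

/-- A `C¹` vector field has a local flow which is jointly continuous. -/
theorem exists_continuousAt_local_flow {X : P → P} {p₀ : P} (hX : ContDiffAt ℝ 1 X p₀) :
    ∃ (α : P × ℝ → P) (ε : ℝ), 0 < ε ∧ ContinuousAt α (p₀, 0) ∧ ∀ᶠ p in 𝓝 p₀, α (p, 0) = p ∧
      ∀ t ∈ Set.Ioo (-ε) ε, HasDerivAt (fun s => α (p, s)) (X (α (p, t))) t := by
  obtain ⟨ε, hε, a, r, L, K, hr, hpl⟩ := IsPicardLindelof.of_contDiffAt_one hX
  obtain ⟨α, hα, hc⟩ :=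
    (hpl 0).exists_forall_mem_closedBall_eq_hasDerivWithinAt_continuousOn
  have hball : Metric.closedBall p₀ (r : ℝ) ∈ 𝓝 p₀ := Metric.closedBall_mem_nhds _ hr
  refine ⟨α, ε, hε, hc.continuousAt
    (prod_mem_nhds hball (Icc_mem_nhds (by linarith) (by linarith))), ?_⟩
  filter_upwards [hball] with p hp
  obtain ⟨h1, h2⟩ := hα p hp
  refine ⟨h1, fun t ht => ?_⟩
  have ht' : t ∈ Set.Ioo (0 - ε) (0 + ε) := by simpa using ht
  exact (h2 t (Set.Ioo_subset_Icc_self ht')).hasDerivAt (Icc_mem_nhds ht'.1 ht'.2)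

theorem eq_of_forall_hasDerivAt_zero {Φ : ℝ → Q} {c : ℝ} (hc : 0 ≤ c)
    (h : ∀ t ∈ Set.Icc 0 c, HasDerivAt Φ 0 t) : Φ c = Φ 0 :=
  constant_of_has_deriv_right_zero (fun t ht => (h t ht).continuousAt.continuousWithinAt)
    (fun t ht => (h t (Set.Ico_subset_Icc_self ht)).hasDerivWithinAt) c ⟨hc, le_rfl⟩

/-- Inverse function theorem for smooth maps, with smoothness of the local inverse on its whole
domain. -/
theorem exists_openPartialHomeomorph_of_isInvertible {g : P → Q} {Ω : Set P} {p₀ : P}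
    (hΩ : IsOpen Ω) (hg : ContDiffOn ℝ ∞ g Ω) (hp₀ : p₀ ∈ Ω) (hinv : (fderiv ℝ g p₀).IsInvertible) :
    ∃ e : OpenPartialHomeomorph P Q, p₀ ∈ e.source ∧ e.source ⊆ Ω ∧ (e : P → Q) = g ∧
      ContDiffOn ℝ ∞ e.symm e.target := by
  obtain ⟨A, hA⟩ := hinv
  have hd : ∀ p ∈ Ω, DifferentiableAt ℝ g p := fun p hp =>
    (hg.contDiffAt (hΩ.mem_nhds hp)).differentiableAt (by simp)
  have hg0 := hg.contDiffAt (hΩ.mem_nhds hp₀)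
  have hA' : HasFDerivAt g (A : P →L[ℝ] Q) p₀ := hA ▸ (hd p₀ hp₀).hasFDerivAt
  let e₀ := hg0.toOpenPartialHomeomorph g hA' (by simp)
  have he₀ : (e₀ : P → Q) = g := hg0.toOpenPartialHomeomorph_coe hA' (by simp)
  let U : Set P := Ω ∩ fderiv ℝ g ⁻¹' Set.range ((↑) : (P ≃L[ℝ] Q) → P →L[ℝ] Q)
  have hU : IsOpen U := (hg.continuousOn_fderiv_of_isOpen hΩ (by simp)).isOpen_inter_preimage hΩ
    (ContinuousLinearEquiv.isOpen)
  refine ⟨e₀.restrOpen U hU, ⟨hg0.mem_toOpenPartialHomeomorph_source hA' (by simp), hp₀, A, hA.symm ▸ rfl⟩,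
    fun p hp => hp.2.1, he₀, ?_⟩
  intro q hq
  have hp : (e₀.restrOpen U hU).symm q ∈ (e₀.restrOpen U hU).source :=
    (e₀.restrOpen U hU).map_target hq
  obtain ⟨-, hpΩ, A', hA'⟩ := hp
  refine ((e₀.restrOpen U hU).contDiffAt_symm hq (f₀' := A') ?_ ?_).contDiffWithinAt
  · change HasFDerivAt e₀ _ _
    rw [he₀, hA']
    exact (hd _ hpΩ).hasFDerivAt
  · change ContDiffAt ℝ ∞ e₀ _
    rw [he₀]
    exact hg.contDiffAt (hΩ.mem_nhds hpΩ)

end LocalAnalysis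

/-! ### Rulings -/

section Rulings

variable {E K H H₁ H₂ : Type*} [NormedAddCommGroup E] [NormedSpace ℝ E] [FiniteDimensional ℝ E]
  [NormedAddCommGroup K] [NormedSpace ℝ K] [FiniteDimensional ℝ K]
  [NormedAddCommGroup H] [NormedSpace ℝ H] [FiniteDimensional ℝ H]
  [NormedAddCommGroup H₁] [NormedSpace ℝ H₁] [FiniteDimensional ℝ H₁]
  [NormedAddCommGroup H₂] [NormedSpace ℝ H₂] [FiniteDimensional ℝ H₂]

/-- The frame `f_* ∘ z` of the image under `f` of the distribution with frame `z`. -/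
noncomputable def pushFrame (f : E → H) (z : E → K →L[ℝ] E) (x : E) : K →L[ℝ] H :=
  fderiv ℝ f x ∘L z x

/-- `z` is a frame of a distribution `D` such that, for every `v = z k` with `k` constant, the maps
`f₁ + t f₁_* v` and `f₂ + t f₂_* v` induce the same metric and are nowhere immersions. -/
structure IsRulingPair (Ω : Set E) (f₁ : E → H₁) (f₂ : E → H₂) (z : E → K →L[ℝ] E) : Prop where
  isOpen : IsOpen Ω
  smooth₁ : ContDiffOn ℝ ∞ f₁ Ω
  smooth₂ : ContDiffOn ℝ ∞ f₂ Ω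
  smooth_frame : ContDiffOn ℝ ∞ z Ω
  injective : ∀ x ∈ Ω, Function.Injective (fderiv ℝ f₁ x)
  injective_frame : ∀ x ∈ Ω, Function.Injective (z x)
  isometric : ∀ x ∈ Ω, ∀ k t a, ‖extensionDeriv f₁ (fun y => pushFrame f₁ z y k) x t a‖ =
    ‖extensionDeriv f₂ (fun y => pushFrame f₂ z y k) x t a‖
  singular : ∀ x ∈ Ω, ∀ k t,
    ¬ Function.Injective (extensionDeriv f₁ (fun y => pushFrame f₁ z y k) x t)

namespace IsRulingPair

variable {Ω : Set E} {f₁ : E → H₁} {f₂ : E → H₂} {z : E → K →L[ℝ] E}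

theorem contDiffOn_pushFrame₁ (h : IsRulingPair Ω f₁ f₂ z) :
    ContDiffOn ℝ ∞ (pushFrame f₁ z) Ω :=
  (h.smooth₁.fderiv_of_isOpen h.isOpen (by simp)).clm_comp h.smooth_frame

theorem contDiffOn_pushFrame₂ (h : IsRulingPair Ω f₁ f₂ z) :
    ContDiffOn ℝ ∞ (pushFrame f₂ z) Ω :=
  (h.smooth₂.fderiv_of_isOpen h.isOpen (by simp)).clm_comp h.smooth_frame

/-- The derivative of `(x, t, k) ↦ f x + t (f_* z) x k`, in the directions in which `t` decreases at
unit speed and `k` is fixed. -/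
theorem hasFDerivAt_sweep {f : E → H} {p : E × ℝ × K} (hf : DifferentiableAt ℝ f p.1)
    (hV : DifferentiableAt ℝ (pushFrame f z) p.1) :
    ∃ T : E × ℝ × K →L[ℝ] H,
      HasFDerivAt (fun p : E × ℝ × K => f p.1 + p.2.1 • pushFrame f z p.1 p.2.2) T p ∧
      ∀ ξ, T (ξ, -1, 0) =
        extensionDeriv f (fun y => pushFrame f z y p.2.2) p.1 p.2.1 (ξ, -1) := by
  have h1 : HasFDerivAt (fun p : E × ℝ × K => f p.1) _ p :=
    hf.hasFDerivAt.comp p (hasFDerivAt_fst (𝕜 := ℝ) (E := E) (F := ℝ × K))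
  have h2 : HasFDerivAt (fun p : E × ℝ × K => pushFrame f z p.1) _ p :=
    hV.hasFDerivAt.comp p (hasFDerivAt_fst (𝕜 := ℝ) (E := E) (F := ℝ × K))
  have h3 : HasFDerivAt (fun p : E × ℝ × K => p.2.1)
      ((ContinuousLinearMap.fst ℝ ℝ K) ∘L (ContinuousLinearMap.snd ℝ E (ℝ × K))) p :=
    ContinuousLinearMap.hasFDerivAt
      ((ContinuousLinearMap.fst ℝ ℝ K) ∘L (ContinuousLinearMap.snd ℝ E (ℝ × K)))
  have h4 : HasFDerivAt (fun p : E × ℝ × K => p.2.2)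
      ((ContinuousLinearMap.snd ℝ ℝ K) ∘L (ContinuousLinearMap.snd ℝ E (ℝ × K))) p :=
    ContinuousLinearMap.hasFDerivAt
      ((ContinuousLinearMap.snd ℝ ℝ K) ∘L (ContinuousLinearMap.snd ℝ E (ℝ × K)))
  refine ⟨_, h1.add (h3.smul (h2.clm_apply h4)), fun ξ => ?_⟩
  have h5 : fderiv ℝ (fun y => pushFrame f z y p.2.2) p.1 =
      (fderiv ℝ (pushFrame f z) p.1).flip p.2.2 := by
    have := (hV.hasFDerivAt.clm_apply (hasFDerivAt_const p.2.2 p.1)).fderiv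
    rw [this]
    ext; simp
  rw [extensionDeriv_apply, h5]
  simp
  abel

/-- The straight lines `f₁ x + t v`, `f₂ x + t v` with `v` in the distribution stay, for small `t`,
in the images of `f₁` and `f₂`, and come from the same point `y`. Indeed the kernels of the
differentials of `f₁ + t v` and of `f₂ + t v` coincide and contain a vector `Z - ∂/∂t`; both maps
are constant along its integral curves, and these reach `t = 0`. -/
theorem exists_transport (h : IsRulingPair Ω f₁ f₂ z) {x₀ : E} (hx₀ : x₀ ∈ Ω) {O : Set E}
    (hO : O ∈ 𝓝 x₀) :
    ∀ᶠ p : E × K in 𝓝 (x₀, 0), ∃ y ∈ O, f₁ y = f₁ p.1 + pushFrame f₁ z p.1 p.2 ∧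
      f₂ y = f₂ p.1 + pushFrame f₂ z p.1 p.2 := by
  obtain ⟨S, hS⟩ := LinearMap.exists_leftInverse_of_injective
    (fderiv ℝ f₁ x₀ : E →ₗ[ℝ] H₁) (LinearMap.ker_eq_bot.mpr (h.injective x₀ hx₀))
  have hV₁ := h.contDiffOn_pushFrame₁
  -- `M (x, t, k)` is the differential in `x` of `f₁ x + t (f₁_* z) x k`
  let M : E × ℝ × K → E →L[ℝ] H₁ := fun p =>
    fderiv ℝ f₁ p.1 + p.2.1 • (ContinuousLinearMap.apply ℝ H₁ p.2.2 ∘L fderiv ℝ (pushFrame f₁ z) p.1)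
  let A : E × ℝ × K → E →L[ℝ] E := fun p => S.toContinuousLinearMap ∘L M p
  let Ω' : Set (E × ℝ × K) := Prod.fst ⁻¹' Ω
  have hΩ' : IsOpen Ω' := h.isOpen.preimage continuous_fst
  have hfst : Set.MapsTo (Prod.fst : E × ℝ × K → E) Ω' Ω := fun p hp => hp
  have hMs : ContDiffOn ℝ ∞ M Ω' := by
    refine ((h.smooth₁.fderiv_of_isOpen h.isOpen (m := ∞) (by simp)).comp contDiff_fst.contDiffOn
      hfst).add ((contDiff_fst.comp contDiff_snd).contDiffOn.smul ?_)
    exact ((ContinuousLinearMap.apply ℝ H₁ : K →L[ℝ] (K →L[ℝ] H₁) →L[ℝ] H₁).contDiff.comp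
      (contDiff_snd.comp contDiff_snd)).contDiffOn.clm_comp
        ((hV₁.fderiv_of_isOpen h.isOpen (m := ∞) (by simp)).comp contDiff_fst.contDiffOn hfst)
  have hAs : ContDiffOn ℝ ∞ A Ω' := contDiffOn_const.clm_comp hMs
  let p₀ : E × ℝ × K := (x₀, 0, 0)
  have hA₀ : A p₀ = ContinuousLinearMap.id ℝ E := by
    refine ContinuousLinearMap.ext fun u => ?_
    have : M p₀ = fderiv ℝ f₁ x₀ := by simp [M, p₀]
    change S (M p₀ u) = u
    rw [this]
    exact LinearMap.congr_fun hS u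
  -- `(f₁_* z) x k` lies in the range of `M (x, t, k)`, and `Z (x, t, k)` is its preimage, computed
  -- with the left inverse `A⁻¹ S` in order to be smooth
  let Z : E × ℝ × K → E := fun p => (A p).inverse (S (pushFrame f₁ z p.1 p.2.2))
  let X : E × ℝ × K → E × ℝ × K := fun p => (Z p, -1, 0)
  have hX : ContDiffAt ℝ 1 X p₀ := by
    have hΩn : Ω' ∈ 𝓝 p₀ := hΩ'.mem_nhds hx₀
    have h1 : ContDiffAt ℝ ∞ (fun p => (A p).inverse) p₀ := by
      refine ContDiffAt.comp (g := ContinuousLinearMap.inverse) p₀ ?_ (hAs.contDiffAt hΩn)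
      rw [hA₀]
      exact ContinuousLinearMap.IsInvertible.contDiffAt_map_inverse
        ⟨ContinuousLinearEquiv.refl ℝ E, rfl⟩
    have h2 : ContDiffAt ℝ ∞ (fun p : E × ℝ × K => pushFrame f₁ z p.1 p.2.2) p₀ :=
      (((hV₁.comp contDiff_fst.contDiffOn hfst).contDiffAt hΩn)).clm_apply
        (contDiff_snd.comp contDiff_snd).contDiffAt
    have h3 : ContDiffAt ℝ ∞ Z p₀ :=
      h1.clm_apply (S.toContinuousLinearMap.contDiff.contDiffAt.comp p₀ h2)
    exact (h3.prodMk contDiffAt_const).of_le (by simp)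
  obtain ⟨α, ε, hε, hαc, hα⟩ := exists_continuousAt_local_flow hX
  -- on `Good` the vector field `X` is tangent to the kernels of both differentials
  let Good : Set (E × ℝ × K) := Ω' ∩ A ⁻¹' {T | Function.Injective T}
  have hGood : IsOpen Good := hAs.continuousOn.isOpen_inter_preimage hΩ'
    ContinuousLinearMap.isOpen_injective
  have hext : ∀ p ∈ Good,
      extensionDeriv f₁ (fun y => pushFrame f₁ z y p.2.2) p.1 p.2.1 (Z p, -1) = 0 := by
    rintro p ⟨hpΩ, hpA⟩
    have hpA' : Function.Injective (A p) := hpA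
    have hVd : DifferentiableAt ℝ (pushFrame f₁ z) p.1 :=
      (hV₁.contDiffAt (h.isOpen.mem_nhds hpΩ)).differentiableAt (by simp)
    have h5 : fderiv ℝ (fun y => pushFrame f₁ z y p.2.2) p.1 =
        (fderiv ℝ (pushFrame f₁ z) p.1).flip p.2.2 := by
      rw [(hVd.hasFDerivAt.clm_apply (hasFDerivAt_const p.2.2 p.1)).fderiv]
      ext; simp
    have hform : ∀ a, extensionDeriv f₁ (fun y => pushFrame f₁ z y p.2.2) p.1 p.2.1 a =
        M p a.1 + a.2 • pushFrame f₁ z p.1 p.2.2 := by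
      intro a; rw [extensionDeriv_apply, h5]; rfl
    obtain ⟨⟨u, r⟩, hur, hne⟩ : ∃ a, extensionDeriv f₁ (fun y => pushFrame f₁ z y p.2.2)
        p.1 p.2.1 a = 0 ∧ a ≠ 0 := by
      by_contra hcon
      push Not at hcon
      exact h.singular p.1 hpΩ p.2.2 p.2.1 ((injective_iff_map_eq_zero _).mpr hcon)
    rw [hform] at hur
    simp only at hur
    have hMinj : ∀ u, M p u = 0 → u = 0 := fun u hu => hpA' (by
      change S (M p u) = S (M p 0); rw [hu, map_zero (M p)])
    -- the kernel is transversal to `E × {0}`, as `M p` is injective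
    have hr : r ≠ 0 := by
      rintro rfl
      refine hne ?_
      rw [zero_smul, add_zero] at hur
      rw [hMinj u hur]; rfl
    have hV : pushFrame f₁ z p.1 p.2.2 = M p (-(r⁻¹ • u)) := by
      rw [map_neg, map_smul, eq_neg_iff_add_eq_zero, ← smul_right_injective _ hr |>.eq_iff]
      simp only [smul_add, smul_zero, smul_smul, mul_inv_cancel₀ hr, one_smul]
      rw [add_comm]; exact hur
    have hZ : Z p = -(r⁻¹ • u) := by
      have hAi := ContinuousLinearMap.isInvertible_of_injective hpA'
      change (A p).inverse (S (pushFrame f₁ z p.1 p.2.2)) = _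
      rw [hV]
      exact hAi.inverse_apply_self _
    rw [hform, hZ, ← hV]
    simp
  -- choose a product neighbourhood whose flow lines stay in `Good` and have first component in `O`
  have hGoodO : Good ∩ Prod.fst ⁻¹' O ∈ 𝓝 (α (p₀, 0)) := by
    rw [hα.self_of_nhds.1]
    refine Filter.inter_mem (hGood.mem_nhds ⟨hx₀, ?_⟩) (continuous_fst.continuousAt hO)
    change Function.Injective (A p₀)
    rw [hA₀]; exact Function.injective_id
  have hev : ∀ᶠ q in 𝓝 (p₀, (0 : ℝ)), α q ∈ Good ∩ Prod.fst ⁻¹' O := hαc hGoodO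
  obtain ⟨r₁, hr₁, hr₁'⟩ := Metric.eventually_nhds_iff.mp hev
  obtain ⟨r₂, hr₂, hr₂'⟩ := Metric.eventually_nhds_iff.mp hα
  let c : ℝ := min (min r₁ r₂) ε / 2
  have hc : 0 < c := by positivity
  have hc1 : c < r₁ := by
    have := min_le_left (min r₁ r₂) ε; have := min_le_left r₁ r₂; simp only [c]; linarith
  have hc2 : c < r₂ := by
    have := min_le_left (min r₁ r₂) ε; have := min_le_right r₁ r₂; simp only [c]; linarith
  have hc3 : c < ε := by
    have := min_le_right (min r₁ r₂) ε; simp only [c]; linarith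
  have hnear : ∀ᶠ p : E × K in 𝓝 (x₀, 0),
      dist (p.1, c, c⁻¹ • p.2) p₀ < min r₁ r₂ := by
    have hcont : Continuous fun p : E × K => dist (p.1, c, c⁻¹ • p.2) p₀ := by fun_prop
    refine hcont.continuousAt.eventually (gt_mem_nhds ?_)
    simp only [p₀, smul_zero, Prod.dist_eq, dist_self, Real.dist_eq, sub_zero, abs_of_pos hc]
    simp [hc1, hc2, hr₁, hr₂]
  filter_upwards [hnear] with p hp
  -- the flow line from `(x, c, c⁻¹ k)` reaches `t = 0` at time `c`; its value of `f + t (f_* z) k`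
  -- is `f x + (f_* z) x k`
  let q : E × ℝ × K := (p.1, c, c⁻¹ • p.2)
  obtain ⟨hq0', hqd⟩ := hr₂' (lt_of_lt_of_le hp (min_le_right _ _))
  have hq0 : α (q, 0) = q := hq0'
  have hmem : ∀ t ∈ Set.Icc 0 c, α (q, t) ∈ Good ∩ Prod.fst ⁻¹' O := by
    intro t ht
    refine hr₁' ?_
    rw [Prod.dist_eq]
    refine max_lt (lt_of_lt_of_le hp (min_le_left _ _)) ?_
    rw [Real.dist_eq, sub_zero, abs_of_nonneg ht.1]
    exact lt_of_le_of_lt ht.2 hc1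
  have hder : ∀ t ∈ Set.Icc 0 c, HasDerivAt (fun s => α (q, s)) (X (α (q, t))) t := fun t ht =>
    hqd t ⟨by linarith [ht.1], lt_of_le_of_lt ht.2 hc3⟩
  have htime : (α (q, c)).2.1 = 0 := by
    have h1 : (α (q, c)).2.1 + c = (α (q, 0)).2.1 + 0 := by
      refine eq_of_forall_hasDerivAt_zero hc.le (Φ := fun t => (α (q, t)).2.1 + t) fun t ht => ?_
      have := (((ContinuousLinearMap.fst ℝ ℝ K) ∘L
        (ContinuousLinearMap.snd ℝ E (ℝ × K))).hasFDerivAt.comp_hasDerivAt t (hder t ht)).add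
        (hasDerivAt_id t)
      convert! this using 1
      simp [X]
    rw [hq0] at h1
    simp only [q] at h1
    linarith
  refine ⟨(α (q, c)).1, (hmem c ⟨hc.le, le_rfl⟩).2, ?_, ?_⟩
  · have h1 := eq_of_forall_hasDerivAt_zero hc.le (Φ := fun t => f₁ (α (q, t)).1 +
        (α (q, t)).2.1 • pushFrame f₁ z (α (q, t)).1 (α (q, t)).2.2) fun t ht => by
      have hg := (hmem t ht).1
      obtain ⟨T, hT, hT'⟩ := hasFDerivAt_sweep (z := z) (f := f₁) (p := α (q, t))
        ((h.smooth₁.contDiffAt (h.isOpen.mem_nhds hg.1)).differentiableAt (by simp))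
        ((hV₁.contDiffAt (h.isOpen.mem_nhds hg.1)).differentiableAt (by simp))
      have := hT.comp_hasDerivAt t (hder t ht)
      rw [show X (α (q, t)) = (Z (α (q, t)), -1, 0) from rfl, hT', hext _ hg] at this
      exact this
    simp only [htime, hq0, zero_smul, add_zero] at h1
    rw [h1]
    simp [q, smul_smul, hc.ne']
  · have h1 := eq_of_forall_hasDerivAt_zero hc.le (Φ := fun t => f₂ (α (q, t)).1 +
        (α (q, t)).2.1 • pushFrame f₂ z (α (q, t)).1 (α (q, t)).2.2) fun t ht => by
      have hg := (hmem t ht).1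
      obtain ⟨T, hT, hT'⟩ := hasFDerivAt_sweep (z := z) (f := f₂) (p := α (q, t))
        ((h.smooth₂.contDiffAt (h.isOpen.mem_nhds hg.1)).differentiableAt (by simp))
        ((h.contDiffOn_pushFrame₂.contDiffAt (h.isOpen.mem_nhds hg.1)).differentiableAt (by simp))
      have h0 : extensionDeriv f₂ (fun y => pushFrame f₂ z y (α (q, t)).2.2) (α (q, t)).1
          (α (q, t)).2.1 (Z (α (q, t)), -1) = 0 := by
        rw [← norm_eq_zero, ← h.isometric _ hg.1, hext _ hg, norm_zero]
      have := hT.comp_hasDerivAt t (hder t ht)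
      rw [show X (α (q, t)) = (Z (α (q, t)), -1, 0) from rfl, hT', h0] at this
      exact this
    simp only [htime, hq0, zero_smul, add_zero] at h1
    rw [h1]
    simp [q, smul_smul, hc.ne']

theorem injective₂ (h : IsRulingPair Ω f₁ f₂ z) {x : E} (hx : x ∈ Ω) :
    Function.Injective (fderiv ℝ f₂ x) := by
  rw [injective_iff_map_eq_zero]
  intro u hu
  have := h.isometric x hx 0 0 (u, 0)
  simp only [extensionDeriv_apply, zero_smul, add_zero, hu, norm_zero, norm_eq_zero] at this
  exact h.injective x hx (by rw [this, map_zero])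

/-- Near `x₀`, the points of the rulings depend smoothly on the base point `x` and on the
coordinates `k` with respect to the frame of the distribution at `x`. -/
theorem exists_smooth_transport (h : IsRulingPair Ω f₁ f₂ z) {x₀ : E} (hx₀ : x₀ ∈ Ω) :
    ∃ (U : Set (E × K)) (Ψ : E × K → E), IsOpen U ∧ (x₀, 0) ∈ U ∧ ContDiffOn ℝ ∞ Ψ U ∧
      ∀ p ∈ U, p.1 ∈ Ω ∧ Ψ p ∈ Ω ∧
        f₁ (Ψ p) = f₁ p.1 + pushFrame f₁ z p.1 p.2 ∧
        f₂ (Ψ p) = f₂ p.1 + pushFrame f₂ z p.1 p.2 ∧ (p.2 = 0 → Ψ p = p.1) := by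
  obtain ⟨S, hS⟩ := LinearMap.exists_leftInverse_of_injective
    (fderiv ℝ f₁ x₀ : E →ₗ[ℝ] H₁) (LinearMap.ker_eq_bot.mpr (h.injective x₀ hx₀))
  let S' : H₁ →L[ℝ] E := S.toContinuousLinearMap
  have hg : ContDiffOn ℝ ∞ (fun x => S' (f₁ x)) Ω := S'.contDiff.comp_contDiffOn h.smooth₁
  have hder : fderiv ℝ (fun x => S' (f₁ x)) x₀ = ContinuousLinearMap.id ℝ E := by
    have h1 : DifferentiableAt ℝ f₁ x₀ :=
      (h.smooth₁.contDiffAt (h.isOpen.mem_nhds hx₀)).differentiableAt (by simp)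
    have h2 : HasFDerivAt (fun x => S' (f₁ x)) (S' ∘L fderiv ℝ f₁ x₀) x₀ :=
      S'.hasFDerivAt.comp x₀ h1.hasFDerivAt
    rw [h2.fderiv]
    exact ContinuousLinearMap.ext fun u => LinearMap.congr_fun hS u
  obtain ⟨e, he0, heΩ, hecoe, hesymm⟩ := exists_openPartialHomeomorph_of_isInvertible h.isOpen hg
    hx₀ (by rw [hder]; exact ⟨ContinuousLinearEquiv.refl ℝ E, rfl⟩)
  obtain ⟨U₁, hU₁, hU₁o, hU₁m⟩ := eventually_nhds_iff.mp
    (h.exists_transport hx₀ (e.open_source.mem_nhds he0))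
  have key : ∀ p ∈ U₁, ∃ y ∈ e.source, S' (f₁ p.1 + pushFrame f₁ z p.1 p.2) = e y ∧
      f₁ y = f₁ p.1 + pushFrame f₁ z p.1 p.2 ∧ f₂ y = f₂ p.1 + pushFrame f₂ z p.1 p.2 := by
    intro p hp
    obtain ⟨y, hy, h1, h2⟩ := hU₁ p hp
    exact ⟨y, hy, by rw [hecoe, ← h1], h1, h2⟩
  have hfst : Set.MapsTo (Prod.fst : E × K → E) (U₁ ∩ Prod.fst ⁻¹' e.source) Ω :=
    fun p hp => heΩ hp.2
  refine ⟨U₁ ∩ Prod.fst ⁻¹' e.source,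
    fun p => e.symm (S' (f₁ p.1 + pushFrame f₁ z p.1 p.2)),
    hU₁o.inter (e.open_source.preimage continuous_fst), ⟨hU₁m, he0⟩, ?_, ?_⟩
  · refine hesymm.comp (S'.contDiff.comp_contDiffOn ?_) ?_
    · exact (h.smooth₁.comp contDiff_fst.contDiffOn hfst).add
        ((h.contDiffOn_pushFrame₁.comp contDiff_fst.contDiffOn hfst).clm_apply
          contDiff_snd.contDiffOn)
    · intro p hp
      obtain ⟨y, hy, h1, -⟩ := key p hp.1
      change S' (f₁ p.1 + pushFrame f₁ z p.1 p.2) ∈ e.target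
      rw [h1]
      exact e.map_source hy
  · intro p hp
    obtain ⟨y, hy, h1, h2, h3⟩ := key p hp.1
    have hΨ : e.symm (S' (f₁ p.1 + pushFrame f₁ z p.1 p.2)) = y := by
      rw [h1, e.left_inv hy]
    simp only [hΨ]
    refine ⟨heΩ hp.2, heΩ hy, h2, h3, fun hp2 => ?_⟩
    rw [← hΨ, hp2, map_zero, add_zero]
    have : S' (f₁ p.1) = e p.1 := by rw [hecoe]
    rw [this, e.left_inv hp.2]

/-- A chart of a foliation by rulings: the leaves are the rulings through the points of an affine
slice transversal to the distribution. -/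
theorem exists_foliated_chart (h : IsRulingPair Ω f₁ f₂ z) {x₀ : E} (hx₀ : x₀ ∈ Ω) :
    ∃ (C : Submodule ℝ E) (r : ℝ) (e : OpenPartialHomeomorph (C × K) E)
      (a₁ : C → H₁) (A₁ : C → K →L[ℝ] H₁) (a₂ : C → H₂) (A₂ : C → K →L[ℝ] H₂),
      0 < r ∧ e.source = Metric.ball 0 r ×ˢ Metric.ball 0 r ∧ e.target ⊆ Ω ∧
      ContDiffOn ℝ ∞ e e.source ∧ ContDiffOn ℝ ∞ e.symm e.target ∧
      ∀ c k, (c, k) ∈ e.source → f₁ (e (c, k)) = a₁ c + A₁ c k ∧ f₂ (e (c, k)) = a₂ c + A₂ c k ∧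
        Function.Injective (A₁ c) ∧ Function.Injective (A₂ c) := by
  obtain ⟨U, Ψ, hU, hU0, hΨ, hUΨ⟩ := h.exists_smooth_transport hx₀
  obtain ⟨C, hC⟩ := Submodule.exists_isCompl (LinearMap.range (z x₀ : K →ₗ[ℝ] E))
  let j : C × K → E × K := fun p => (x₀ + p.1, p.2)
  have hj : ContDiff ℝ ∞ j := (contDiff_const.add (C.subtypeL.contDiff.comp contDiff_fst)).prodMk
    contDiff_snd
  have hU' : IsOpen (j ⁻¹' U) := hU.preimage hj.continuous
  have hΦ : ContDiffOn ℝ ∞ (fun p => Ψ (j p)) (j ⁻¹' U) :=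
    hΨ.comp hj.contDiffOn (Set.mapsTo_preimage _ _)
  have h0 : (0 : C × K) ∈ j ⁻¹' U := by simpa [j] using hU0
  have hΦ0 : Ψ (j 0) = x₀ := by
    rw [(hUΨ (j 0) h0).2.2.2.2 rfl]; simp [j]
  have hΦd : HasFDerivAt (fun p => Ψ (j p)) (fderiv ℝ (fun p => Ψ (j p)) 0) 0 :=
    ((hΦ.contDiffAt (hU'.mem_nhds h0)).differentiableAt (by simp)).hasFDerivAt
  have hf₁d : HasFDerivAt f₁ (fderiv ℝ f₁ x₀) x₀ :=
    ((h.smooth₁.contDiffAt (h.isOpen.mem_nhds hx₀)).differentiableAt (by simp)).hasFDerivAt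
  have hVd : HasFDerivAt (pushFrame f₁ z) (fderiv ℝ (pushFrame f₁ z) x₀) x₀ :=
    ((h.contDiffOn_pushFrame₁.contDiffAt (h.isOpen.mem_nhds hx₀)).differentiableAt
      (by simp)).hasFDerivAt
  -- the differential of the chart at the origin is `(c, k) ↦ c + z x₀ k`
  have hT : ∀ p, fderiv ℝ (fun p => Ψ (j p)) 0 p = (p.1 : E) + z x₀ p.2 := by
    intro p
    apply h.injective x₀ hx₀
    have e1 : HasFDerivAt (fun p => f₁ (Ψ (j p))) _ 0 :=
      HasFDerivAt.comp (g := f₁) 0 (by rw [hΦ0]; exact hf₁d) hΦd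
    have hbase : HasFDerivAt (fun p : C × K => x₀ + (p.1 : E))
        (C.subtypeL ∘L ContinuousLinearMap.fst ℝ C K) 0 :=
      (C.subtypeL ∘L ContinuousLinearMap.fst ℝ C K).hasFDerivAt.const_add x₀
    have hb0 : x₀ + ((0 : C × K).1 : E) = x₀ := by simp
    have e2 : HasFDerivAt (fun p : C × K => f₁ (x₀ + p.1) + pushFrame f₁ z (x₀ + p.1) p.2) _ 0 :=
      (HasFDerivAt.comp (g := f₁) 0 (by rw [hb0]; exact hf₁d) hbase).add
        ((HasFDerivAt.comp (g := pushFrame f₁ z) 0 (by rw [hb0]; exact hVd) hbase).clm_apply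
          (hasFDerivAt_snd (𝕜 := ℝ) (E := C) (F := K)))
    have heq : (fun p => f₁ (Ψ (j p))) =ᶠ[𝓝 0]
        fun p : C × K => f₁ (x₀ + p.1) + pushFrame f₁ z (x₀ + p.1) p.2 := by
      filter_upwards [hU'.mem_nhds h0] with p hp using (hUΨ (j p) hp).2.2.1
    have := congrArg (fun T => T p) ((e2.congr_of_eventuallyEq heq).unique e1)
    simp [pushFrame] at this
    rw [map_add]
    exact this.symm
  have hinv : (fderiv ℝ (fun p => Ψ (j p)) 0).IsInvertible := by
    have hbij : Function.Bijective (fderiv ℝ (fun p => Ψ (j p)) 0) := by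
      constructor
      · rw [injective_iff_map_eq_zero]
        rintro ⟨c, k⟩ hck
        rw [hT] at hck
        simp only at hck
        have hc : (c : E) = 0 := by
          refine (Submodule.disjoint_def.mp hC.disjoint) c ?_ c.2
          exact ⟨-k, by simpa using (eq_neg_of_add_eq_zero_left hck).symm⟩
        have hk : k = 0 := h.injective_frame x₀ hx₀ (by rw [map_zero]; simpa [hc] using hck)
        rw [hk, show c = 0 from Subtype.ext hc]; rfl
      · intro u
        obtain ⟨_, ⟨k, rfl⟩, c, hc, rfl⟩ :=
          Submodule.mem_sup.mp (hC.sup_eq_top ▸ Submodule.mem_top (x := u))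
        exact ⟨(⟨c, hc⟩, k), by rw [hT]; exact add_comm _ _⟩
    exact ⟨(LinearEquiv.ofBijective (fderiv ℝ (fun p => Ψ (j p)) 0 : C × K →ₗ[ℝ] E)
      hbij).toContinuousLinearEquiv, by ext; rfl; rfl⟩
  obtain ⟨e, he0, heU, hecoe, hesymm⟩ := exists_openPartialHomeomorph_of_isInvertible hU' hΦ
    h0 hinv
  obtain ⟨r, hr, hrs⟩ := Metric.isOpen_iff.mp e.open_source 0 he0
  have hball : Metric.ball (0 : C) r ×ˢ Metric.ball (0 : K) r = Metric.ball (0 : C × K) r :=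
    ball_prod_same 0 0 r
  have hsource : (e.restrOpen (Metric.ball 0 r) Metric.isOpen_ball).source =
      Metric.ball (0 : C) r ×ˢ Metric.ball (0 : K) r := by
    rw [e.restrOpen_source, hball, Set.inter_eq_right]; exact hrs
  refine ⟨C, r, e.restrOpen (Metric.ball 0 r) Metric.isOpen_ball, fun c => f₁ (x₀ + c),
    fun c => pushFrame f₁ z (x₀ + c), fun c => f₂ (x₀ + c), fun c => pushFrame f₂ z (x₀ + c),
    hr, hsource, ?_, ?_, ?_, ?_⟩
  · intro y hy
    have h1 := (e.restrOpen (Metric.ball 0 r) Metric.isOpen_ball).map_target hy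
    rw [← (e.restrOpen (Metric.ball 0 r) Metric.isOpen_ball).right_inv hy]
    change e _ ∈ Ω
    rw [hecoe]
    exact (hUΨ _ (heU h1.1)).2.1
  · change ContDiffOn ℝ ∞ e _
    rw [hecoe]
    exact hΦ.mono fun p hp => heU hp.1
  · exact hesymm.mono fun y hy => hy.1
  · intro c k hck
    have h1 := hUΨ _ (heU hck.1)
    change f₁ (e (c, k)) = _ ∧ f₂ (e (c, k)) = _ ∧ _
    rw [hecoe]
    exact ⟨h1.2.2.1, h1.2.2.2.1, (h.injective _ h1.1).comp (h.injective_frame _ h1.1),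
      (h.injective₂ h1.1).comp (h.injective_frame _ h1.1)⟩

end IsRulingPair

end Rulings

/-! ### Kernels of `φ_τ` at regular elements -/

section RegularElements

variable {E F H₁ H₂ : Type*} [NormedAddCommGroup E] [NormedSpace ℝ E] [FiniteDimensional ℝ E]
  [NormedAddCommGroup F] [NormedSpace ℝ F] [FiniteDimensional ℝ F]
  [NormedAddCommGroup H₁] [InnerProductSpace ℝ H₁] [FiniteDimensional ℝ H₁]
  [NormedAddCommGroup H₂] [InnerProductSpace ℝ H₂] [FiniteDimensional ℝ H₂]

/-- If `f₁` and `f₂` nowhere extend, then `ker φ_τ^Y` is tangent to `M` for every field `Y` of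
regular elements, and it is a distribution along which `f₁` and `f₂` are ruled. -/
theorem IsCompatiblePair.exists_isRulingPair {Ω : Set E} {f₁ : E → H₁} {f₂ : E → H₂}
    {B₁ : E → E × F →L[ℝ] H₁} {B₂ : E → E × F →L[ℝ] H₂}
    (h : IsCompatiblePair Ω f₁ f₂ B₁ B₂)
    (hgen : ∀ U ⊆ Ω, IsOpen U → U.Nonempty → ¬ LocallySingularlyExtend U f₁ f₂)
    {Ω' : Set E} (hΩ' : IsOpen Ω') (hsub : Ω' ⊆ Ω) {Y : E → E} (hY : ContDiffOn ℝ ∞ Y Ω')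
    (hreg : ∀ x ∈ Ω', ∀ u,
      Module.finrank ℝ (LinearMap.range (pairForm B₁ B₂ x u : E × F →ₗ[ℝ] H₁ × H₂)) ≤
        Module.finrank ℝ (LinearMap.range (pairForm B₁ B₂ x (Y x) : E × F →ₗ[ℝ] H₁ × H₂)))
    {d : ℕ} (hd : ∀ x ∈ Ω', Module.finrank ℝ
      (LinearMap.ker (pairForm B₁ B₂ x (Y x) : E × F →ₗ[ℝ] H₁ × H₂)) = d)
    {x₀ : E} (hx₀ : x₀ ∈ Ω') :
    ∃ (U : Set E) (z : E → EuclideanSpace ℝ (Fin d) →L[ℝ] E), x₀ ∈ U ∧ U ⊆ Ω' ∧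
      IsRulingPair U f₁ f₂ z ∧ ∀ x ∈ U, ∀ a : E × F,
        pairForm B₁ B₂ x (Y x) a = 0 ↔ ∃ k, a = (z x k, 0) := by
  obtain ⟨U, hU, hxU, hUΩ, s, hs, hsk⟩ := exists_smooth_kernel_frame hΩ'
    (h.contDiffOn_pairForm hsub hY) hx₀ hd
  have hUΩ' : U ⊆ Ω := hUΩ.trans hsub
  have hker : ∀ x ∈ U, ∀ k, pairForm B₁ B₂ x (Y x) (s x k) = 0 := by
    intro x hx k
    have : s x k ∈ LinearMap.ker (pairForm B₁ B₂ x (Y x) : E × F →ₗ[ℝ] H₁ × H₂) := by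
      rw [← (hsk x hx).2]; exact ⟨k, rfl⟩
    exact this
  have hsm : ∀ k, ContDiffOn ℝ ∞ (fun x => s x k) U := fun k => hs.clm_apply contDiffOn_const
  have hiso : ∀ x ∈ U, ∀ k t a, ‖extensionDeriv f₁ (fun y => B₁ y (s y k)) x t a‖ =
      ‖extensionDeriv f₂ (fun y => B₂ y (s y k)) x t a‖ := fun x hx k t a =>
    h.norm_extensionDeriv_eq (hUΩ' hx)
      (((hsm k).contDiffAt (hU.mem_nhds hx)).differentiableAt (by simp))
      (h.norm_frameSff_eq (hUΩ' hx) (hreg x (hUΩ hx)) (hker x hx k)) t a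
  have hsing : ∀ x ∈ U, ∀ k t,
      ¬ Function.Injective (extensionDeriv f₁ (fun y => B₁ y (s y k)) x t) := fun x hx k t =>
    not_injective_extensionDeriv hU (h.smooth₁.mono hUΩ')
      ((h.frame₁.mono hUΩ').clm_apply (hsm k)) (h.smooth₂.mono hUΩ')
      ((h.frame₂.mono hUΩ').clm_apply (hsm k)) (fun x hx => hiso x hx k)
      (fun W hW => hgen W (hW.trans hUΩ')) hx t
  -- the extensions are not immersions even for `t = 0`, hence the fields are tangent to `M`
  have htan : ∀ x ∈ U, ∀ k, (s x k).2 = 0 := by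
    intro x hx k
    obtain ⟨a, ha, hne⟩ : ∃ a, extensionDeriv f₁ (fun y => B₁ y (s y k)) x 0 a = 0 ∧ a ≠ 0 := by
      by_contra hcon
      push Not at hcon
      exact hsing x hx k 0 ((injective_iff_map_eq_zero _).mpr hcon)
    rw [extensionDeriv_apply, zero_smul, add_zero, ← h.tangent₁ x (hUΩ' hx), ← map_smul,
      ← map_add] at ha
    have h0 : ((a.1, 0) : E × F) + a.2 • s x k = 0 :=
      h.injective₁ x (hUΩ' hx) (by rw [ha, map_zero])
    have h1 : a.1 + a.2 • (s x k).1 = 0 := congrArg Prod.fst h0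
    have h2 : a.2 • (s x k).2 = 0 := by simpa using congrArg Prod.snd h0
    rcases smul_eq_zero.mp h2 with h3 | h3
    · rw [h3, zero_smul, add_zero] at h1
      exact absurd (Prod.ext h1 h3) hne
    · exact h3
  let z : E → EuclideanSpace ℝ (Fin d) →L[ℝ] E := fun x => ContinuousLinearMap.fst ℝ E F ∘L s x
  have hzs : ∀ x ∈ U, ∀ k, s x k = (z x k, 0) := fun x hx k => Prod.ext rfl (htan x hx k)
  have hpush₁ : ∀ x ∈ U, ∀ k, (fun y => pushFrame f₁ z y k) =ᶠ[𝓝 x] fun y => B₁ y (s y k) := by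
    intro x hx k
    filter_upwards [hU.mem_nhds hx] with y hy
    rw [hzs y hy, h.tangent₁ y (hUΩ' hy)]; rfl
  have hpush₂ : ∀ x ∈ U, ∀ k, (fun y => pushFrame f₂ z y k) =ᶠ[𝓝 x] fun y => B₂ y (s y k) := by
    intro x hx k
    filter_upwards [hU.mem_nhds hx] with y hy
    rw [hzs y hy, h.tangent₂ y (hUΩ' hy)]; rfl
  have hext₁ : ∀ x ∈ U, ∀ k t, extensionDeriv f₁ (fun y => pushFrame f₁ z y k) x t =
      extensionDeriv f₁ (fun y => B₁ y (s y k)) x t := by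
    intro x hx k t
    rw [extensionDeriv, extensionDeriv, (hpush₁ x hx k).fderiv_eq, (hpush₁ x hx k).eq_of_nhds]
  have hext₂ : ∀ x ∈ U, ∀ k t, extensionDeriv f₂ (fun y => pushFrame f₂ z y k) x t =
      extensionDeriv f₂ (fun y => B₂ y (s y k)) x t := by
    intro x hx k t
    rw [extensionDeriv, extensionDeriv, (hpush₂ x hx k).fderiv_eq, (hpush₂ x hx k).eq_of_nhds]
  refine ⟨U, z, hxU, hUΩ, ⟨hU, h.smooth₁.mono hUΩ', h.smooth₂.mono hUΩ',
    contDiffOn_const.clm_comp hs, ?_, ?_, ?_, ?_⟩, ?_⟩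
  · intro x hx u v huv
    rw [← h.tangent₁ x (hUΩ' hx), ← h.tangent₁ x (hUΩ' hx)] at huv
    exact congrArg Prod.fst (h.injective₁ x (hUΩ' hx) huv)
  · intro x hx k k' hkk
    apply (hsk x hx).1
    rw [hzs x hx, hzs x hx, hkk]
  · intro x hx k t a
    rw [hext₁ x hx, hext₂ x hx, hiso x hx]
  · intro x hx k t
    rw [hext₁ x hx]
    exact hsing x hx k t
  · intro x hx a
    constructor
    · intro ha
      have : a ∈ LinearMap.ker (pairForm B₁ B₂ x (Y x) : E × F →ₗ[ℝ] H₁ × H₂) := ha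
      rw [← (hsk x hx).2] at this
      obtain ⟨k, rfl⟩ := this
      exact ⟨k, hzs x hx k⟩
    · rintro ⟨k, rfl⟩
      rw [← hzs x hx]
      exact hker x hx k

end RegularElements

/-! ### The frame of `TM ⊕ L` -/

section BundleFrame

variable {E H H₁ H₂ : Type*} [NormedAddCommGroup E] [NormedSpace ℝ E] [FiniteDimensional ℝ E]
  [NormedAddCommGroup H] [InnerProductSpace ℝ H]
  [NormedAddCommGroup H₁] [InnerProductSpace ℝ H₁] [FiniteDimensional ℝ H₁]
  [NormedAddCommGroup H₂] [InnerProductSpace ℝ H₂] [FiniteDimensional ℝ H₂] {ℓ : ℕ}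

/-- The frame `(u, c) ↦ df(u) + ∑ cᵢ eᵢ` of `TM ⊕ L`, where `e` is a frame of `L`. -/
noncomputable def bundleFrame (f : E → H) (e : Fin ℓ → E → H) (x : E) :
    E × (Fin ℓ → ℝ) →L[ℝ] H :=
  fderiv ℝ f x ∘L ContinuousLinearMap.fst ℝ E (Fin ℓ → ℝ) +
    ∑ i, ContinuousLinearMap.toSpanSingletonCLE (𝕜 := ℝ) (e i x) ∘L
      (ContinuousLinearMap.proj i ∘L ContinuousLinearMap.snd ℝ E (Fin ℓ → ℝ))

theorem bundleFrame_apply (f : E → H) (e : Fin ℓ → E → H) (x : E) (a : E × (Fin ℓ → ℝ)) :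
    bundleFrame f e x a = fderiv ℝ f x a.1 + ∑ i, a.2 i • e i x := by
  simp [bundleFrame]

theorem contDiffOn_bundleFrame {Ω : Set E} (hΩ : IsOpen Ω) {f : E → H} {e : Fin ℓ → E → H}
    (hf : ContDiffOn ℝ ∞ f Ω) (he : ∀ i, ContDiffOn ℝ ∞ (e i) Ω) :
    ContDiffOn ℝ ∞ (bundleFrame f e) Ω := by
  refine ((hf.fderiv_of_isOpen hΩ (by simp)).clm_comp contDiffOn_const).add
    (ContDiffOn.sum fun i _ => ContDiffOn.clm_comp ?_ contDiffOn_const)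
  exact (ContinuousLinearMap.toSpanSingletonCLE (𝕜 := ℝ) (E := H)).contDiff.comp_contDiffOn (he i)

theorem fderiv_bundleFrame_apply {Ω : Set E} (hΩ : IsOpen Ω) {f : E → H} {e : Fin ℓ → E → H}
    (hf : ContDiffOn ℝ ∞ f Ω) (he : ∀ i, ContDiffOn ℝ ∞ (e i) Ω) {x : E} (hx : x ∈ Ω) (u : E)
    (a : E × (Fin ℓ → ℝ)) :
    fderiv ℝ (bundleFrame f e) x u a =
      fderiv ℝ (fderiv ℝ f) x u a.1 + ∑ i, a.2 i • fderiv ℝ (e i) x u := by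
  have hd : DifferentiableAt ℝ (bundleFrame f e) x :=
    ((contDiffOn_bundleFrame hΩ hf he).contDiffAt (hΩ.mem_nhds hx)).differentiableAt (by simp)
  have hfd : DifferentiableAt ℝ (fderiv ℝ f) x :=
    ((hf.fderiv_of_isOpen hΩ (m := ∞) (by simp)).contDiffAt (hΩ.mem_nhds hx)).differentiableAt
      (by simp)
  have h1 : HasFDerivAt (fun y => bundleFrame f e y a) _ x :=
    hd.hasFDerivAt.clm_apply (hasFDerivAt_const a x)
  have h2 : HasFDerivAt (fun y => fderiv ℝ f y a.1 + ∑ i, a.2 i • e i y) _ x :=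
    (hfd.hasFDerivAt.clm_apply (hasFDerivAt_const a.1 x)).add
      (HasFDerivAt.fun_sum fun i _ => (((he i).contDiffAt (hΩ.mem_nhds hx)).differentiableAt
        (by simp)).hasFDerivAt.const_smul (a.2 i))
  have heq : (fun y => bundleFrame f e y a) = fun y => fderiv ℝ f y a.1 + ∑ i, a.2 i • e i y :=
    funext fun y => bundleFrame_apply f e y a
  rw [heq] at h1
  have := congrArg (fun T => T u) (h1.unique h2)
  simpa [sum_apply] using this

/-- The Levi-Civita connections of isometric immersions coincide. -/
theorem inner_fderiv_fderiv_eq {Ω : Set E} (hΩ : IsOpen Ω) {f₁ : E → H₁} {f₂ : E → H₂}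
    (hf₁ : ContDiffOn ℝ ∞ f₁ Ω) (hf₂ : ContDiffOn ℝ ∞ f₂ Ω)
    (hiso : ∀ x ∈ Ω, ∀ u v, inner ℝ (fderiv ℝ f₁ x u) (fderiv ℝ f₁ x v) =
      inner ℝ (fderiv ℝ f₂ x u) (fderiv ℝ f₂ x v)) {x : E} (hx : x ∈ Ω) (u v w : E) :
    inner ℝ (fderiv ℝ (fderiv ℝ f₁) x u v) (fderiv ℝ f₁ x w) =
      inner ℝ (fderiv ℝ (fderiv ℝ f₂) x u v) (fderiv ℝ f₂ x w) := by
  have hΩn := hΩ.mem_nhds hx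
  have d1 : DifferentiableAt ℝ (fderiv ℝ f₁) x :=
    ((hf₁.fderiv_of_isOpen hΩ (m := ∞) (by simp)).contDiffAt hΩn).differentiableAt (by simp)
  have d2 : DifferentiableAt ℝ (fderiv ℝ f₂) x :=
    ((hf₂.fderiv_of_isOpen hΩ (m := ∞) (by simp)).contDiffAt hΩn).differentiableAt (by simp)
  have s1 := (hf₁.contDiffAt hΩn).isSymmSndFDerivAt
    (by simpa only [minSmoothness_of_isRCLikeNormedField] using ENat.LEInfty.out)
  have s2 := (hf₂.contDiffAt hΩn).isSymmSndFDerivAt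
    (by simpa only [minSmoothness_of_isRCLikeNormedField] using ENat.LEInfty.out)
  have key : ∀ u v w : E,
      inner ℝ (fderiv ℝ (fderiv ℝ f₁) x u v) (fderiv ℝ f₁ x w) +
        inner ℝ (fderiv ℝ f₁ x v) (fderiv ℝ (fderiv ℝ f₁) x u w) =
      inner ℝ (fderiv ℝ (fderiv ℝ f₂) x u v) (fderiv ℝ f₂ x w) +
        inner ℝ (fderiv ℝ f₂ x v) (fderiv ℝ (fderiv ℝ f₂) x u w) := by
    intro u v w
    have i1 := (d1.hasFDerivAt.clm_apply (hasFDerivAt_const v x)).inner ℝ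
      (d1.hasFDerivAt.clm_apply (hasFDerivAt_const w x))
    have i2 := (d2.hasFDerivAt.clm_apply (hasFDerivAt_const v x)).inner ℝ
      (d2.hasFDerivAt.clm_apply (hasFDerivAt_const w x))
    have heq : (fun y => inner ℝ (fderiv ℝ f₁ y v) (fderiv ℝ f₁ y w)) =ᶠ[𝓝 x]
        fun y => inner ℝ (fderiv ℝ f₂ y v) (fderiv ℝ f₂ y w) := by
      filter_upwards [hΩn] with y hy using hiso y hy v w
    have := congrArg (fun T => T u) ((i1.congr_of_eventuallyEq heq.symm).unique i2)
    simp at this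
    linarith
  have k1 := key u v w
  have k2 := key v u w
  have k3 := key w u v
  rw [real_inner_comm _ (fderiv ℝ f₁ x v), real_inner_comm _ (fderiv ℝ f₂ x v)] at k1
  rw [real_inner_comm _ (fderiv ℝ f₁ x u), real_inner_comm _ (fderiv ℝ f₂ x u), s1 v u, s2 v u,
    s1 v w, s2 v w] at k2
  rw [real_inner_comm _ (fderiv ℝ f₁ x u), real_inner_comm _ (fderiv ℝ f₂ x u), s1 w u, s2 w u]
    at k3
  linarith

/-- If `L` and `L'` have corresponding frames with the same inner products, components of the second
fundamental forms and connection forms, then the bundles `TM ⊕ L` and `TM ⊕ L'` have the same induced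
metric and connection. -/
theorem isCompatiblePair_bundleFrame {Ω : Set E} (hΩ : IsOpen Ω) {f₁ : E → H₁} {f₂ : E → H₂}
    {e₁ : Fin ℓ → E → H₁} {e₂ : Fin ℓ → E → H₂}
    (hf₁ : ContDiffOn ℝ ∞ f₁ Ω) (hf₂ : ContDiffOn ℝ ∞ f₂ Ω)
    (he₁ : ∀ i, ContDiffOn ℝ ∞ (e₁ i) Ω) (he₂ : ∀ i, ContDiffOn ℝ ∞ (e₂ i) Ω)
    (hinj : ∀ x ∈ Ω, Function.Injective (fderiv ℝ f₁ x))
    (hli : ∀ x ∈ Ω, LinearIndependent ℝ fun i => e₁ i x)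
    (hiso : ∀ x ∈ Ω, ∀ u v, inner ℝ (fderiv ℝ f₁ x u) (fderiv ℝ f₁ x v) =
      inner ℝ (fderiv ℝ f₂ x u) (fderiv ℝ f₂ x v))
    (horth₁ : ∀ x ∈ Ω, ∀ u i, inner ℝ (fderiv ℝ f₁ x u) (e₁ i x) = 0)
    (horth₂ : ∀ x ∈ Ω, ∀ u i, inner ℝ (fderiv ℝ f₂ x u) (e₂ i x) = 0)
    (hmetric : ∀ x ∈ Ω, ∀ i j, inner ℝ (e₁ i x) (e₁ j x) = inner ℝ (e₂ i x) (e₂ j x))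
    (hsff : ∀ x ∈ Ω, ∀ u v i, inner ℝ (fderiv ℝ (fderiv ℝ f₁) x u v) (e₁ i x) =
      inner ℝ (fderiv ℝ (fderiv ℝ f₂) x u v) (e₂ i x))
    (hpar : ∀ x ∈ Ω, ∀ u i j, inner ℝ (fderiv ℝ (e₁ i) x u) (e₁ j x) =
      inner ℝ (fderiv ℝ (e₂ i) x u) (e₂ j x)) :
    IsCompatiblePair Ω f₁ f₂ (bundleFrame f₁ e₁) (bundleFrame f₂ e₂) where
  isOpen := hΩ
  smooth₁ := hf₁
  smooth₂ := hf₂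
  frame₁ := contDiffOn_bundleFrame hΩ hf₁ he₁
  frame₂ := contDiffOn_bundleFrame hΩ hf₂ he₂
  injective₁ := by
    intro x hx
    rw [injective_iff_map_eq_zero]
    rintro ⟨u, c⟩ ha
    rw [bundleFrame_apply] at ha
    have h0 : inner ℝ (fderiv ℝ f₁ x u) (∑ i, c i • e₁ i x) = 0 := by
      simp [inner_sum, inner_smul_right, horth₁ x hx]
    have h1 : fderiv ℝ f₁ x u = 0 := by
      have : inner ℝ (fderiv ℝ f₁ x u) (fderiv ℝ f₁ x u + ∑ i, c i • e₁ i x) = 0 := by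
        rw [ha, inner_zero_right]
      rw [inner_add_right, h0, add_zero] at this
      exact inner_self_eq_zero.mp this
    have hu : u = 0 := hinj x hx (by rw [h1, map_zero])
    rw [h1, zero_add] at ha
    have hc : c = 0 := funext fun i => Fintype.linearIndependent_iff.mp (hli x hx) c ha i
    rw [hu, hc]; rfl
  tangent₁ := by intro x _ u; simp [bundleFrame_apply]
  tangent₂ := by intro x _ u; simp [bundleFrame_apply]
  metric := by
    intro x hx a b
    simp only [bundleFrame_apply, inner_add_left, inner_add_right, inner_sum, sum_inner,
      inner_smul_left, inner_smul_right, horth₁ x hx, horth₂ x hx, hiso x hx, hmetric x hx,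
      real_inner_comm (fderiv ℝ f₁ x _) (e₁ _ x), real_inner_comm (fderiv ℝ f₂ x _) (e₂ _ x)]
  connection := by
    intro x hx u a b
    have hΩn := hΩ.mem_nhds hx
    have hmix : ∀ i w, inner ℝ (fderiv ℝ (e₁ i) x u) (fderiv ℝ f₁ x w) =
        inner ℝ (fderiv ℝ (e₂ i) x u) (fderiv ℝ f₂ x w) := by
      intro i w
      have d1 : DifferentiableAt ℝ (fderiv ℝ f₁) x :=
        ((hf₁.fderiv_of_isOpen hΩ (m := ∞) (by simp)).contDiffAt hΩn).differentiableAt (by simp)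
      have d2 : DifferentiableAt ℝ (fderiv ℝ f₂) x :=
        ((hf₂.fderiv_of_isOpen hΩ (m := ∞) (by simp)).contDiffAt hΩn).differentiableAt (by simp)
      have i1 := (d1.hasFDerivAt.clm_apply (hasFDerivAt_const w x)).inner ℝ
        (((he₁ i).contDiffAt hΩn).differentiableAt (by simp)).hasFDerivAt
      have i2 := (d2.hasFDerivAt.clm_apply (hasFDerivAt_const w x)).inner ℝ
        (((he₂ i).contDiffAt hΩn).differentiableAt (by simp)).hasFDerivAt
      have heq1 : (fun y => inner ℝ (fderiv ℝ f₁ y w) (e₁ i y)) =ᶠ[𝓝 x] fun _ => (0 : ℝ) := by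
        filter_upwards [hΩn] with y hy using horth₁ y hy w i
      have heq2 : (fun y => inner ℝ (fderiv ℝ f₂ y w) (e₂ i y)) =ᶠ[𝓝 x] fun _ => (0 : ℝ) := by
        filter_upwards [hΩn] with y hy using horth₂ y hy w i
      have j1 := congrArg (fun T => T u)
        ((i1.congr_of_eventuallyEq heq1.symm).unique (hasFDerivAt_const 0 x))
      have j2 := congrArg (fun T => T u)
        ((i2.congr_of_eventuallyEq heq2.symm).unique (hasFDerivAt_const 0 x))
      simp at j1 j2
      have := hsff x hx u w i
      rw [real_inner_comm (fderiv ℝ f₁ x w), real_inner_comm (fderiv ℝ f₂ x w)]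
      linarith
    rw [fderiv_bundleFrame_apply hΩ hf₁ he₁ hx, fderiv_bundleFrame_apply hΩ hf₂ he₂ hx]
    simp only [bundleFrame_apply, inner_add_left, inner_add_right, inner_sum, sum_inner,
      inner_smul_left, inner_smul_right, hsff x hx, hpar x hx, hmix,
      inner_fderiv_fderiv_eq hΩ hf₁ hf₂ hiso hx]

end BundleFrame

/-! ### Passage to charts -/

section Charts

variable {n m : ℕ} {M : Type u} [TopologicalSpace M] [ChartedSpace (Euc n) M]

/-- `φ` is a smooth chart of `M`. -/
structure IsSmoothChart (φ : OpenPartialHomeomorph M (Euc n)) : Prop where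
  smooth : ContMDiffOn (𝓡 n) (𝓡 n) ∞ φ φ.source
  smooth_symm : ContMDiffOn (𝓡 n) (𝓡 n) ∞ φ.symm φ.target

theorem isSmoothChart_chartAt [IsManifold (𝓡 n) ∞ M] (x : M) :
    IsSmoothChart (chartAt (Euc n) x) :=
  ⟨contMDiffOn_chart, contMDiffOn_chart_symm⟩

/-- The differential of a chart. -/
noncomputable def chartDeriv (φ : OpenPartialHomeomorph M (Euc n)) (x : M) :
    TangentSpace (𝓡 n) x →L[ℝ] Euc n :=
  mfderiv (𝓡 n) (𝓡 n) φ x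

namespace IsSmoothChart

variable {φ : OpenPartialHomeomorph M (Euc n)} (hφ : IsSmoothChart φ)

include hφ

theorem restrOpen {U : Set M} (hU : IsOpen U) : IsSmoothChart (φ.restrOpen U hU) :=
  ⟨hφ.smooth.mono fun _ hx => hx.1, hφ.smooth_symm.mono fun _ hx => hx.1⟩

theorem mdifferentiable : φ.MDifferentiable (𝓡 n) (𝓡 n) :=
  ⟨hφ.smooth.mdifferentiableOn (by simp), hφ.smooth_symm.mdifferentiableOn (by simp)⟩

theorem mdifferentiableAt {x : M} (hx : x ∈ φ.source) :
    MDifferentiableAt (𝓡 n) (𝓡 n) φ x :=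
  hφ.mdifferentiable.mdifferentiableAt hx

theorem bijective_chartDeriv {x : M} (hx : x ∈ φ.source) :
    Function.Bijective (chartDeriv φ x) :=
  (hφ.mdifferentiable.mfderiv hx).bijective

theorem mfderiv_comp {V : Type*} [NormedAddCommGroup V] [NormedSpace ℝ V] {x : M}
    (hx : x ∈ φ.source) {g : Euc n → V} (hg : DifferentiableAt ℝ g (φ x)) :
    mfderiv (𝓡 n) 𝓘(ℝ, V) (fun y => g (φ y)) x = (fderiv ℝ g (φ x)) ∘L (chartDeriv φ x) := by
  have := _root_.mfderiv_comp (I := 𝓡 n) (I' := 𝓡 n) (I'' := 𝓘(ℝ, V)) x hg.mdifferentiableAt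
    (hφ.mdifferentiableAt hx)
  rw [mfderiv_eq_fderiv] at this
  exact this

theorem mdifferentiableAt_comp {V : Type*} [NormedAddCommGroup V] [NormedSpace ℝ V] {x : M}
    (hx : x ∈ φ.source) {g : Euc n → V} (hg : DifferentiableAt ℝ g (φ x)) :
    MDifferentiableAt (𝓡 n) 𝓘(ℝ, V) (fun y => g (φ y)) x :=
  MDifferentiableAt.comp (I' := 𝓡 n) x hg.mdifferentiableAt (hφ.mdifferentiableAt hx)

/-- The differential of a map on `M`, in terms of a representation in a chart. -/
theorem diff_eq_of_eventuallyEq {x : M} (hx : x ∈ φ.source) {ξ : M → Euc m} {g : Euc n → Euc m}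
    (hg : DifferentiableAt ℝ g (φ x)) (h : ξ =ᶠ[𝓝 x] fun y => g (φ y))
    (u : TangentSpace (𝓡 n) x) : diff ξ x u = fderiv ℝ g (φ x) (chartDeriv φ x u) := by
  have h1 : diff ξ x = (fderiv ℝ g (φ x)) ∘L (chartDeriv φ x) := by
    rw [diff, h.mfderiv_eq]
    exact hφ.mfderiv_comp hx hg
  rw [h1]; rfl

theorem contDiffOn_comp_symm {V : Type*} [NormedAddCommGroup V] [NormedSpace ℝ V] {f : M → V}
    {U : Set M} (hf : ContMDiffOn (𝓡 n) 𝓘(ℝ, V) ∞ f U) (hU : φ.source ⊆ U) :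
    ContDiffOn ℝ ∞ (fun y => f (φ.symm y)) φ.target := by
  rw [← contMDiffOn_iff_contDiffOn]
  exact hf.comp hφ.smooth_symm fun y hy => hU (φ.map_target hy)

omit hφ in
theorem _root_.OpenPartialHomeomorph.eventuallyEq_comp_symm {V : Type*} {x : M} (hx : x ∈ φ.source)
    (ξ : M → V) : ξ =ᶠ[𝓝 x] fun y => ξ (φ.symm (φ y)) := by
  filter_upwards [φ.open_source.mem_nhds hx] with y hy
  rw [φ.left_inv hy]

theorem diff_eq {x : M} (hx : x ∈ φ.source) {f : M → Euc m}
    (hf : ContMDiffOn (𝓡 n) (𝓡 m) ∞ f φ.source) (u : TangentSpace (𝓡 n) x) :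
    diff f x u = fderiv ℝ (fun y => f (φ.symm y)) (φ x) (chartDeriv φ x u) :=
  hφ.diff_eq_of_eventuallyEq hx
    (((hφ.contDiffOn_comp_symm hf subset_rfl).contDiffAt
      (φ.open_target.mem_nhds (φ.map_source hx))).differentiableAt (by simp))
    (φ.eventuallyEq_comp_symm hx f) u

/-- In a chart, the second fundamental form of a subbundle is the one of its frame. -/
theorem secondForm_eq_frameSff {G : Type*} [NormedAddCommGroup G] [NormedSpace ℝ G]
    [FiniteDimensional ℝ G] {S : M → Submodule ℝ (Euc m)} {B : Euc n → G →L[ℝ] Euc m}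
    (hB : ContDiffOn ℝ ∞ B φ.target) (hinj : ∀ y ∈ φ.target, Function.Injective (B y))
    (hS : ∀ x ∈ φ.source, S x = LinearMap.range (B (φ x) : G →ₗ[ℝ] Euc m))
    {x : M} (hx : x ∈ φ.source) (u : TangentSpace (𝓡 n) x) (a : G) :
    secondForm S x u (B (φ x) a) = frameSff B (φ x) (chartDeriv φ x u) a := by
  have hn := φ.open_target.mem_nhds (φ.map_source hx)
  have hBd : DifferentiableAt ℝ B (φ x) := (hB.contDiffAt hn).differentiableAt (by simp)
  have hξ : DifferentiableAt ℝ (fun y => B y a) (φ x) := hBd.clm_apply (differentiableAt_const a)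
  have hP : DifferentiableAt ℝ (fun y => (LinearMap.range (B y : G →ₗ[ℝ] Euc m)).starProjection)
      (φ x) := ((contDiffOn_starProjection_range hB hinj).contDiffAt hn).differentiableAt (by simp)
  have hPS : (fun y => (S y).starProjection) =ᶠ[𝓝 x]
      fun y => (LinearMap.range (B (φ y) : G →ₗ[ℝ] Euc m)).starProjection := by
    filter_upwards [φ.open_source.mem_nhds hx] with y hy
    rw [hS y hy]
  have h1 := secondForm_eq_of_section S x u (fun y => B (φ y) a)
    ((hφ.mdifferentiableAt_comp hx hP).congr_of_eventuallyEq hPS)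
    (hφ.mdifferentiableAt_comp hx hξ) (by
      filter_upwards [φ.open_source.mem_nhds hx] with y hy
      rw [hS y hy]; exact ⟨a, rfl⟩)
  rw [h1, ambientDeriv, hφ.diff_eq_of_eventuallyEq hx hξ Filter.EventuallyEq.rfl, frameSff_apply,
    hS x hx, (hBd.hasFDerivAt.clm_apply (hasFDerivAt_const a (φ x))).fderiv]
  simp

theorem tangentImage_eq {x : M} (hx : x ∈ φ.source) {f : M → Euc m}
    (hf : ContMDiffOn (𝓡 n) (𝓡 m) ∞ f φ.source) :
    tangentImage (n := n) f x =
      LinearMap.range (fderiv ℝ (fun y => f (φ.symm y)) (φ x) : Euc n →ₗ[ℝ] Euc m) := by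
  ext w
  constructor
  · rintro ⟨u, rfl⟩
    exact ⟨chartDeriv φ x u, (hφ.diff_eq hx hf u).symm⟩
  · rintro ⟨v, rfl⟩
    obtain ⟨u, rfl⟩ := (hφ.bijective_chartDeriv hx).2 v
    exact ⟨u, hφ.diff_eq hx hf u⟩

/-- In a chart, the second fundamental form is the normal component of the second derivative. -/
theorem sff_eq {f : M → Euc m} (hf : ContMDiffOn (𝓡 n) (𝓡 m) ∞ f φ.source)
    (hinj : ∀ y ∈ φ.target, Function.Injective (fderiv ℝ (fun y => f (φ.symm y)) y))
    {x : M} (hx : x ∈ φ.source) (u w : TangentSpace (𝓡 n) x) :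
    sff f x u w = (tangentImage (n := n) f x)ᗮ.starProjection
      (fderiv ℝ (fderiv ℝ (fun y => f (φ.symm y))) (φ x) (chartDeriv φ x u)
        (chartDeriv φ x w)) := by
  have h := hφ.secondForm_eq_frameSff (S := tangentImage (n := n) f)
    ((hφ.contDiffOn_comp_symm hf subset_rfl).fderiv_of_isOpen φ.open_target (by simp)) hinj
    (fun y hy => hφ.tangentImage_eq hy hf) hx u (chartDeriv φ x w)
  rw [sff, hφ.diff_eq hx hf w, h, frameSff_apply, hφ.tangentImage_eq hx hf]

end IsSmoothChart

end Charts

section LocalData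

variable {n p q ℓ : ℕ} {M : Type u} [TopologicalSpace M] [ChartedSpace (Euc n) M]
  [IsManifold (𝓡 n) ∞ M]

theorem inner_orthogonal_starProjection_of_mem {m : ℕ} (T : Submodule ℝ (Euc m)) (v w : Euc m)
    (hw : w ∈ Tᗮ) : inner ℝ (Tᗮ.starProjection v) w = inner ℝ v w := by
  rw [Submodule.inner_starProjection_left_eq_right,
    Submodule.starProjection_eq_self_iff.mpr hw]

theorem IsIsometricImmersion.injective_diff
    {g : Bundle.ContMDiffRiemannianMetric (𝓡 n) ∞ (Euc n)
      (fun x : M => TangentSpace (𝓡 n) x)} {f : M → Euc p} (hf : IsIsometricImmersion g f) (x : M) :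
    Function.Injective (diff (n := n) f x) := by
  rw [injective_iff_map_eq_zero]
  intro u hu
  by_contra hne
  have := g.pos x u hne
  rw [hf.2, hu, inner_zero_left] at this
  exact this.false

/-- A chart `φ` of `M` in which the bundles `TM ⊕ L` and `TM ⊕ L'` have the compatible frames `B₁`
and `B₂`; `J x` is the coordinate isomorphism of the fibre `T_xM ⊕ L x` in the frame. -/
structure IsAdaptedChart {L : M → Submodule ℝ (Euc (n + p))} {L' : M → Submodule ℝ (Euc (n + q))}
    (f : M → Euc (n + p)) (f' : M → Euc (n + q)) (τ : ∀ x, L x ≃ₗᵢ[ℝ] L' x)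
    (φ : OpenPartialHomeomorph M (Euc n))
    (B₁ : Euc n → Euc n × (Fin ℓ → ℝ) →L[ℝ] Euc (n + p))
    (B₂ : Euc n → Euc n × (Fin ℓ → ℝ) →L[ℝ] Euc (n + q))
    (J : ∀ x : M, (TangentSpace (𝓡 n) x × L x) → Euc n × (Fin ℓ → ℝ)) : Prop where
  chart : IsSmoothChart φ
  pair : IsCompatiblePair φ.target (fun y => f (φ.symm y)) (fun y => f' (φ.symm y)) B₁ B₂
  bijective : ∀ x ∈ φ.source, Function.Bijective (J x)
  linear : ∀ x ∈ φ.source, IsLinearMap ℝ (J x)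
  fst_eq : ∀ x ∈ φ.source, ∀ v, (J x v).1 = chartDeriv φ x v.1
  snd_eq_zero_iff : ∀ x ∈ φ.source, ∀ v, (J x v).2 = 0 ↔ v.2 = 0
  phi_eq : ∀ x ∈ φ.source, ∀ u v,
    phi f f' τ x u v = pairForm B₁ B₂ (φ x) (chartDeriv φ x u) (J x v)

/-- Near every point the bundles `TM ⊕ L` and `TM ⊕ L'` have compatible frames, and `φ_τ` is given
by their second fundamental forms. -/
theorem exists_isAdaptedChart
    (g : Bundle.ContMDiffRiemannianMetric (𝓡 n) ∞ (Euc n)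
      (fun x : M => TangentSpace (𝓡 n) x))
    (f : M → Euc (n + p)) (f' : M → Euc (n + q))
    (hf : IsIsometricImmersion g f) (hf' : IsIsometricImmersion g f')
    (L : M → Submodule ℝ (Euc (n + p))) (L' : M → Submodule ℝ (Euc (n + q)))
    (hL : IsNormalSubbundle (n := n) f ℓ L) (hL' : IsNormalSubbundle (n := n) f' ℓ L')
    (τ : ∀ x, L x ≃ₗᵢ[ℝ] L' x) (hτ : IsSmoothBundleMap (n := n) τ)
    (hsff : PreservesSff (n := n) f f' τ) (hpar : IsParallel (n := n) f f' τ) (x₀ : M) :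
    ∃ (φ : OpenPartialHomeomorph M (Euc n))
      (B₁ : Euc n → Euc n × (Fin ℓ → ℝ) →L[ℝ] Euc (n + p))
      (B₂ : Euc n → Euc n × (Fin ℓ → ℝ) →L[ℝ] Euc (n + q))
      (J : ∀ x : M, (TangentSpace (𝓡 n) x × L x) → Euc n × (Fin ℓ → ℝ)),
      x₀ ∈ φ.source ∧ IsAdaptedChart f f' τ φ B₁ B₂ J := by
  classical
  obtain ⟨U, e, hU, hx₀U, he, heL⟩ := hL.1 x₀
  have hφ' : IsSmoothChart ((chartAt (Euc n) x₀).restrOpen U hU) :=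
    (isSmoothChart_chartAt x₀).restrOpen hU
  have hx₀' : x₀ ∈ ((chartAt (Euc n) x₀).restrOpen U hU).source := ⟨mem_chart_source _ x₀, hx₀U⟩
  have hφU' : ((chartAt (Euc n) x₀).restrOpen U hU).source ⊆ U := fun x hx => hx.2
  generalize (chartAt (Euc n) x₀).restrOpen U hU = φ at hφ' hx₀' hφU'
  rename' hφ' => hφ, hx₀' => hx₀, hφU' => hφU
  -- the frame of `L` as sections of `L`, extended by zero outside `U`
  let σ : Fin ℓ → ∀ x, L x := fun i x =>
    if h : x ∈ U then ⟨e i x, (heL x h).2 ▸ Submodule.subset_span ⟨i, rfl⟩⟩ else 0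
  have hσ : ∀ i, ∀ x ∈ U, (σ i x : Euc (n + p)) = e i x := fun i x hx => by simp [σ, hx]
  have hσs : ∀ i, ContMDiffOn (𝓡 n) (𝓡 (n + p)) ∞ (fun y => (σ i y : Euc (n + p))) U :=
    fun i => (he i).congr (hσ i)
  let e' : Fin ℓ → M → Euc (n + q) := fun i y => (τ y (σ i y) : Euc (n + q))
  have he' : ∀ i, ContMDiffOn (𝓡 n) (𝓡 (n + q)) ∞ (e' i) U := fun i => hτ U (σ i) hU (hσs i)
  let f₁ : Euc n → Euc (n + p) := fun y => f (φ.symm y)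
  let f₂ : Euc n → Euc (n + q) := fun y => f' (φ.symm y)
  let e₁ : Fin ℓ → Euc n → Euc (n + p) := fun i y => e i (φ.symm y)
  let e₂ : Fin ℓ → Euc n → Euc (n + q) := fun i y => e' i (φ.symm y)
  have hfs := hf.1.contMDiffOn (s := φ.source)
  have hfs' := hf'.1.contMDiffOn (s := φ.source)
  have hf₁ : ContDiffOn ℝ ∞ f₁ φ.target := hφ.contDiffOn_comp_symm hfs subset_rfl
  have hf₂ : ContDiffOn ℝ ∞ f₂ φ.target := hφ.contDiffOn_comp_symm hfs' subset_rfl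
  have he₁ : ∀ i, ContDiffOn ℝ ∞ (e₁ i) φ.target := fun i => hφ.contDiffOn_comp_symm (he i) hφU
  have he₂ : ∀ i, ContDiffOn ℝ ∞ (e₂ i) φ.target := fun i => hφ.contDiffOn_comp_symm (he' i) hφU
  have hmetric : ∀ x ∈ φ.source, ∀ u v : TangentSpace (𝓡 n) x,
      inner ℝ (fderiv ℝ f₁ (φ x) (chartDeriv φ x u)) (fderiv ℝ f₁ (φ x) (chartDeriv φ x v)) =
        inner ℝ (fderiv ℝ f₂ (φ x) (chartDeriv φ x u))
          (fderiv ℝ f₂ (φ x) (chartDeriv φ x v)) := by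
    intro x hx u v
    rw [← hφ.diff_eq hx hfs, ← hφ.diff_eq hx hfs, ← hφ.diff_eq hx hfs', ← hφ.diff_eq hx hfs',
      ← hf.2, hf'.2]
  -- every point of the chart domain and tangent vector come from `M`
  have hlift : ∀ {P : Euc n → Prop}, (∀ x ∈ φ.source, P (φ x)) → ∀ y ∈ φ.target, P y := by
    intro P h y hy
    rw [← φ.right_inv hy]
    exact h _ (φ.map_target hy)
  have hlift' : ∀ {x}, x ∈ φ.source → ∀ {P : Euc n → Prop},
      (∀ u : TangentSpace (𝓡 n) x, P (chartDeriv φ x u)) → ∀ v, P v := by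
    intro x hx P h v
    obtain ⟨u, rfl⟩ := (hφ.bijective_chartDeriv hx).2 v
    exact h u
  have hinj : ∀ x ∈ φ.source, Function.Injective (fderiv ℝ f₁ (φ x)) := by
    intro x hx
    rw [injective_iff_map_eq_zero]
    refine hlift' hx fun u hu => ?_
    exact (congrArg _ (hf.injective_diff x ((hφ.diff_eq hx hfs u).trans
      (hu.trans (map_zero _).symm)))).trans (map_zero _)
  have hinj₁ : ∀ y ∈ φ.target, Function.Injective (fderiv ℝ f₁ y) := hlift hinj
  have hinj₂ : ∀ y ∈ φ.target, Function.Injective (fderiv ℝ f₂ y) := by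
    refine hlift fun x hx => ?_
    rw [injective_iff_map_eq_zero]
    refine hlift' hx fun u hu => ?_
    have h0 := hmetric x hx u u
    rw [hu, inner_zero_left] at h0
    exact hinj x hx (by rw [inner_self_eq_zero.mp h0, map_zero])
  have hσ₁ : ∀ x ∈ φ.source, ∀ i, e₁ i (φ x) = σ i x := by
    intro x hx i
    simp only [e₁]
    rw [φ.left_inv hx, hσ i x (hφU hx)]
  have hσ₂ : ∀ x ∈ φ.source, ∀ i, e₂ i (φ x) = τ x (σ i x) := by
    intro x hx i
    simp only [e₂, e']
    rw [φ.left_inv hx]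
  have hnorm₁ : ∀ x ∈ φ.source, ∀ i, e₁ i (φ x) ∈ (tangentImage (n := n) f x)ᗮ := by
    intro x hx i
    rw [hσ₁ x hx]; exact hL.2 x (σ i x).2
  have hnorm₂ : ∀ x ∈ φ.source, ∀ i, e₂ i (φ x) ∈ (tangentImage (n := n) f' x)ᗮ := by
    intro x hx i
    rw [hσ₂ x hx]; exact hL'.2 x (τ x (σ i x)).2
  -- inner products with `L` are unchanged by the orthogonal projection onto `L` and by `τ`
  have hproj : ∀ x (w : Euc (n + p)) (w' : Euc (n + q)),
      τ x ((L x).orthogonalProjectionOnto w) = (L' x).orthogonalProjectionOnto w' →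
      ∀ η : L x, inner ℝ w (η : Euc (n + p)) = inner ℝ w' (τ x η : Euc (n + q)) := by
    intro x w w' hw η
    have h1 : inner ℝ ((L x).orthogonalProjectionOnto w) η = inner ℝ w (η : Euc (n + p)) := by
      rw [Submodule.inner_orthogonalProjectionOnto_eq_of_mem_right]
    have h2 : inner ℝ ((L' x).orthogonalProjectionOnto w') (τ x η) =
        inner ℝ w' (τ x η : Euc (n + q)) := by
      rw [Submodule.inner_orthogonalProjectionOnto_eq_of_mem_right]
    rw [← h1, ← h2, ← hw, LinearIsometryEquiv.inner_map_map]
  have hpair : IsCompatiblePair φ.target f₁ f₂ (bundleFrame f₁ e₁) (bundleFrame f₂ e₂) := by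
    refine isCompatiblePair_bundleFrame φ.open_target hf₁ hf₂ he₁ he₂ hinj₁ ?_ ?_ ?_ ?_ ?_ ?_ ?_
    · exact fun y hy => (heL _ (hφU (φ.map_target hy))).1
    · refine hlift fun x hx => hlift' hx fun u => hlift' hx fun v => hmetric x hx u v
    · refine hlift fun x hx => hlift' hx fun u i => ?_
      rw [← hφ.diff_eq hx hfs]
      exact Submodule.inner_right_of_mem_orthogonal (LinearMap.mem_range_self
        (diff (n := n) f x : TangentSpace (𝓡 n) x →ₗ[ℝ] Euc (n + p)) u) (hnorm₁ x hx i)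
    · refine hlift fun x hx => hlift' hx fun u i => ?_
      rw [← hφ.diff_eq hx hfs']
      exact Submodule.inner_right_of_mem_orthogonal (LinearMap.mem_range_self
        (diff (n := n) f' x : TangentSpace (𝓡 n) x →ₗ[ℝ] Euc (n + q)) u) (hnorm₂ x hx i)
    · refine hlift fun x hx i j => ?_
      rw [hσ₁ x hx, hσ₁ x hx, hσ₂ x hx, hσ₂ x hx]
      exact ((τ x).inner_map_map (σ i x) (σ j x)).symm
    · refine hlift fun x hx => hlift' hx fun u => hlift' hx fun v i => ?_
      have h1 := hproj x _ _ (hsff x u v) (σ i x)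
      rw [hφ.sff_eq hfs hinj₁ hx, hφ.sff_eq hfs' hinj₂ hx, ← hσ₁ x hx, ← hσ₂ x hx,
        inner_orthogonal_starProjection_of_mem _ _ _ (hnorm₁ x hx i),
        inner_orthogonal_starProjection_of_mem _ _ _ (hnorm₂ x hx i)] at h1
      exact h1
    · refine hlift fun x hx => hlift' hx fun u i j => ?_
      have h1 := hproj x _ _ (hpar U (σ i) hU (hσs i) x (hφU hx) u) (σ j x)
      rw [normalDeriv, normalDeriv, ← hσ₁ x hx, ← hσ₂ x hx,
        inner_orthogonal_starProjection_of_mem _ _ _ (hnorm₁ x hx j),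
        inner_orthogonal_starProjection_of_mem _ _ _ (hnorm₂ x hx j), ambientDeriv, ambientDeriv,
        hφ.diff_eq hx ((hσs i).mono hφU), hφ.diff_eq hx ((he' i).mono hφU)] at h1
      have h2 : fderiv ℝ (fun y => (σ i (φ.symm y) : Euc (n + p))) (φ x) =
          fderiv ℝ (e₁ i) (φ x) := by
        refine Filter.EventuallyEq.fderiv_eq ?_
        filter_upwards [φ.open_target.mem_nhds (φ.map_source hx)] with y hy
        exact hσ i _ (hφU (φ.map_target hy))
      rw [h2] at h1
      exact h1
  have hli : ∀ x ∈ φ.source, LinearIndependent ℝ fun i => σ i x := by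
    intro x hx
    refine LinearIndependent.of_comp (L x).subtype ?_
    have : (L x).subtype ∘ (fun i => σ i x) = fun i => e i x := funext fun i => hσ i x (hφU hx)
    rw [this]; exact (heL x (hφU hx)).1
  have hspan : ∀ x ∈ φ.source, ⊤ ≤ Submodule.span ℝ (Set.range fun i => σ i x) := by
    rintro x hx ⟨η, hη⟩ -
    have h1 : η ∈ Submodule.span ℝ (Set.range fun i => e i x) := by
      rw [← (heL x (hφU hx)).2]; exact hη
    obtain ⟨c, rfl⟩ := (Submodule.mem_span_range_iff_exists_fun ℝ).mp h1
    refine (Submodule.mem_span_range_iff_exists_fun ℝ).mpr ⟨c, Subtype.ext ?_⟩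
    simp only [Submodule.coe_sum, Submodule.coe_smul, hσ _ x (hφU hx)]
  let J : ∀ x : M, (TangentSpace (𝓡 n) x × L x) → Euc n × (Fin ℓ → ℝ) := fun x v =>
    (chartDeriv φ x v.1,
      if hx : x ∈ φ.source then (Module.Basis.mk (hli x hx) (hspan x hx)).equivFun v.2 else 0)
  have hJ : ∀ x (hx : x ∈ φ.source) v, J x v =
      (chartDeriv φ x v.1, (Module.Basis.mk (hli x hx) (hspan x hx)).equivFun v.2) := by
    intro x hx v
    simp only [J, dif_pos hx]
  have hJsum : ∀ x ∈ φ.source, ∀ v, ∑ i, (J x v).2 i • σ i x = v.2 := by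
    intro x hx v
    rw [hJ x hx]
    have := (Module.Basis.mk (hli x hx) (hspan x hx)).sum_equivFun v.2
    simpa only [Module.Basis.mk_apply] using this
  have hfib₁ : ∀ x ∈ φ.source, ∀ v,
      fibreIncl f L x v = bundleFrame f₁ e₁ (φ x) (J x v) := by
    intro x hx v
    rw [bundleFrame_apply, ← hφ.diff_eq hx hfs, fibreIncl, LinearMap.coprod_apply]
    congr 1
    rw [Submodule.subtype_apply, ← hJsum x hx v]
    simp only [Submodule.coe_sum, Submodule.coe_smul, hσ₁ x hx]
  have hfib₂ : ∀ x ∈ φ.source, ∀ v,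
      fibreIncl f' L' x (tauBar τ x v) = bundleFrame f₂ e₂ (φ x) (J x v) := by
    intro x hx v
    rw [bundleFrame_apply, ← hφ.diff_eq hx hfs', fibreIncl, LinearMap.coprod_apply]
    congr 1
    change ((τ x v.2 : L' x) : Euc (n + q)) = _
    rw [← hJsum x hx v, map_sum]
    simp only [Submodule.coe_sum, map_smul, Submodule.coe_smul, hσ₂ x hx]
  have hbij : ∀ x ∈ φ.source, Function.Bijective (J x) := by
    intro x hx
    have : J x = Prod.map (chartDeriv φ x)
        (Module.Basis.mk (hli x hx) (hspan x hx)).equivFun := funext fun v => hJ x hx v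
    rw [this]
    exact (hφ.bijective_chartDeriv hx).prodMap (LinearEquiv.bijective _)
  have hS₁ : ∀ x ∈ φ.source, tangentImage (n := n) f x ⊔ L x =
      LinearMap.range (bundleFrame f₁ e₁ (φ x) : Euc n × (Fin ℓ → ℝ) →ₗ[ℝ] Euc (n + p)) := by
    intro x hx
    rw [tangentImage, ← Submodule.range_subtype (L x), ← LinearMap.range_coprod]
    ext w
    constructor
    · rintro ⟨v, rfl⟩
      exact ⟨J x v, (hfib₁ x hx v).symm⟩
    · rintro ⟨a, rfl⟩
      obtain ⟨v, rfl⟩ := (hbij x hx).2 a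
      exact ⟨v, hfib₁ x hx v⟩
  have hS₂ : ∀ x ∈ φ.source, tangentImage (n := n) f' x ⊔ L' x =
      LinearMap.range (bundleFrame f₂ e₂ (φ x) : Euc n × (Fin ℓ → ℝ) →ₗ[ℝ] Euc (n + q)) := by
    intro x hx
    rw [tangentImage, ← Submodule.range_subtype (L' x), ← LinearMap.range_coprod]
    ext w
    constructor
    · rintro ⟨v, rfl⟩
      refine ⟨J x (v.1, (τ x).symm v.2), (hfib₂ x hx _).symm.trans ?_⟩
      change fibreIncl f' L' x (v.1, τ x ((τ x).symm v.2)) = fibreIncl f' L' x (v.1, v.2)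
      rw [LinearIsometryEquiv.apply_symm_apply]
    · rintro ⟨a, rfl⟩
      obtain ⟨v, rfl⟩ := (hbij x hx).2 a
      exact ⟨tauBar τ x v, hfib₂ x hx v⟩
  refine ⟨φ, bundleFrame f₁ e₁, bundleFrame f₂ e₂, J, hx₀, hφ, hpair, hbij,
    fun x hx => ⟨fun v w => ?_, fun c v => ?_⟩, fun x hx v => rfl, fun x hx v => ?_,
    fun x hx u v => ?_⟩
  · simp only [hJ x hx, Prod.fst_add, Prod.snd_add, map_add, Prod.mk_add_mk]
  · simp only [hJ x hx, Prod.smul_fst, Prod.smul_snd, map_smul, Prod.smul_mk]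
  · rw [hJ x hx]
    exact LinearEquiv.map_eq_zero_iff _
  · have h₁ := hφ.secondForm_eq_frameSff (S := fun y => tangentImage (n := n) f y ⊔ L y)
      hpair.frame₁ hpair.injective₁ hS₁ hx u (J x v)
    have h₂ := hφ.secondForm_eq_frameSff (S := fun y => tangentImage (n := n) f' y ⊔ L' y)
      hpair.frame₂ (fun _ hy => hpair.injective₂ hy) hS₂ hx u (J x v)
    rw [← hfib₁ x hx v] at h₁
    rw [← hfib₂ x hx v] at h₂
    rw [pairForm_apply, ← h₁, ← h₂]
    rfl

end LocalData

/-! ### Singular extensions in a chart and on the manifold -/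

/-- A map with a differentiable local left inverse has injective differential. -/
theorem injective_mfderiv_of_eventually_leftInverse {E E' A A' : Type*}
    [NormedAddCommGroup E] [NormedSpace ℝ E] [NormedAddCommGroup E'] [NormedSpace ℝ E']
    [TopologicalSpace A] [ChartedSpace E A] [TopologicalSpace A'] [ChartedSpace E' A']
    {h : A → A'} {r : A' → A} {x : A}
    (hh : MDifferentiableAt 𝓘(ℝ, E) 𝓘(ℝ, E') h x)
    (hr : MDifferentiableAt 𝓘(ℝ, E') 𝓘(ℝ, E) r (h x)) (hrh : ∀ᶠ y in 𝓝 x, r (h y) = y) :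
    Function.Injective (mfderiv 𝓘(ℝ, E) 𝓘(ℝ, E') h x) := by
  have h1 : mfderiv 𝓘(ℝ, E) 𝓘(ℝ, E) (r ∘ h) x = ContinuousLinearMap.id ℝ _ :=
    (Filter.EventuallyEq.mfderiv_eq (f := id) (hrh.mono fun y hy => hy)).trans mfderiv_id
  have h2 := _root_.mfderiv_comp x hr hh
  intro u v huv
  have h3 : ∀ w : TangentSpace 𝓘(ℝ, E) x, mfderiv 𝓘(ℝ, E') 𝓘(ℝ, E) r (h x)
      (mfderiv 𝓘(ℝ, E) 𝓘(ℝ, E') h x w) = w := fun w => by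
    have := congrArg (fun T => T w) (h2.symm.trans h1)
    exact this
  rw [← h3 u, huv, h3 v]

/-- Every nonempty open subset `O` of `ℝᵏ` is diffeomorphic to a manifold in any given universe; `ι`
is the diffeomorphism onto `O`, and `r` its inverse. -/
theorem exists_manifold_of_isOpen {k : ℕ} {O : Set (Euc k)} (hO : IsOpen O) (hne : O.Nonempty) :
    ∃ (N : Type u) (_ : TopologicalSpace N) (_ : T2Space N) (_ : SecondCountableTopology N)
      (_ : ChartedSpace (Euc k) N) (_ : IsManifold (𝓡 k) ∞ N) (ι : N → Euc k) (r : Euc k → N),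
      Topology.IsEmbedding ι ∧ (∀ y, ι y ∈ O) ∧ (∀ z ∈ O, ι (r z) = z) ∧ (∀ y, r (ι y) = y) ∧
      ContMDiff (𝓡 k) (𝓡 k) ∞ ι ∧ ContMDiffOn (𝓡 k) (𝓡 k) ∞ r O := by
  let ι : ULift.{u} O → Euc k := fun y => y.down
  have hι : Topology.IsOpenEmbedding ι :=
    hO.isOpenEmbedding_subtypeVal.comp Homeomorph.ulift.isOpenEmbedding
  have : Nonempty (ULift.{u} O) := ⟨⟨⟨hne.some, hne.some_mem⟩⟩⟩
  have hrange : Set.range ι = O := by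
    ext z
    exact ⟨by rintro ⟨y, rfl⟩; exact y.down.2, fun hz => ⟨⟨⟨z, hz⟩⟩, rfl⟩⟩
  let _ := hι.singletonChartedSpace
  have : IsManifold (𝓡 k) ∞ (ULift.{u} O) := hι.isManifold_singleton
  refine ⟨ULift.{u} O, inferInstance, hι.isEmbedding.t2Space, hι.isEmbedding.secondCountableTopology,
    inferInstance, inferInstance, ι, (hι.toOpenPartialHomeomorph ι).symm, hι.isEmbedding,
    fun y => y.down.2, fun z hz => ?_, fun y => ?_, contMDiff_isOpenEmbedding hι, ?_⟩
  · exact (hι.toOpenPartialHomeomorph ι).right_inv (by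
      rw [hι.toOpenPartialHomeomorph_target, hrange]; exact hz)
  · exact (hι.toOpenPartialHomeomorph ι).left_inv (by simp)
  · have := contMDiffOn_isOpenEmbedding_symm (I := 𝓡 k) (n := ∞) hι
    rwa [hrange] at this

section

variable {n p q : ℕ} {M : Type u} [TopologicalSpace M] [ChartedSpace (Euc n) M]
  [IsManifold (𝓡 n) ∞ M]

/-- A singular extension in a chart `φ` is a singular extension on `M`: the manifold `N` is the open
subset of `E × ℝ ≃ ℝⁿ⁺¹` on which the extensions are defined, and `j x = (φ x, 0)`. -/
theorem LocallySingularlyExtend.singularlyExtendIsometrically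
    {φ : OpenPartialHomeomorph M (Euc n)} (hφ : IsSmoothChart φ) {f : M → Euc p} {f' : M → Euc q}
    {U : Set (Euc n)} (hU : IsOpen U) (hUφ : U ⊆ φ.target) (hne : U.Nonempty)
    (hext : LocallySingularlyExtend U (fun y => f (φ.symm y)) (fun y => f' (φ.symm y))) :
    ∃ U' : TopologicalSpace.Opens M, (U' : Set M).Nonempty ∧
      SingularlyExtendIsometrically (n := n) (fun x : U' => f x) (fun x : U' => f' x) := by
  obtain ⟨N, F₁, F₂, hN, hF₁, hF₂, hNU, hFU, hmet, himm⟩ := hext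
  let κ : (Euc n × ℝ) ≃L[ℝ] Euc (n + 1) := ContinuousLinearEquiv.ofFinrankEq (by simp)
  have hO : IsOpen (κ.symm ⁻¹' N) := hN.preimage κ.symm.continuous
  have hOne : (κ.symm ⁻¹' N).Nonempty := by
    obtain ⟨y, hy⟩ := hne
    exact ⟨κ (y, 0), by simpa using (hNU y).mpr hy⟩
  obtain ⟨N', i1, i2, i3, i4, i5, ι, r, hιe, hιO, hιr, hrι, hιs, hrs⟩ :=
    exists_manifold_of_isOpen.{u} hO hOne
  let U' : TopologicalSpace.Opens M := ⟨φ.source ∩ φ ⁻¹' U, φ.isOpen_inter_preimage hU⟩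
  have hU' : ∀ x : U', (x : M) ∈ φ.source ∧ φ x ∈ U := fun x => x.2
  have hU'ne : (U' : Set M).Nonempty := by
    obtain ⟨y, hy⟩ := hne
    exact ⟨φ.symm y, φ.map_target (hUφ hy), by
      rw [Set.mem_preimage, φ.right_inv (hUφ hy)]; exact hy⟩
  have hsymm : ∀ y ∈ U, φ.symm y ∈ U' := fun y hy =>
    ⟨φ.map_target (hUφ hy), by rw [Set.mem_preimage, φ.right_inv (hUφ hy)]; exact hy⟩
  let x₁ : U' := ⟨hU'ne.some, hU'ne.some_mem⟩
  classical
  -- the chart `φ` of `M` read on `U'`, and its inverse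
  let ρ : Euc n → U' := fun y => if h : φ.symm y ∈ U' then ⟨φ.symm y, h⟩ else x₁
  have hρ : ∀ y ∈ U, (ρ y : M) = φ.symm y := fun y hy => by simp only [ρ, dif_pos (hsymm y hy)]
  have hρs : ContMDiffOn (𝓡 n) (𝓡 n) ∞ ρ U := by
    intro y hy
    refine ContMDiffAt.contMDiffWithinAt ?_
    rw [← ContMDiffAt.subtypeVal_comp_iff]
    refine (hφ.smooth_symm.contMDiffAt (φ.open_target.mem_nhds (hUφ hy))).congr_of_eventuallyEq ?_
    filter_upwards [hU.mem_nhds hy] with z hz using hρ z hz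
  let κι : Euc n → Euc (n + 1) := fun y => κ (y, 0)
  have hκι : ContDiff ℝ ∞ κι := κ.contDiff.comp (contDiff_id.prodMk contDiff_const)
  have hκιO : ∀ y, κι y ∈ κ.symm ⁻¹' N ↔ y ∈ U := fun y => by simp [κι, hNU]
  let j : U' → N' := fun x => r (κι (φ x))
  have hιj : ∀ x : U', ι (j x) = κι (φ x) := fun x => hιr _ ((hκιO _).mpr (hU' x).2)
  have hφs : ContMDiff (𝓡 n) (𝓡 n) ∞ (fun x : U' => φ x) :=
    hφ.smooth.comp_contMDiff contMDiff_subtype_val fun x => (hU' x).1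
  have hjs : ContMDiff (𝓡 n) (𝓡 (n + 1)) ∞ j :=
    hrs.comp_contMDiff (hκι.contMDiff.comp hφs) fun x => (hκιO _).mpr (hU' x).2
  let π : N' → Euc n := fun y => (κ.symm (ι y)).1
  have hπs : ContMDiff (𝓡 (n + 1)) (𝓡 n) ∞ π :=
    (contDiff_fst.comp κ.symm.contDiff).contMDiff.comp hιs
  have hπj : ∀ x : U', π (j x) = φ x := fun x => by
    simp only [π]; rw [hιj]; simp [κι]
  have hρφ : ∀ x : U', ρ (φ x) = x := fun x => Subtype.ext (by
    rw [hρ _ (hU' x).2, φ.left_inv (hU' x).1])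
  have hF : ∀ {k : ℕ} {F : Euc n × ℝ → Euc k}, ContDiffOn ℝ ∞ F N →
      ContMDiff (𝓡 (n + 1)) (𝓡 k) ∞ (fun y : N' => F (κ.symm (ι y))) ∧
      ∀ (y : N') (v : TangentSpace (𝓡 (n + 1)) y),
        diff (n := n + 1) (fun y : N' => F (κ.symm (ι y))) y v =
          fderiv ℝ F (κ.symm (ι y)) (κ.symm (mfderiv (𝓡 (n + 1)) (𝓡 (n + 1)) ι y v)) := by
    intro k F hF
    have hFκ : ContDiffOn ℝ ∞ (fun z => F (κ.symm z)) (κ.symm ⁻¹' N) :=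
      hF.comp κ.symm.contDiff.contDiffOn fun z hz => hz
    refine ⟨hFκ.contMDiffOn.comp_contMDiff hιs hιO, fun y v => ?_⟩
    have hd : DifferentiableAt ℝ F (κ.symm (ι y)) :=
      (hF.contDiffAt (hN.mem_nhds (hιO y))).differentiableAt (by simp)
    have hd' : HasFDerivAt (fun z => F (κ.symm z))
        ((fderiv ℝ F (κ.symm (ι y))).comp (κ.symm : Euc (n + 1) →L[ℝ] Euc n × ℝ)) (ι y) :=
      hd.hasFDerivAt.comp (ι y) κ.symm.hasFDerivAt
    have h1 := _root_.mfderiv_comp (I := 𝓡 (n + 1)) (I' := 𝓡 (n + 1)) (I'' := 𝓡 k) y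
      hd'.differentiableAt.mdifferentiableAt ((hιs y).mdifferentiableAt (by simp))
    rw [mfderiv_eq_fderiv, hd'.fderiv] at h1
    exact congrArg (fun T => T v) h1
  have hιinj : ∀ y, Function.Injective (mfderiv (𝓡 (n + 1)) (𝓡 (n + 1)) ι y) := fun y =>
    injective_mfderiv_of_eventually_leftInverse ((hιs y).mdifferentiableAt (by simp))
      ((hrs.contMDiffAt (hO.mem_nhds (hιO y))).mdifferentiableAt (by simp))
      (Filter.Eventually.of_forall hrι)
  refine ⟨U', hU'ne, 1, N', i1, i2, i3, i4, i5, j, fun y => F₁ (κ.symm (ι y)),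
    fun y => F₂ (κ.symm (ι y)), one_pos, hjs, fun x => ?_, ?_, (hF hF₁).1, (hF hF₂).1, ?_, ?_,
    ?_, ?_⟩
  · refine injective_mfderiv_of_eventually_leftInverse (r := fun y => ρ (π y))
      ((hjs x).mdifferentiableAt (by simp)) ?_ (Filter.Eventually.of_forall fun y => ?_)
    · refine MDifferentiableAt.comp (I' := 𝓡 n) (j x) (g := ρ) (f := π) ?_
        ((hπs _).mdifferentiableAt (by simp))
      rw [hπj]
      exact (hρs.contMDiffAt (hU.mem_nhds (hU' x).2)).mdifferentiableAt (by simp)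
    · simp only [hπj, hρφ]
  · have h1 : Topology.IsEmbedding (fun x : U' => φ x) := by
      exact φ.isOpenEmbedding_restrict.isEmbedding.comp
        (Topology.IsEmbedding.inclusion fun x hx => hx.1 : Topology.IsEmbedding
          (Set.inclusion (fun x hx => hx.1 : (U' : Set M) ⊆ φ.source)))
    refine Topology.IsEmbedding.of_comp hjs.continuous hπs.continuous ?_
    rwa [show π ∘ j = fun x : U' => φ x from funext hπj]
  · intro y v w
    rw [(hF hF₁).2, (hF hF₁).2, (hF hF₂).2, (hF hF₂).2]
    exact hmet _ (hιO y) _ _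
  · intro y hy
    have hy2 : (κ.symm (ι y)).2 ≠ 0 := by
      intro h0
      refine hy ⟨ρ (π y), ?_⟩
      have h1 : κ.symm (ι y) = (π y, 0) := Prod.ext rfl h0
      have hπU : π y ∈ U := (hNU _).mp (h1 ▸ hιO y)
      have h2 : ι (j (ρ (π y))) = ι y := by
        rw [hιj, hρ _ hπU, φ.right_inv (hUφ hπU)]
        simp only [κι]
        rw [← h1, ContinuousLinearEquiv.apply_symm_apply]
      rw [← hrι (j (ρ (π y))), h2, hrι]
    obtain ⟨h1, h2⟩ := himm _ (hιO y) hy2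
    constructor
    · intro v w hvw
      rw [(hF hF₁).2, (hF hF₁).2] at hvw
      exact hιinj y (κ.symm.injective (h1 hvw))
    · intro v w hvw
      rw [(hF hF₂).2, (hF hF₂).2] at hvw
      exact hιinj y (κ.symm.injective (h2 hvw))
  · funext x
    change F₁ (κ.symm (ι (j x))) = f x
    rw [hιj]
    simp only [κι, ContinuousLinearEquiv.symm_apply_apply]
    rw [(hFU _ (hU' x).2).1]
    simp only []
    rw [φ.left_inv (hU' x).1]
  · funext x
    change F₂ (κ.symm (ι (j x))) = f' x
    rw [hιj]
    simp only [κι, ContinuousLinearEquiv.symm_apply_apply]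
    rw [(hFU _ (hU' x).2).2]
    simp only []
    rw [φ.left_inv (hU' x).1]

end

/-! ### Vector fields in charts -/

section Fields

variable {n : ℕ} {M : Type u} [TopologicalSpace M] [ChartedSpace (Euc n) M]
  [IsManifold (𝓡 n) ∞ M]

namespace IsSmoothChart

variable {φ : OpenPartialHomeomorph M (Euc n)} (hφ : IsSmoothChart φ)

include hφ

/-- The coordinates of a smooth vector field are smooth. -/
theorem contDiffOn_chartDeriv {W : Set M} {Y : ∀ x : M, TangentSpace (𝓡 n) x}
    (hY : IsSmoothVectorField W Y) :
    ContDiffOn ℝ ∞ (fun y => chartDeriv φ (φ.symm y) (Y (φ.symm y)))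
      (φ.target ∩ φ.symm ⁻¹' W) := by
  have h1 := hφ.smooth.contMDiffOn_tangentMapWithin (m := ∞) (by simp)
    φ.open_source.uniqueMDiffOn
  have h2 : ContMDiffOn (𝓡 n) (𝓡 n) ∞ φ.symm (φ.target ∩ φ.symm ⁻¹' W) :=
    hφ.smooth_symm.mono Set.inter_subset_left
  have h3 := h1.comp (hY.comp h2 fun y hy => hy.2) (fun y hy => φ.map_target hy.1)
  have h4 := (contMDiff_snd_tangentBundle_modelSpace (n := ∞) (Euc n)
    𝓘(ℝ, Euc n)).comp_contMDiffOn h3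
  refine contMDiffOn_iff_contDiffOn.mp (h4.congr fun y hy => ?_)
  have : mfderivWithin (𝓡 n) (𝓡 n) φ φ.source (φ.symm y) = mfderiv (𝓡 n) (𝓡 n) φ (φ.symm y) :=
    mfderivWithin_of_isOpen φ.open_source (φ.map_target hy.1)
  change chartDeriv φ (φ.symm y) (Y (φ.symm y)) =
    mfderivWithin (𝓡 n) (𝓡 n) φ φ.source (φ.symm y) (Y (φ.symm y))
  rw [this]; rfl

/-- Smooth vector fields in the coordinates of a chart come from smooth vector fields on `M`. -/
theorem exists_isSmoothVectorField {U : Set (Euc n)} (hUφ : U ⊆ φ.target)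
    {X : Euc n → Euc n} (hX : ContDiffOn ℝ ∞ X U) :
    ∃ Y : ∀ x : M, TangentSpace (𝓡 n) x, IsSmoothVectorField (φ.source ∩ φ ⁻¹' U) Y ∧
      ∀ x ∈ φ.source, chartDeriv φ x (Y x) = X (φ x) := by
  classical
  let Y : ∀ x : M, TangentSpace (𝓡 n) x := fun x =>
    (mfderiv (𝓡 n) (𝓡 n) φ.symm (φ x) (X (φ x)) : Euc n)
  refine ⟨Y, ?_, fun x hx => ?_⟩
  · have h1 := hφ.smooth_symm.contMDiffOn_tangentMapWithin (m := ∞) (by simp)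
      φ.open_target.uniqueMDiffOn
    have h2 : ContMDiffOn (𝓡 n) (𝓡 n).tangent ∞
        (fun y => (⟨y, X y⟩ : TangentBundle (𝓡 n) (Euc n))) U :=
      contMDiffOn_vectorSpace_iff_contDiffOn.mpr hX
    have h3 := (h1.comp h2 fun y hy => hUφ hy).comp
      (hφ.smooth.mono Set.inter_subset_left) (fun x (hx : x ∈ φ.source ∩ φ ⁻¹' U) => hx.2)
    refine h3.congr fun x hx => ?_
    have h4 : mfderivWithin (𝓡 n) (𝓡 n) φ.symm φ.target (φ x) =
        mfderiv (𝓡 n) (𝓡 n) φ.symm (φ x) :=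
      mfderivWithin_of_isOpen φ.open_target (φ.map_source hx.1)
    change (⟨x, Y x⟩ : TangentBundle (𝓡 n) M) = ⟨φ.symm (φ x),
      mfderivWithin (𝓡 n) (𝓡 n) φ.symm φ.target (φ x) (X (φ x))⟩
    rw [h4]
    -- all tangent spaces are the model space, so the base point can be rewritten
    have h5 : ∀ (a b : M) (_ : a = b) (w : Euc n),
        (⟨a, w⟩ : TangentBundle (𝓡 n) M) = ⟨b, w⟩ := by
      rintro a _ rfl w; rfl
    exact h5 x (φ.symm (φ x)) (φ.left_inv hx.1).symm _
  · have h1 := hφ.mdifferentiable.comp_symm_deriv (φ.map_source hx)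
    have h2 := congrArg (fun T => T (X (φ x))) h1
    rw [φ.left_inv hx] at h2
    exact h2

end IsSmoothChart

end Fields

/-! ### The index of `φ_τ` -/

section Index

variable {n p q ℓ : ℕ} {M : Type u} [TopologicalSpace M] [ChartedSpace (Euc n) M]
  [IsManifold (𝓡 n) ∞ M] {f : M → Euc (n + p)} {f' : M → Euc (n + q)}
  {L : M → Submodule ℝ (Euc (n + p))} {L' : M → Submodule ℝ (Euc (n + q))}
  {τ : ∀ x, L x ≃ₗᵢ[ℝ] L' x} {φ : OpenPartialHomeomorph M (Euc n)}
  {B₁ : Euc n → Euc n × (Fin ℓ → ℝ) →L[ℝ] Euc (n + p)}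
  {B₂ : Euc n → Euc n × (Fin ℓ → ℝ) →L[ℝ] Euc (n + q)}
  {J : ∀ x : M, (TangentSpace (𝓡 n) x × L x) → Euc n × (Fin ℓ → ℝ)}

namespace IsAdaptedChart

variable (h : IsAdaptedChart f f' τ φ B₁ B₂ J)

include h

theorem phiRank_eq {x : M} (hx : x ∈ φ.source) (u : TangentSpace (𝓡 n) x) :
    phiRank f f' τ x u = Module.finrank ℝ (LinearMap.range
      (pairForm B₁ B₂ (φ x) (chartDeriv φ x u) :
        Euc n × (Fin ℓ → ℝ) →ₗ[ℝ] Euc (n + p) × Euc (n + q))) := by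
  have : LinearMap.range (phi f f' τ x u) = LinearMap.range
      (pairForm B₁ B₂ (φ x) (chartDeriv φ x u) :
        Euc n × (Fin ℓ → ℝ) →ₗ[ℝ] Euc (n + p) × Euc (n + q)) := by
    ext w
    constructor
    · rintro ⟨v, rfl⟩
      exact ⟨J x v, (h.phi_eq x hx u v).symm⟩
    · rintro ⟨a, rfl⟩
      obtain ⟨v, rfl⟩ := (h.bijective x hx).2 a
      exact ⟨v, h.phi_eq x hx u v⟩
  rw [phiRank, this]

/-- The ranks are bounded, so that the supremum `i(φ_τ)(x)` in `ℕ` is a maximum. -/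
theorem bddAbove_phiRank {x : M} (hx : x ∈ φ.source) :
    BddAbove (Set.range fun u : TangentSpace (𝓡 n) x => phiRank f f' τ x u) := by
  refine ⟨n + ℓ, ?_⟩
  rintro _ ⟨u, rfl⟩
  simp only [h.phiRank_eq hx u]
  refine (LinearMap.finrank_range_le _).trans (by simp)

theorem phiRank_le_phiIndex {x : M} (hx : x ∈ φ.source) (u : TangentSpace (𝓡 n) x) :
    phiRank f f' τ x u ≤ phiIndex (n := n) f f' τ x :=
  le_ciSup (h.bddAbove_phiRank hx) u

theorem exists_isRegularElement {x : M} (hx : x ∈ φ.source) :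
    ∃ u : TangentSpace (𝓡 n) x, IsRegularElement f f' τ x u :=
  Nat.sSup_mem (Set.range_nonempty _) (h.bddAbove_phiRank hx)

/-- The kernel of `φ_τ^u`, read in the frame, has dimension `n + ℓ - i(φ_τ)` for regular `u`. -/
theorem finrank_ker_add_phiIndex {x : M} (hx : x ∈ φ.source) {u : TangentSpace (𝓡 n) x}
    (hu : IsRegularElement f f' τ x u) :
    Module.finrank ℝ (LinearMap.ker (pairForm B₁ B₂ (φ x) (chartDeriv φ x u) :
        Euc n × (Fin ℓ → ℝ) →ₗ[ℝ] Euc (n + p) × Euc (n + q))) +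
      phiIndex (n := n) f f' τ x = n + ℓ := by
  rw [← hu, h.phiRank_eq hx, add_comm, LinearMap.finrank_range_add_finrank_ker]
  simp

/-- The values of `φ_τ` lie in `L^⊥ × L'^⊥`, of dimension `(p - ℓ) + (q - ℓ)`. -/
theorem phiIndex_add_le {x : M} (hx : x ∈ φ.source) :
    phiIndex (n := n) f f' τ x + 2 * ℓ ≤ p + q := by
  obtain ⟨u, hu⟩ := h.exists_isRegularElement hx
  rw [← hu, h.phiRank_eq hx]
  have hy := φ.map_source hx
  have hdim : ∀ {m : ℕ} {B : Euc n × (Fin ℓ → ℝ) →L[ℝ] Euc m}, Function.Injective B →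
      Module.finrank ℝ (LinearMap.range (B : Euc n × (Fin ℓ → ℝ) →ₗ[ℝ] Euc m))ᗮ + (n + ℓ) = m := by
    intro m B hB
    have h1 := LinearMap.finrank_range_of_inj (f := (B : Euc n × (Fin ℓ → ℝ) →ₗ[ℝ] Euc m)) hB
    have h2 := Submodule.finrank_add_finrank_orthogonal
      (LinearMap.range (B : Euc n × (Fin ℓ → ℝ) →ₗ[ℝ] Euc m))
    simp at h1 h2
    omega
  let P₁ := (LinearMap.range (B₁ (φ x) : Euc n × (Fin ℓ → ℝ) →ₗ[ℝ] Euc (n + p)))ᗮ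
  let P₂ := (LinearMap.range (B₂ (φ x) : Euc n × (Fin ℓ → ℝ) →ₗ[ℝ] Euc (n + q)))ᗮ
  have h1 : Module.finrank ℝ P₁ + (n + ℓ) = n + p := hdim (h.pair.injective₁ _ hy)
  have h2 : Module.finrank ℝ P₂ + (n + ℓ) = n + q := hdim (h.pair.injective₂ hy)
  have h3 : LinearMap.range (pairForm B₁ B₂ (φ x) (chartDeriv φ x u) :
        Euc n × (Fin ℓ → ℝ) →ₗ[ℝ] Euc (n + p) × Euc (n + q)) ≤
      LinearMap.range (P₁.subtype.prodMap P₂.subtype) := by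
    rintro _ ⟨a, rfl⟩
    rw [ContinuousLinearMap.coe_coe, pairForm_apply, frameSff_apply, frameSff_apply]
    exact ⟨(⟨_, Submodule.starProjection_apply_mem P₁ _⟩,
      ⟨_, Submodule.starProjection_apply_mem P₂ _⟩), rfl⟩
  have h4 := (Submodule.finrank_mono h3).trans (LinearMap.finrank_range_le _)
  rw [Module.finrank_prod] at h4
  omega

/-- A constant coordinate field through a regular element has rank at least `i(φ_τ)(x₀)`
near `x₀`. -/
theorem eventually_phiIndex_le {x₀ : M} (hx₀ : x₀ ∈ φ.source) :
    ∃ a : Euc n, ∀ᶠ x in 𝓝 x₀, ∀ u : TangentSpace (𝓡 n) x, chartDeriv φ x u = a →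
      phiIndex (n := n) f f' τ x₀ ≤ phiRank f f' τ x u := by
  obtain ⟨u, hu⟩ := h.exists_isRegularElement hx₀
  refine ⟨chartDeriv φ x₀ u, ?_⟩
  have h1 := h.pair.contDiffOn_pairForm subset_rfl
    (contDiffOn_const (c := chartDeriv φ x₀ u) (s := φ.target))
  have h2 : ContinuousAt (fun x => pairForm B₁ B₂ (φ x) (chartDeriv φ x₀ u)) x₀ :=
    ContinuousAt.comp (f := φ) (h1.continuousOn.continuousAt
      (φ.open_target.mem_nhds (φ.map_source hx₀))) (φ.continuousAt hx₀)
  filter_upwards [eventually_finrank_range_le h2, φ.open_source.mem_nhds hx₀] with x hx hxφ v hv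
  rw [← hu, h.phiRank_eq hx₀, h.phiRank_eq hxφ, hv]
  exact hx

/-- At the regular elements of a vector field `Y`, the kernel of `φ_τ^Y` is tangent to `M` and is
a ruling distribution. -/
theorem exists_isRulingPair (hgen : IsStronglyGenuineDeformation (n := n) f f')
    {W : Set M} (hW : IsOpen W) {Y : ∀ x : M, TangentSpace (𝓡 n) x}
    (hY : IsSmoothVectorField W Y) (hreg : ∀ x ∈ W, IsRegularElement f f' τ x (Y x)) {d i : ℕ}
    (hi : ∀ x ∈ W, phiIndex (n := n) f f' τ x = i) (hd : d + i = n + ℓ) {x₀ : M}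
    (hx₀ : x₀ ∈ φ.source) (hx₀W : x₀ ∈ W) :
    ∃ (U : Set (Euc n)) (z : Euc n → Euc d →L[ℝ] Euc n), φ x₀ ∈ U ∧
      U ⊆ φ.target ∩ φ.symm ⁻¹' W ∧
      IsRulingPair U (fun y => f (φ.symm y)) (fun y => f' (φ.symm y)) z ∧
      ∀ x ∈ φ.source, φ x ∈ U → (∀ v ∈ phiKer f f' τ Y x, v.2 = 0) ∧
        ∀ u, u ∈ phiKerTangent f f' τ Y x ↔ ∃ k, chartDeriv φ x u = z (φ x) k := by
  have hsymm : ∀ y ∈ φ.target ∩ φ.symm ⁻¹' W, φ (φ.symm y) = y := fun y hy => φ.right_inv hy.1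
  have hlift : ∀ {P : Euc n → Prop}, (∀ x ∈ φ.source, x ∈ W → P (φ x)) →
      ∀ y ∈ φ.target ∩ φ.symm ⁻¹' W, P y := by
    intro P hP y hy
    rw [← hsymm y hy]
    exact hP _ (φ.map_target hy.1) hy.2
  let Yc : Euc n → Euc n := fun y => chartDeriv φ (φ.symm y) (Y (φ.symm y))
  have hYc : ∀ x ∈ φ.source, Yc (φ x) = chartDeriv φ x (Y x) := fun x hx => by
    simp only [Yc]; rw [φ.left_inv hx]
  have hgen' : ∀ U ⊆ φ.target, IsOpen U → U.Nonempty →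
      ¬ LocallySingularlyExtend U (fun y => f (φ.symm y)) (fun y => f' (φ.symm y)) := by
    intro U hUφ hU hne hext
    obtain ⟨U', hU', hU'ext⟩ := hext.singularlyExtendIsometrically h.chart hU hUφ hne
    exact hgen U' hU' hU'ext
  obtain ⟨U, z, hxU, hUW, hpair, hker⟩ := h.pair.exists_isRulingPair (d := d) (Y := Yc) hgen'
    (φ.isOpen_inter_preimage_symm hW) Set.inter_subset_left (h.chart.contDiffOn_chartDeriv hY)
    (hlift fun x hx hxW u => by
      obtain ⟨u, rfl⟩ := (h.chart.bijective_chartDeriv hx).2 u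
      rw [hYc x hx, ← h.phiRank_eq hx, ← h.phiRank_eq hx, hreg x hxW]
      exact h.phiRank_le_phiIndex hx u)
    (hlift fun x hx hxW => by
      have := h.finrank_ker_add_phiIndex hx (hreg x hxW)
      rw [hi x hxW] at this
      rw [hYc x hx]
      omega)
    (⟨φ.map_source hx₀, by rw [Set.mem_preimage, φ.left_inv hx₀]; exact hx₀W⟩ :
      φ x₀ ∈ φ.target ∩ φ.symm ⁻¹' W)
  have hphi : ∀ x ∈ φ.source, φ x ∈ U → ∀ v : TangentSpace (𝓡 n) x × L x,
      v ∈ phiKer f f' τ Y x ↔ ∃ k, J x v = (z (φ x) k, 0) := by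
    intro x hx hxU v
    rw [← hker _ hxU, hYc x hx, ← h.phi_eq x hx]
    exact LinearMap.mem_ker
  refine ⟨U, z, hxU, hUW, hpair, fun x hx hxU => ⟨fun v hv => ?_, fun u => ⟨?_, ?_⟩⟩⟩
  · obtain ⟨k, hk⟩ := (hphi x hx hxU v).mp hv
    rw [← h.snd_eq_zero_iff x hx, hk]
  · rintro ⟨v, hv, rfl⟩
    obtain ⟨k, hk⟩ := (hphi x hx hxU v).mp hv
    exact ⟨k, by rw [LinearMap.fst_apply, ← h.fst_eq x hx, hk]⟩
  · rintro ⟨k, hk⟩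
    refine ⟨(u, 0), (hphi x hx hxU _).mpr ⟨k, ?_⟩, rfl⟩
    exact Prod.ext ((h.fst_eq x hx _).trans hk) ((h.snd_eq_zero_iff x hx _).mpr rfl)

end IsAdaptedChart

end Index

/-! ### Rulings on the manifold -/

section ManifoldRulings

variable {n m d : ℕ} {M : Type u} [TopologicalSpace M] [ChartedSpace (Euc n) M]

/-- The image of an open set under an injective affine map is open in its affine span. -/
theorem mapsOntoOpenOfAffine_of_image_eq {f : M → Euc m} {S : Set M} {B : Set (Euc d)}
    (hB : IsOpen B) (a : Euc m) {A : Euc d →L[ℝ] Euc m} (hA : Function.Injective A)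
    (hS : f '' S = (fun k => a + A k) '' B) : MapsOntoOpenOfAffine f d S := by
  obtain ⟨R, hR⟩ := LinearMap.exists_leftInverse_of_injective (A : Euc d →ₗ[ℝ] Euc m)
    (LinearMap.ker_eq_bot.mpr hA)
  have hRA : ∀ k, R.toContinuousLinearMap (A k) = k := fun k => congrArg (fun T => T k) hR
  refine ⟨AffineSubspace.mk' a (LinearMap.range (A : Euc d →ₗ[ℝ] Euc m)),
    (fun y => R.toContinuousLinearMap (y - a)) ⁻¹' B, ?_,
    hB.preimage (R.toContinuousLinearMap.continuous.comp (continuous_id.sub continuous_const)), ?_⟩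
  · rw [AffineSubspace.direction_mk', LinearMap.finrank_range_of_inj hA]
    simp
  · rw [hS]
    ext y
    simp only [Set.mem_image, Set.mem_inter_iff, Set.mem_preimage, SetLike.mem_coe,
      AffineSubspace.mem_mk']
    constructor
    · rintro ⟨k, hk, rfl⟩
      refine ⟨by rwa [add_sub_cancel_left, hRA], k, ?_⟩
      simp
    · rintro ⟨hy, k, hk⟩
      have hk' : A k = y - a := hk
      rw [← hk', hRA] at hy
      exact ⟨k, hy, by rw [hk', add_sub_cancel]⟩

/-- A distribution with a smooth frame in a chart is smooth. -/
theorem IsSmoothChart.exists_fields [IsManifold (𝓡 n) ∞ M] {φ : OpenPartialHomeomorph M (Euc n)}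
    (hφ : IsSmoothChart φ) {U : Set (Euc n)} (hUφ : U ⊆ φ.target)
    {z : Euc n → Euc d →L[ℝ] Euc n} (hz : ContDiffOn ℝ ∞ z U)
    (hinj : ∀ y ∈ U, Function.Injective (z y)) {D : ∀ x : M, Submodule ℝ (TangentSpace (𝓡 n) x)}
    (hD : ∀ x ∈ φ.source, φ x ∈ U → ∀ u, u ∈ D x ↔ ∃ k, chartDeriv φ x u = z (φ x) k) :
    ∃ X : Fin d → ∀ x : M, TangentSpace (𝓡 n) x,
      (∀ i, IsSmoothVectorField (φ.source ∩ φ ⁻¹' U) (X i)) ∧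
      ∀ x ∈ φ.source ∩ φ ⁻¹' U, LinearIndependent ℝ (fun i => X i x) ∧
        D x = Submodule.span ℝ (Set.range fun i => X i x) := by
  let b := (EuclideanSpace.basisFun (Fin d) ℝ).toBasis
  choose X hX hXz using fun i : Fin d =>
    hφ.exists_isSmoothVectorField hUφ (X := fun y => z y (b i)) (hz.clm_apply contDiffOn_const)
  refine ⟨X, hX, fun x hx => ⟨?_, ?_⟩⟩
  · refine LinearIndependent.of_comp
      (chartDeriv φ x : TangentSpace (𝓡 n) x →ₗ[ℝ] Euc n) ?_
    have : (chartDeriv φ x : TangentSpace (𝓡 n) x →ₗ[ℝ] Euc n) ∘ (fun i => X i x) =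
        (z (φ x) : Euc d →ₗ[ℝ] Euc n) ∘ b := funext fun i => hXz i x hx.1
    rw [this]
    exact b.linearIndependent.map' _ (LinearMap.ker_eq_bot.mpr (hinj _ hx.2))
  · ext u
    rw [hD x hx.1 hx.2, Submodule.mem_span_range_iff_exists_fun]
    have key : ∀ c : Fin d → ℝ, chartDeriv φ x (∑ i, c i • X i x) =
        z (φ x) (∑ i, c i • b i) := fun c => by
      rw [map_sum, map_sum]
      exact Finset.sum_congr rfl fun i _ => by rw [map_smul, map_smul, hXz i x hx.1]
    constructor
    · rintro ⟨k, hk⟩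
      refine ⟨b.equivFun k, (hφ.bijective_chartDeriv hx.1).1 ?_⟩
      rw [key, b.sum_equivFun, hk]
    · rintro ⟨c, rfl⟩
      exact ⟨_, key c⟩

/-- A submanifold through `σ 0`, on which the immersion `f` is affine, is a ruling: the second
derivative of `f ∘ σ` vanishes. -/
theorem isAffineRuling_of_affine {f : M → Euc m} (hf : ContMDiff (𝓡 n) (𝓡 m) ∞ f)
    (hinj : ∀ x, Function.Injective (diff (n := n) f x)) {C : Set M} {W : Set (Euc d)}
    {σ : Euc d → M} (hW : IsOpen W) (h0 : 0 ∈ W) (hmaps : Set.MapsTo σ W C)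
    (hσ : ContMDiffOn (𝓡 d) (𝓡 n) ∞ σ W) {a : Euc m} {A : Euc d →L[ℝ] Euc m}
    (hA : Function.Injective A) (hfσ : ∀ w ∈ W, f (σ w) = a + A w)
    {D : ∀ x : M, Submodule ℝ (TangentSpace (𝓡 n) x)}
    (hD : (D (σ 0)).map (diff (n := n) f (σ 0) : TangentSpace (𝓡 n) (σ 0) →ₗ[ℝ] Euc m) =
      LinearMap.range (A : Euc d →ₗ[ℝ] Euc m)) :
    IsAffineRuling f C d D W σ := by
  have hd : ∀ w ∈ W, HasFDerivAt (f ∘ σ) A w := by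
    intro w hw
    refine HasFDerivAt.congr_of_eventuallyEq (f := fun w => a + A w)
      (A.hasFDerivAt.const_add a) ?_
    filter_upwards [hW.mem_nhds hw] with y hy using hfσ y hy
  have hchain : ∀ w ∈ W, ∀ k : Euc d, diff f (σ w) (mfderiv (𝓡 d) (𝓡 n) σ w k) = A k := by
    intro w hw k
    have h1 := _root_.mfderiv_comp (I := 𝓡 d) (I' := 𝓡 n) (I'' := 𝓡 m) w
      ((hf (σ w)).mdifferentiableAt (by simp))
      ((hσ.contMDiffAt (hW.mem_nhds hw)).mdifferentiableAt (by simp))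
    rw [mfderiv_eq_fderiv, (hd w hw).fderiv] at h1
    exact (congrArg (fun T => T k) h1).symm
  refine ⟨hW, h0, hmaps, hσ, fun w hw k k' hk => hA ?_, ?_, ?_, fun w hw b c => ?_, ?_⟩
  · rw [← hchain w hw k, ← hchain w hw k', hk]
  · refine Topology.IsEmbedding.of_comp hσ.continuousOn.domRestrict hf.continuous ?_
    have h1 : Topology.IsEmbedding fun w : Euc d => a + A w :=
      (Homeomorph.addLeft a).isEmbedding.comp
        (LinearMap.isClosedEmbedding_of_injective (f := (A : Euc d →ₗ[ℝ] Euc m))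
          (LinearMap.ker_eq_bot.mpr hA)).isEmbedding
    have h2 : (f ∘ fun w : W => σ w) = (fun w : Euc d => a + A w) ∘ Subtype.val :=
      funext fun w => hfσ w w.2
    rw [h2]
    exact h1.comp Topology.IsEmbedding.subtypeVal
  · refine Submodule.map_injective_of_injective
      (f := (diff (n := n) f (σ 0) : TangentSpace (𝓡 n) (σ 0) →ₗ[ℝ] Euc m)) (hinj _) ?_
    simp only []
    rw [hD, ← LinearMap.range_comp]
    congr 1
    exact LinearMap.ext fun k => hchain 0 h0 k
  · have h1 : (fun z => fderiv ℝ (f ∘ σ) z c) =ᶠ[𝓝 w] fun _ => A c := by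
      filter_upwards [hW.mem_nhds hw] with z hz
      rw [(hd z hz).fderiv]
    rw [h1.fderiv_eq]
    simp
  · refine mapsOntoOpenOfAffine_of_image_eq hW a hA ?_
    rw [Set.image_image]
    exact Set.image_congr hfσ

/-- A ruling pair in a chart around `x₀` rules the immersions along a submanifold through `x₀`. -/
theorem IsRulingPair.exists_isAffineRuling {p q : ℕ} [IsManifold (𝓡 n) ∞ M]
    {f : M → Euc p} {f' : M → Euc q}
    (hf : ContMDiff (𝓡 n) (𝓡 p) ∞ f) (hf' : ContMDiff (𝓡 n) (𝓡 q) ∞ f')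
    (hinj : ∀ x, Function.Injective (diff (n := n) f x))
    (hinj' : ∀ x, Function.Injective (diff (n := n) f' x))
    {φ : OpenPartialHomeomorph M (Euc n)} (hφ : IsSmoothChart φ) {U : Set (Euc n)} {W : Set M}
    (hUφ : U ⊆ φ.target ∩ φ.symm ⁻¹' W) {z : Euc n → Euc d →L[ℝ] Euc n}
    (h : IsRulingPair U (fun y => f (φ.symm y)) (fun y => f' (φ.symm y)) z)
    {D : ∀ x : M, Submodule ℝ (TangentSpace (𝓡 n) x)} {x₀ : M}
    (hx₀ : x₀ ∈ φ.source) (hx₀U : φ x₀ ∈ U)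
    (hD : ∀ u, u ∈ D x₀ ↔ ∃ k, chartDeriv φ x₀ u = z (φ x₀) k) :
    ∃ (B : Set (Euc d)) (σ : Euc d → M), σ 0 = x₀ ∧
      IsAffineRuling f W d D B σ ∧ IsAffineRuling f' W d D B σ := by
  obtain ⟨O, Ψ, hO, h0, hΨ, hOΨ⟩ := h.exists_smooth_transport hx₀U
  let B : Set (Euc d) := (fun k => (φ x₀, k)) ⁻¹' O
  let σ : Euc d → M := fun k => φ.symm (Ψ (φ x₀, k))
  have hB : IsOpen B := hO.preimage (by fun_prop)
  have hσ0 : σ 0 = x₀ := by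
    simp only [σ]
    rw [(hOΨ _ h0).2.2.2.2 rfl, φ.left_inv hx₀]
  have hσ : ContMDiffOn (𝓡 d) (𝓡 n) ∞ σ B := by
    have h1 : ContDiffOn ℝ ∞ (fun k => Ψ (φ x₀, k)) B :=
      hΨ.comp (contDiff_const.prodMk contDiff_id).contDiffOn fun k hk => hk
    exact hφ.smooth_symm.comp h1.contMDiffOn fun k hk => (hUφ (hOΨ _ hk).2.1).1
  have hmaps : Set.MapsTo σ B W := fun k hk => (hUφ (hOΨ _ hk).2.1).2
  have key : ∀ {m : ℕ} {g : M → Euc m} (_ : ContMDiff (𝓡 n) (𝓡 m) ∞ g)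
      (_ : ∀ x, Function.Injective (diff (n := n) g x))
      (_ : ∀ k ∈ B, g (σ k) = g (φ.symm (φ x₀)) + pushFrame (fun y => g (φ.symm y)) z (φ x₀) k),
      IsAffineRuling g W d D B σ := by
    intro m g hg hginj hgσ
    have hdiff := fun u => hφ.diff_eq hx₀ (hg.contMDiffOn (s := φ.source)) u
    refine isAffineRuling_of_affine hg hginj hB h0 hmaps hσ ?_ hgσ ?_
    · intro k k' hk
      obtain ⟨u, hu⟩ := (hφ.bijective_chartDeriv hx₀).2 (z (φ x₀) k)
      obtain ⟨u', hu'⟩ := (hφ.bijective_chartDeriv hx₀).2 (z (φ x₀) k')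
      have hk' : diff g x₀ u = diff g x₀ u' := by
        rw [hdiff, hdiff, hu, hu']; exact hk
      refine h.injective_frame _ hx₀U ?_
      rw [← hu, ← hu', hginj x₀ hk']
    · rw [hσ0]
      ext w
      constructor
      · rintro ⟨u, hu, rfl⟩
        obtain ⟨k, hk⟩ := (hD u).mp hu
        refine ⟨k, ?_⟩
        refine Eq.trans ?_ (hdiff u).symm
        rw [hk]; rfl
      · rintro ⟨k, rfl⟩
        obtain ⟨u, hu⟩ := (hφ.bijective_chartDeriv hx₀).2 (z (φ x₀) k)
        refine ⟨u, (hD u).mpr ⟨k, hu⟩, (hdiff u).trans ?_⟩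
        rw [hu]; rfl
  exact ⟨B, σ, hσ0, key hf hinj fun k hk => (hOΨ _ hk).2.2.1,
    key hf' hinj' fun k hk => (hOΨ _ hk).2.2.2.1⟩

end ManifoldRulings

/-! ### Foliated charts and their leaves -/

/-- The derivative of a map with values in a subspace has values in the subspace. -/
theorem HasFDerivAt.apply_mem_of_eventually_mem {K : Type*} [NormedAddCommGroup K]
    [NormedSpace ℝ K] {m : ℕ} {h : K → Euc m} {h' : K →L[ℝ] Euc m} {k : K}
    (hh : HasFDerivAt h h' k) {S : Submodule ℝ (Euc m)} (hS : ∀ᶠ y in 𝓝 k, h y ∈ S) (v : K) :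
    h' v ∈ S := by
  have h1 : HasFDerivAt (fun y => Sᗮ.starProjection (h y)) (Sᗮ.starProjection ∘L h') k :=
    Sᗮ.starProjection.hasFDerivAt.comp k hh
  have h2 : (fun y => Sᗮ.starProjection (h y)) =ᶠ[𝓝 k] fun _ => 0 := by
    filter_upwards [hS] with y hy
    exact Submodule.starProjection_orthogonal_apply_eq_zero hy
  have h3 := congrArg (fun T => T v) ((h1.congr_of_eventuallyEq h2.symm).unique
    (hasFDerivAt_const 0 k))
  rw [← Submodule.orthogonal_orthogonal S]
  exact (Submodule.starProjection_apply_eq_zero_iff _).mp h3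

section Foliation

variable {n d : ℕ} {M : Type u} [TopologicalSpace M] [ChartedSpace (Euc n) M]
  {C : Type*} [NormedAddCommGroup C] [NormedSpace ℝ C]

/-- `e⁻¹ ∘ φ` are coordinates `(c, k)` of `M`, with values in the product of two balls, whose slices
`c = const` foliate the domain. -/
structure IsFoliatedChart (φ : OpenPartialHomeomorph M (Euc n))
    (e : OpenPartialHomeomorph (C × Euc d) (Euc n)) (r : ℝ) : Prop where
  chart : IsSmoothChart φ
  source_eq : e.source = Metric.ball 0 r ×ˢ Metric.ball 0 r
  target_subset : e.target ⊆ φ.target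
  smooth : ContDiffOn ℝ ∞ e e.source
  smooth_symm : ContDiffOn ℝ ∞ e.symm e.target

/-- The frame of the tangent spaces of the slices, in the chart `φ`. -/
noncomputable def sliceFrame (e : OpenPartialHomeomorph (C × Euc d) (Euc n)) (y : Euc n) :
    Euc d →L[ℝ] Euc n :=
  fderiv ℝ e (e.symm y) ∘L ContinuousLinearMap.inr ℝ C (Euc d)

/-- The distribution tangent to the slices. -/
noncomputable def sliceDistribution (φ : OpenPartialHomeomorph M (Euc n))
    (e : OpenPartialHomeomorph (C × Euc d) (Euc n)) (x : M) :
    Submodule ℝ (TangentSpace (𝓡 n) x) :=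
  (LinearMap.range (sliceFrame e (φ x) : Euc d →ₗ[ℝ] Euc n)).comap
    (chartDeriv φ x : TangentSpace (𝓡 n) x →ₗ[ℝ] Euc n)

theorem mem_sliceDistribution {φ : OpenPartialHomeomorph M (Euc n)}
    {e : OpenPartialHomeomorph (C × Euc d) (Euc n)} {x : M} {u : TangentSpace (𝓡 n) x} :
    u ∈ sliceDistribution φ e x ↔ ∃ k, chartDeriv φ x u = sliceFrame e (φ x) k :=
  ⟨fun ⟨k, hk⟩ => ⟨k, hk.symm⟩, fun ⟨k, hk⟩ => ⟨k, hk.symm⟩⟩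

namespace IsFoliatedChart

variable {φ : OpenPartialHomeomorph M (Euc n)} {e : OpenPartialHomeomorph (C × Euc d) (Euc n)}
  {r : ℝ} (h : IsFoliatedChart φ e r)

include h

theorem hasFDerivAt {p : C × Euc d} (hp : p ∈ e.source) : HasFDerivAt e (fderiv ℝ e p) p :=
  ((h.smooth.contDiffAt (e.open_source.mem_nhds hp)).differentiableAt (by simp)).hasFDerivAt

theorem hasFDerivAt_symm {y : Euc n} (hy : y ∈ e.target) :
    HasFDerivAt e.symm (fderiv ℝ e.symm y) y :=
  ((h.smooth_symm.contDiffAt (e.open_target.mem_nhds hy)).differentiableAt (by simp)).hasFDerivAt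

theorem fderiv_symm_sliceFrame {y : Euc n} (hy : y ∈ e.target) (k : Euc d) :
    fderiv ℝ e.symm y (sliceFrame e y k) = (0, k) := by
  have h1 := h.hasFDerivAt_symm hy
  have h2 := h.hasFDerivAt (e.map_target hy)
  rw [← e.right_inv hy] at h1
  have h3 : HasFDerivAt (fun p => e.symm (e p)) (ContinuousLinearMap.id ℝ (C × Euc d))
      (e.symm y) := by
    refine (hasFDerivAt_id _).congr_of_eventuallyEq ?_
    filter_upwards [e.open_source.mem_nhds (e.map_target hy)] with p hp using e.left_inv hp
  have h4 := congrArg (fun T => T (0, k)) ((h1.comp (e.symm y) h2).unique h3)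
  rw [e.right_inv hy] at h4
  exact h4

theorem injective_sliceFrame {y : Euc n} (hy : y ∈ e.target) :
    Function.Injective (sliceFrame e y) := by
  intro k k' hk
  have := congrArg (fderiv ℝ e.symm y) hk
  rw [h.fderiv_symm_sliceFrame hy, h.fderiv_symm_sliceFrame hy] at this
  exact (Prod.mk.inj this).2

theorem contDiffOn_sliceFrame : ContDiffOn ℝ ∞ (sliceFrame (C := C) (d := d) e) e.target :=
  ((h.smooth.fderiv_of_isOpen e.open_source (by simp)).comp h.smooth_symm
    fun _ hy => e.map_target hy).clm_comp contDiffOn_const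

theorem mem_source_iff {c : C} {k : Euc d} :
    (c, k) ∈ e.source ↔ c ∈ Metric.ball (0 : C) r ∧ k ∈ Metric.ball (0 : Euc d) r := by
  rw [h.source_eq]; rfl

theorem isPreconnected : IsPreconnected (φ.source ∩ φ ⁻¹' e.target) := by
  have h1 : φ.source ∩ φ ⁻¹' e.target = φ.symm '' (e '' e.source) := by
    rw [e.image_source_eq_target]
    ext x
    constructor
    · rintro ⟨hx, hxe⟩
      exact ⟨φ x, hxe, φ.left_inv hx⟩
    · rintro ⟨y, hy, rfl⟩
      exact ⟨φ.map_target (h.target_subset hy), by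
        rw [Set.mem_preimage, φ.right_inv (h.target_subset hy)]; exact hy⟩
  rw [h1]
  refine (IsPreconnected.image ?_ e e.continuousOn).image φ.symm ?_
  · rw [h.source_eq]
    exact ((convex_ball _ _).prod (convex_ball _ _)).isPreconnected
  · rw [e.image_source_eq_target]
    exact φ.continuousOn_symm.mono h.target_subset

/-- The leaves of the slice distribution are the slices. -/
theorem leaf_eq {x : M} (hx : x ∈ φ.source ∩ φ ⁻¹' e.target) :
    leaf (φ.source ∩ φ ⁻¹' e.target) (sliceDistribution φ e) x =
      {y | y ∈ φ.source ∩ φ ⁻¹' e.target ∧ (e.symm (φ y)).1 = (e.symm (φ x)).1} := by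
  ext y
  constructor
  · rintro ⟨γ, hγ, rfl, rfl, hγD⟩
    refine ⟨(hγD 1).1, ?_⟩
    -- the coordinate `c` has zero derivative along a curve tangent to the slices
    have hder : ∀ t, HasDerivAt (fun s => (e.symm (φ (γ s))).1) 0 t := by
      intro t
      obtain ⟨⟨ht, hte⟩, htD⟩ := hγD t
      obtain ⟨k, hk⟩ := mem_sliceDistribution.mp htD
      have h1 : MDifferentiableAt 𝓘(ℝ, ℝ) (𝓡 n) γ t := (hγ t).mdifferentiableAt (by simp)
      have h2 := (h.chart.mdifferentiableAt ht).comp t h1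
      have h3 : HasFDerivAt (fun s => φ (γ s)) (fderiv ℝ (fun s => φ (γ s)) t) t :=
        (mdifferentiableAt_iff_differentiableAt.mp h2).hasFDerivAt
      have h4 := _root_.mfderiv_comp t (h.chart.mdifferentiableAt ht) h1
      rw [mfderiv_eq_fderiv] at h4
      have h5 : fderiv ℝ (fun s => φ (γ s)) t 1 = sliceFrame e (φ (γ t)) k :=
        (congrArg (fun T => T (1 : ℝ)) h4).trans hk
      have h6 := (((h.hasFDerivAt_symm hte).comp t h3).fst).hasDerivAt
      have h7 : ((ContinuousLinearMap.fst ℝ C (Euc d)).comp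
          ((fderiv ℝ e.symm (φ (γ t))).comp (fderiv ℝ (fun s => φ (γ s)) t))) 1 = 0 := by
        simp only [ContinuousLinearMap.comp_apply, h5, h.fderiv_symm_sliceFrame hte,
          ContinuousLinearMap.coe_fst']
      rw [h7] at h6
      exact h6
    exact is_const_of_deriv_eq_zero (fun t => (hder t).differentiableAt)
      (fun t => (hder t).deriv) 1 0
  · rintro ⟨⟨hy, hye⟩, hc⟩
    obtain ⟨hxφ, hxe⟩ := hx
    have hxs := e.map_target hxe
    have hys := e.map_target hye
    have hxr := e.right_inv hxe
    have hyr := e.right_inv hye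
    rcases hp : e.symm (φ x) with ⟨c, k⟩
    rcases hp' : e.symm (φ y) with ⟨c', k'⟩
    rw [hp, hp'] at hc
    obtain rfl : c' = c := hc
    rw [hp] at hxs hxr
    rw [hp'] at hys hyr
    -- a segment in the slice, reparametrized to stay in the slice for all times
    let s : ℝ → C × Euc d := fun t => (c', k + Real.smoothTransition t • (k' - k))
    have hs : ContDiff ℝ ∞ s := contDiff_const.prodMk (contDiff_const.add
      (Real.smoothTransition.contDiff.smul contDiff_const))
    have hse : ∀ t, s t ∈ e.source := by
      intro t
      rw [h.mem_source_iff] at hxs hys ⊢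
      exact ⟨hxs.1, (convex_ball (0 : Euc d) r).add_smul_sub_mem hxs.2 hys.2
        ⟨Real.smoothTransition.nonneg t, Real.smoothTransition.le_one t⟩⟩
    have hes : ContDiff ℝ ∞ fun t => e (s t) := h.smooth.comp_contDiff hs hse
    have hesφ : ∀ t, e (s t) ∈ φ.target := fun t => h.target_subset (e.map_source (hse t))
    have hγ : ContMDiff 𝓘(ℝ, ℝ) (𝓡 n) ∞ fun t => φ.symm (e (s t)) :=
      h.chart.smooth_symm.comp_contMDiff hes.contMDiff hesφ
    refine ⟨fun t => φ.symm (e (s t)), hγ, ?_, ?_, fun t => ?_⟩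
    · simp only [s, Real.smoothTransition.zero, zero_smul, add_zero]
      rw [hxr, φ.left_inv hxφ]
    · simp only [s, Real.smoothTransition.one, one_smul, add_sub_cancel]
      rw [hyr, φ.left_inv hy]
    · have ht : φ.symm (e (s t)) ∈ φ.source := φ.map_target (hesφ t)
      refine ⟨⟨ht, by rw [Set.mem_preimage, φ.right_inv (hesφ t)]; exact e.map_source (hse t)⟩, ?_⟩
      have h1 : MDifferentiableAt 𝓘(ℝ, ℝ) (𝓡 n) (fun t => φ.symm (e (s t))) t :=
        (hγ t).mdifferentiableAt (by simp)
      have h4 := _root_.mfderiv_comp t (h.chart.mdifferentiableAt ht) h1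
      rw [mfderiv_eq_fderiv, show (φ ∘ fun t => φ.symm (e (s t))) = fun t => e (s t) from
        funext fun t => φ.right_inv (hesφ t)] at h4
      obtain ⟨κ, hκ⟩ : ∃ κ, fderiv ℝ s t 1 = (0, κ) := by
        refine ⟨(fderiv ℝ s t 1).2, Prod.ext ?_ rfl⟩
        have h5 := ((hs.differentiable (by simp) t).hasFDerivAt.fst).unique
          (hasFDerivAt_const c' t)
        exact congrArg (fun T => T (1 : ℝ)) h5
      refine mem_sliceDistribution.mpr ⟨κ, ?_⟩
      have h6 : fderiv ℝ (fun t => e (s t)) t 1 = fderiv ℝ e (s t) (0, κ) := by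
        have h7 := ((h.hasFDerivAt (hse t)).comp t
          (hs.differentiable (by simp) t).hasFDerivAt).fderiv
        rw [← hκ]
        exact congrArg (fun T => T (1 : ℝ)) h7
      refine Eq.trans ?_ (h6.trans ?_)
      · exact (congrArg (fun T => T (1 : ℝ)) h4).symm
      · rw [φ.right_inv (hesφ t), sliceFrame, e.left_inv (hse t)]
        rfl

variable {m : ℕ} {f : M → Euc m} (hf : ContMDiff (𝓡 n) (𝓡 m) ∞ f) {a : C → Euc m}
  {A : C → Euc d →L[ℝ] Euc m} (hA : ∀ c k, (c, k) ∈ e.source →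
    f (φ.symm (e (c, k))) = a c + A c k ∧ Function.Injective (A c))

include hf hA

/-- Along the slice through `x`, `f` is affine with linear part `A c`. -/
theorem diff_apply_of_sliceFrame {x : M} (hx : x ∈ φ.source ∩ φ ⁻¹' e.target)
    {u : TangentSpace (𝓡 n) x} {k : Euc d} (hu : chartDeriv φ x u = sliceFrame e (φ x) k) :
    diff f x u = A (e.symm (φ x)).1 k := by
  have hfs := h.chart.contDiffOn_comp_symm (hf.contMDiffOn (s := φ.source)) subset_rfl
  have hd : HasFDerivAt (fun y => f (φ.symm y)) (fderiv ℝ (fun y => f (φ.symm y)) (φ x)) (φ x) :=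
    ((hfs.contDiffAt (φ.open_target.mem_nhds (φ.map_source hx.1))).differentiableAt
      (by simp)).hasFDerivAt
  have hp := e.map_target hx.2
  have hd' := h.hasFDerivAt hp
  rw [h.chart.diff_eq hx.1 (hf.contMDiffOn (s := φ.source)), hu]
  have hr := e.right_inv hx.2
  rw [← hr] at hd
  rw [sliceFrame]
  rcases hck : e.symm (φ x) with ⟨c, k₀⟩
  rw [hck] at hp hd hd' hr
  have h1 : HasFDerivAt (fun k' : Euc d => f (φ.symm (e (c, k')))) _ k₀ :=
    (hd.comp (c, k₀) hd').comp k₀ (hasFDerivAt_prodMk_right c k₀)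
  have h2 : HasFDerivAt (fun k' : Euc d => f (φ.symm (e (c, k')))) (A c) k₀ := by
    refine HasFDerivAt.congr_of_eventuallyEq (f := fun k' => a c + A c k')
      ((A c).hasFDerivAt.const_add (a c)) ?_
    have : (fun k' : Euc d => (c, k')) ⁻¹' e.source ∈ 𝓝 k₀ :=
      (e.open_source.preimage (by fun_prop)).mem_nhds hp
    filter_upwards [this] with k' hk' using (hA c k' hk').1
  have h3 := congrArg (fun T => T k) (h1.unique h2)
  rw [hr] at h3
  exact h3

theorem map_sliceDistribution {x : M} (hx : x ∈ φ.source ∩ φ ⁻¹' e.target) :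
    (sliceDistribution φ e x).map (diff (n := n) f x : TangentSpace (𝓡 n) x →ₗ[ℝ] Euc m) =
      LinearMap.range (A (e.symm (φ x)).1 : Euc d →ₗ[ℝ] Euc m) := by
  ext w
  constructor
  · rintro ⟨u, hu, rfl⟩
    obtain ⟨k, hk⟩ := mem_sliceDistribution.mp hu
    exact ⟨k, (h.diff_apply_of_sliceFrame hf hA hx hk).symm⟩
  · rintro ⟨k, rfl⟩
    obtain ⟨u, hu⟩ := (h.chart.bijective_chartDeriv hx.1).2 (sliceFrame e (φ x) k)
    exact ⟨u, mem_sliceDistribution.mpr ⟨k, hu⟩, h.diff_apply_of_sliceFrame hf hA hx hu⟩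

/-- If `f` is affine on the slices, then the images of the sections of the slice distribution have
values in a constant subspace along each slice; hence the slice distribution is totally geodesic. -/
theorem isTotallyGeodesicDistribution [IsManifold (𝓡 n) ∞ M] :
    IsTotallyGeodesicDistribution f (φ.source ∩ φ ⁻¹' e.target) (sliceDistribution φ e) := by
  intro U Y hU hUG hY hYD x hxU u hu
  have hx := hUG hxU
  rw [h.map_sliceDistribution hf hA hx]
  have hmem : ambientDeriv (fun y => diff f y (Y y)) x u ∈
      LinearMap.range (A (e.symm (φ x)).1 : Euc d →ₗ[ℝ] Euc m) := by
    by_cases hξ : MDifferentiableAt (𝓡 n) (𝓡 m) (fun y => diff f y (Y y)) x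
    swap
    -- the derivative of a map which is not differentiable is zero by convention
    · rw [ambientDeriv, diff, mfderiv_zero_of_not_mdifferentiableAt hξ]
      exact Submodule.zero_mem _
    have hs : MDifferentiableAt (𝓡 n) (𝓡 n) φ.symm (φ x) :=
      h.chart.mdifferentiable.mdifferentiableAt_symm (φ.map_source hx.1)
    have hd : DifferentiableAt ℝ (fun y => diff f (φ.symm y) (Y (φ.symm y))) (φ x) := by
      rw [← mdifferentiableAt_iff_differentiableAt]
      exact MDifferentiableAt.comp (I' := 𝓡 n) (φ x) (g := fun y => diff f y (Y y))
        (by rw [φ.left_inv hx.1]; exact hξ) hs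
    obtain ⟨κ, hκ⟩ := mem_sliceDistribution.mp hu
    rw [ambientDeriv, h.chart.diff_eq_of_eventuallyEq hx.1 hd
      (φ.eventuallyEq_comp_symm hx.1 fun y => diff f y (Y y)), hκ]
    have hp := e.map_target hx.2
    have hr := e.right_inv hx.2
    have hd1 := hd.hasFDerivAt
    rw [← hr] at hd1
    have hd2 := h.hasFDerivAt hp
    rw [sliceFrame]
    rcases hck : e.symm (φ x) with ⟨c, k₀⟩
    rw [hck] at hp hr hd1 hd2
    have h1 := (hd1.comp (c, k₀) hd2).comp k₀ (hasFDerivAt_prodMk_right c k₀)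
    have h2 := h1.apply_mem_of_eventually_mem
      (S := LinearMap.range (A c : Euc d →ₗ[ℝ] Euc m)) ?_ κ
    · rw [hr] at h2
      exact h2
    · have hxc : φ.symm (e (c, k₀)) = x := by rw [hr, φ.left_inv hx.1]
      have hcont : ContinuousAt (fun k' : Euc d => φ.symm (e (c, k'))) k₀ := by
        have h3 : ContinuousAt (fun k' : Euc d => e (c, k')) k₀ :=
          ContinuousAt.comp (g := e) (e.continuousAt hp) (by fun_prop)
        exact ContinuousAt.comp (g := φ.symm)
          (φ.symm.continuousAt (h.target_subset (e.map_source hp))) h3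
      have h4 : ∀ᶠ k' in 𝓝 k₀, φ.symm (e (c, k')) ∈ U :=
        hcont (hU.mem_nhds (by simp only []; rw [hxc]; exact hxU))
      have h5 : (fun k' : Euc d => (c, k')) ⁻¹' e.source ∈ 𝓝 k₀ :=
        (e.open_source.preimage (by fun_prop)).mem_nhds hp
      filter_upwards [h4, h5] with k' hk' hk's
      have h6 : (diff f (φ.symm (e (c, k'))) (Y (φ.symm (e (c, k'))))) ∈
          LinearMap.range (A (e.symm (φ (φ.symm (e (c, k'))))).1 : Euc d →ₗ[ℝ] Euc m) := by
        rw [← h.map_sliceDistribution hf hA (hUG hk')]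
        exact ⟨_, hYD _ hk', rfl⟩
      rw [φ.right_inv (h.target_subset (e.map_source hk's)), e.left_inv hk's] at h6
      exact h6
  rw [Submodule.starProjection_eq_self_iff.mpr ?_]
  · exact hmem
  · rw [← h.map_sliceDistribution hf hA hx] at hmem
    obtain ⟨v, -, hv⟩ := hmem
    exact ⟨v, hv⟩

/-- If `f` is affine on the slices, then it is ruled by the slice distribution. -/
theorem isRuledBy [IsManifold (𝓡 n) ∞ M] :
    IsRuledBy f (φ.source ∩ φ ⁻¹' e.target) d (sliceDistribution φ e) := by
  refine ⟨fun x hx => ?_, h.isTotallyGeodesicDistribution hf hA, fun x hx => ?_⟩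
  · obtain ⟨X, hX, hXD⟩ := h.chart.exists_fields h.target_subset h.contDiffOn_sliceFrame
      (fun y hy => h.injective_sliceFrame hy) (D := sliceDistribution φ e)
      (fun x _ _ u => mem_sliceDistribution)
    exact ⟨_, X, φ.isOpen_inter_preimage e.open_target, hx, subset_rfl, hX, hXD⟩
  · have hp := e.map_target hx.2
    rw [h.leaf_eq hx]
    rcases hck : e.symm (φ x) with ⟨c, k₀⟩
    rw [hck] at hp
    refine mapsOntoOpenOfAffine_of_image_eq (Metric.isOpen_ball (x := (0 : Euc d)) (ε := r)) (a c)
      (hA c k₀ hp).2 ?_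
    rw [h.mem_source_iff] at hp
    ext w
    constructor
    · rintro ⟨y, ⟨hy, hyc⟩, rfl⟩
      have hq := e.map_target hy.2
      have hqr := e.right_inv hy.2
      rcases hck' : e.symm (φ y) with ⟨c', k⟩
      rw [hck'] at hq hqr hyc
      obtain rfl : c' = c := hyc
      refine ⟨k, (h.mem_source_iff.mp hq).2, ?_⟩
      simp only []
      rw [← (hA _ k hq).1, hqr, φ.left_inv hy.1]
    · rintro ⟨k, hk, rfl⟩
      have hs : (c, k) ∈ e.source := h.mem_source_iff.mpr ⟨hp.1, hk⟩
      have ht := h.target_subset (e.map_source hs)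
      refine ⟨φ.symm (e (c, k)), ⟨⟨φ.map_target ht, ?_⟩, ?_⟩, (hA c k hs).1⟩
      · rw [Set.mem_preimage, φ.right_inv ht]; exact e.map_source hs
      · rw [φ.right_inv ht, e.left_inv hs]

end IsFoliatedChart

end Foliation

/-! ### The open dense set -/

/-- If every nonempty open set contains a nonempty connected open set with the property `P`, then
there is an open dense set whose connected components have the property `P`: the union of a maximal
family of pairwise disjoint sets of this kind. -/
theorem exists_isOpen_dense_connectedComponentIn {X : Type*} [TopologicalSpace X]
    {P : Set X → Prop} (hP : ∀ O : Set X, IsOpen O → O.Nonempty →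
      ∃ G ⊆ O, IsOpen G ∧ IsPreconnected G ∧ G.Nonempty ∧ P G) :
    ∃ V : Set X, IsOpen V ∧ Dense V ∧ ∀ x ∈ V, P (connectedComponentIn V x) := by
  let 𝒮 : Set (Set (Set X)) :=
    {F | (∀ G ∈ F, IsOpen G ∧ IsPreconnected G ∧ G.Nonempty ∧ P G) ∧ F.PairwiseDisjoint id}
  obtain ⟨F, hF⟩ := zorn_subset 𝒮 fun c hc hchain => by
    refine ⟨⋃₀ c, ⟨?_, ?_⟩, fun s hs => Set.subset_sUnion_of_mem hs⟩
    · rintro G ⟨s, hs, hG⟩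
      exact (hc hs).1 G hG
    · rw [Set.pairwiseDisjoint_sUnion hchain.directedOn]
      exact fun s hs => (hc hs).2
  obtain ⟨hFgood, hFdisj⟩ := hF.prop
  have hopen : ∀ F' ⊆ F, IsOpen (⋃₀ F') := fun F' hF' =>
    isOpen_sUnion fun G hG => (hFgood G (hF' hG)).1
  refine ⟨⋃₀ F, hopen F subset_rfl, ?_, ?_⟩
  · rw [dense_iff_inter_open]
    intro O hO hne
    obtain ⟨G, hGO, hGo, hGc, hGne, hGP⟩ := hP O hO hne
    by_contra hempty
    rw [Set.not_nonempty_iff_eq_empty] at hempty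
    have hdisj : ∀ G' ∈ F, Disjoint G G' := fun G' hG' => by
      rw [Set.disjoint_left]
      intro x hx hx'
      have : x ∈ O ∩ ⋃₀ F := ⟨hGO hx, G', hG', hx'⟩
      rw [hempty] at this
      exact this
    have hins : insert G F ∈ 𝒮 := by
      refine ⟨?_, hFdisj.insert fun G' hG' _ => hdisj G' hG'⟩
      rintro G' (rfl | hG')
      · exact ⟨hGo, hGc, hGne, hGP⟩
      · exact hFgood G' hG'
    have hGF : G ∈ F := hF.le_of_ge hins (Set.subset_insert G F) (Set.mem_insert G F)
    obtain ⟨x, hx⟩ := hGne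
    exact Set.disjoint_left.mp (hdisj G hGF) hx hx
  · rintro x ⟨G, hG, hxG⟩
    obtain ⟨hGo, hGc, hGne, hGP⟩ := hFgood G hG
    have hxV : x ∈ ⋃₀ F := ⟨G, hG, hxG⟩
    have hcomp : connectedComponentIn (⋃₀ F) x = G := by
      refine subset_antisymm ?_ (hGc.subset_connectedComponentIn hxG
        (Set.subset_sUnion_of_mem hG))
      refine isPreconnected_connectedComponentIn.subset_left_of_subset_union hGo
        (hopen (F \ {G}) Set.sdiff_subset) ?_ ?_ ⟨x, mem_connectedComponentIn hxV, hxG⟩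
      · rw [Set.disjoint_sUnion_right]
        rintro G' ⟨hG', hne⟩
        exact hFdisj hG hG' (Ne.symm hne)
      · refine (connectedComponentIn_subset _ _).trans ?_
        rintro y ⟨G', hG', hy⟩
        by_cases hGG : G' = G
        · exact Or.inl (hGG ▸ hy)
        · exact Or.inr ⟨G', ⟨hG', hGG⟩, hy⟩
    rw [hcomp]
    exact hGP

section Conclusion

variable {n p q ℓ : ℕ} {M : Type u} [TopologicalSpace M] [ChartedSpace (Euc n) M]
  [IsManifold (𝓡 n) ∞ M]

variable {f : M → Euc (n + p)} {f' : M → Euc (n + q)}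
  {L : M → Submodule ℝ (Euc (n + p))} {L' : M → Submodule ℝ (Euc (n + q))}
  {τ : ∀ x, L x ≃ₗᵢ[ℝ] L' x}

/-- The kernel of `φ_τ^Y`, for a regular vector field `Y`, is tangent to `M` and rules `f` and
`f'`. -/
theorem mutuallyBarRuled_phiKerTangent
    (hf : ContMDiff (𝓡 n) (𝓡 (n + p)) ∞ f) (hf' : ContMDiff (𝓡 n) (𝓡 (n + q)) ∞ f')
    (hinj : ∀ x, Function.Injective (diff (n := n) f x))
    (hinj' : ∀ x, Function.Injective (diff (n := n) f' x))
    (hgen : IsStronglyGenuineDeformation (n := n) f f')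
    (hchart : ∀ x₀ : M, ∃ (φ : OpenPartialHomeomorph M (Euc n))
      (B₁ : Euc n → Euc n × (Fin ℓ → ℝ) →L[ℝ] Euc (n + p))
      (B₂ : Euc n → Euc n × (Fin ℓ → ℝ) →L[ℝ] Euc (n + q))
      (J : ∀ x : M, (TangentSpace (𝓡 n) x × L x) → Euc n × (Fin ℓ → ℝ)),
      x₀ ∈ φ.source ∧ IsAdaptedChart f f' τ φ B₁ B₂ J)
    {W : Set M} (hW : IsOpen W) {Y : ∀ x : M, TangentSpace (𝓡 n) x}
    (hY : IsSmoothVectorField W Y) (hreg : ∀ x ∈ W, IsRegularElement f f' τ x (Y x)) {d i : ℕ}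
    (hi : ∀ x ∈ W, phiIndex (n := n) f f' τ x = i) (hd : d + i = n + ℓ) :
    (∀ x ∈ W, ∀ v ∈ phiKer f f' τ Y x, v.2 = 0) ∧
      MutuallyBarRuled f f' W d (phiKerTangent f f' τ Y) := by
  refine ⟨fun x hx => ?_, fun x hx => ?_, fun x hx => ?_⟩
  · obtain ⟨φ, B₁, B₂, J, hxφ, h⟩ := hchart x
    obtain ⟨U, z, hxU, hUW, hpair, hker⟩ := h.exists_isRulingPair hgen hW hY hreg hi hd hxφ hx
    exact (hker x hxφ hxU).1
  · obtain ⟨φ, B₁, B₂, J, hxφ, h⟩ := hchart x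
    obtain ⟨U, z, hxU, hUW, hpair, hker⟩ := h.exists_isRulingPair hgen hW hY hreg hi hd hxφ hx
    obtain ⟨X, hX, hXD⟩ := h.chart.exists_fields (fun y hy => (hUW hy).1) hpair.smooth_frame
      hpair.injective_frame (D := phiKerTangent f f' τ Y) fun x hx hxU => (hker x hx hxU).2
    refine ⟨_, X, φ.isOpen_inter_preimage hpair.isOpen, ⟨hxφ, hxU⟩, fun y hy => ?_, hX, hXD⟩
    have := (hUW hy.2).2
    rwa [Set.mem_preimage, φ.left_inv hy.1] at this
  · obtain ⟨φ, B₁, B₂, J, hxφ, h⟩ := hchart x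
    obtain ⟨U, z, hxU, hUW, hpair, hker⟩ := h.exists_isRulingPair hgen hW hY hreg hi hd hxφ hx
    exact hpair.exists_isAffineRuling hf hf' hinj hinj' h.chart hUW hxφ hxU (hker x hxφ hxU).2

/-- Every nonempty open set contains a nonempty connected open set along which `φ_τ` has constant
index and the immersions are ruled: near a point at which the index is maximal, a constant
coordinate field is regular. -/
theorem exists_mutuallyRuled
    (hf : ContMDiff (𝓡 n) (𝓡 (n + p)) ∞ f) (hf' : ContMDiff (𝓡 n) (𝓡 (n + q)) ∞ f')
    (hgen : IsStronglyGenuineDeformation (n := n) f f')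
    (hchart : ∀ x₀ : M, ∃ (φ : OpenPartialHomeomorph M (Euc n))
      (B₁ : Euc n → Euc n × (Fin ℓ → ℝ) →L[ℝ] Euc (n + p))
      (B₂ : Euc n → Euc n × (Fin ℓ → ℝ) →L[ℝ] Euc (n + q))
      (J : ∀ x : M, (TangentSpace (𝓡 n) x × L x) → Euc n × (Fin ℓ → ℝ)),
      x₀ ∈ φ.source ∧ IsAdaptedChart f f' τ φ B₁ B₂ J)
    {O : Set M} (hO : IsOpen O) (hne : O.Nonempty) :
    ∃ G ⊆ O, IsOpen G ∧ IsPreconnected G ∧ G.Nonempty ∧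
      ∃ i d : ℕ, (∀ x ∈ G, phiIndex (n := n) f f' τ x = i) ∧ d + i = n + ℓ ∧
        (n : ℤ) - p - q + 3 * ℓ ≤ d ∧ MutuallyRuled n f f' G d := by
  have hle : ∀ x, phiIndex (n := n) f f' τ x ≤ n + ℓ := by
    intro x
    obtain ⟨φ, B₁, B₂, J, hxφ, h⟩ := hchart x
    obtain ⟨u, hu⟩ := h.exists_isRegularElement hxφ
    have := h.finrank_ker_add_phiIndex hxφ hu
    omega
  have hbdd : BddAbove (phiIndex (n := n) f f' τ '' O) :=
    ⟨n + ℓ, by rintro _ ⟨x, -, rfl⟩; exact hle x⟩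
  obtain ⟨x₀, hx₀O, hx₀⟩ := Nat.sSup_mem (hne.image _) hbdd
  have hmax : ∀ x ∈ O, phiIndex (n := n) f f' τ x ≤ phiIndex (n := n) f f' τ x₀ :=
    fun x hx => hx₀ ▸ le_csSup hbdd ⟨x, hx, rfl⟩
  obtain ⟨φ, B₁, B₂, J, hx₀φ, h⟩ := hchart x₀
  obtain ⟨v, hv⟩ := h.eventually_phiIndex_le hx₀φ
  obtain ⟨N, hN, hNo, hx₀N⟩ := eventually_nhds_iff.mp hv
  obtain ⟨Y, hY, hYv⟩ := h.chart.exists_isSmoothVectorField subset_rfl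
    (contDiffOn_const (c := v) (s := φ.target))
  have hWsub : φ.source ∩ (O ∩ N) ⊆ φ.source ∩ φ ⁻¹' φ.target :=
    fun x hx => ⟨hx.1, φ.map_source hx.1⟩
  have hrank : ∀ x ∈ φ.source ∩ (O ∩ N), phiIndex (n := n) f f' τ x₀ ≤ phiRank f f' τ x (Y x) :=
    fun x hx => hN x hx.2.2 (Y x) (hYv x hx.1)
  have hi : ∀ x ∈ φ.source ∩ (O ∩ N),
      phiIndex (n := n) f f' τ x = phiIndex (n := n) f f' τ x₀ := fun x hx =>
    le_antisymm (hmax x hx.2.1) ((hrank x hx).trans (h.phiRank_le_phiIndex hx.1 _))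
  have hreg : ∀ x ∈ φ.source ∩ (O ∩ N), IsRegularElement f f' τ x (Y x) := fun x hx =>
    le_antisymm (h.phiRank_le_phiIndex hx.1 _) ((hi x hx).trans_le (hrank x hx))
  have hd := Nat.sub_add_cancel (hle x₀)
  obtain ⟨U, z, hx₀U, hUW, hpair, -⟩ := h.exists_isRulingPair hgen
    (φ.open_source.inter (hO.inter hNo)) (hY.mono hWsub) hreg hi hd hx₀φ ⟨hx₀φ, hx₀O, hx₀N⟩
  obtain ⟨C, r, e, a₁, A₁, a₂, A₂, hr, hes, het, hesm, hesym, hA⟩ :=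
    hpair.exists_foliated_chart hx₀U
  have hfol : IsFoliatedChart φ e r :=
    ⟨h.chart, hes, fun y hy => (hUW (het hy)).1, hesm, hesym⟩
  have hGW : φ.source ∩ φ ⁻¹' e.target ⊆ φ.source ∩ (O ∩ N) := by
    intro x hx
    have := (hUW (het hx.2)).2
    rwa [Set.mem_preimage, φ.left_inv hx.1] at this
  refine ⟨φ.source ∩ φ ⁻¹' e.target, fun x hx => (hGW hx).2.1,
    φ.isOpen_inter_preimage e.open_target, hfol.isPreconnected, ?_, _, _,
    fun x hx => hi x (hGW hx), hd, ?_, sliceDistribution φ e,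
    hfol.isRuledBy hf fun c k hck => ⟨(hA c k hck).1, (hA c k hck).2.2.1⟩,
    hfol.isRuledBy hf' fun c k hck => ⟨(hA c k hck).2.1, (hA c k hck).2.2.2⟩⟩
  · have h0 : e (0, 0) ∈ e.target := e.map_source (hfol.mem_source_iff.mpr
      ⟨Metric.mem_ball_self hr, Metric.mem_ball_self hr⟩)
    have h1 := hfol.target_subset h0
    exact ⟨φ.symm (e (0, 0)), φ.map_target h1, by
      rw [Set.mem_preimage, φ.right_inv h1]; exact h0⟩
  · have := h.phiIndex_add_le hx₀φ
    omega

end Conclusion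

theorem mainTheorem4 {n p q ℓ : ℕ} {M : Type u} [TopologicalSpace M] [T2Space M]
    [SecondCountableTopology M] [ChartedSpace (Euc n) M] [IsManifold (𝓡 n) ∞ M]
    (g : Bundle.ContMDiffRiemannianMetric (𝓡 n) ∞ (Euc n)
      (fun x : M => TangentSpace (𝓡 n) x))
    (f : M → Euc (n + p)) (f' : M → Euc (n + q))
    (hf : IsIsometricImmersion g f) (hf' : IsIsometricImmersion g f')
    (hgen : IsStronglyGenuineDeformation (n := n) f f')
    (L : M → Submodule ℝ (Euc (n + p))) (L' : M → Submodule ℝ (Euc (n + q)))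
    (hL : IsNormalSubbundle (n := n) f ℓ L) (hL' : IsNormalSubbundle (n := n) f' ℓ L')
    (τ : ∀ x, L x ≃ₗᵢ[ℝ] L' x) (hτ : IsSmoothBundleMap (n := n) τ)
    (hsff : PreservesSff (n := n) f f' τ) (hpar : IsParallel (n := n) f f' τ) :
    ∃ V : Set M, IsOpen V ∧ Dense V ∧
      ∀ x₀ ∈ V, ∃ i d : ℕ,
        (∀ x ∈ connectedComponentIn V x₀, phiIndex (n := n) f f' τ x = i) ∧
        d + i = n + ℓ ∧ (n : ℤ) - p - q + 3 * ℓ ≤ d ∧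
        (∀ (W : Set M) (Y : ∀ x : M, TangentSpace (𝓡 n) x),
          IsOpen W → W ⊆ connectedComponentIn V x₀ → IsSmoothVectorField W Y →
          (∀ x ∈ W, IsRegularElement f f' τ x (Y x)) →
          (∀ x ∈ W, ∀ v ∈ phiKer f f' τ Y x, v.2 = 0) ∧
            MutuallyBarRuled f f' W d (phiKerTangent f f' τ Y)) ∧
        MutuallyRuled n f f' (connectedComponentIn V x₀) d := by
  have hchart := exists_isAdaptedChart g f f' hf hf' L L' hL hL' τ hτ hsff hpar
  obtain ⟨V, hV, hVd, hVC⟩ := exists_isOpen_dense_connectedComponentIn fun O hO hne =>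
    exists_mutuallyRuled (τ := τ) hf.1 hf'.1 hgen hchart hO hne
  refine ⟨V, hV, hVd, fun x₀ hx₀ => ?_⟩
  obtain ⟨i, d, hi, hd, hle, hruled⟩ := hVC x₀ hx₀
  exact ⟨i, d, hi, hd, hle, fun W Y hW hWC hY hreg =>
    mutuallyBarRuled_phiKerTangent hf.1 hf'.1 hf.injective_diff hf'.injective_diff hgen hchart hW hY
      hreg (fun x hx => hi x (hWC hx)) hd, hruled⟩
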